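/- **Notation.** Write $[N]=\{1,\dots,N\}$ and $b_N=1+\lceil\log_2 N\rceil$. A vector is $k$-sparse if it has at most $k$ nonzero entries, and $\|u-u_k\|_q=\inf\{\|u-v\|_q : v\in\mathbb C^N\ k\text{-sparse}\}$ is the error of a best $k$-sparse approximation of $u$. A matrix $M$ is an $\varepsilon$-JL map of a set $S\subset\mathbb C^N$ if $(1-\varepsilon)\|x\|_2^2\le\|Mx\|_2^2\le(1+\varepsilon)\|x\|_2^2$ for all $x\in S$; it has the RIP of order $(k,\varepsilon)$ if it is an $\varepsilon$-JL map of the set of all $k$-sparse vectors. A matrix $W\in\{0,1\}^{m'\times N}$ is $(K,\alpha)$-coherent if each of its columns contains at least $K$ ones and any two distinct columns have inner product at most $\alpha$. The bit testing matrix $B_N\in\{0,1\}^{b_N\times N}$ has as its $j$-th column a $1$ followed by $j-1$ in binary; $B_N'\in\{0,1\}^{2b_N\times N}$ is obtained by appending to each column of $B_N$ its binary complement. $W\odot B$ is the Khatri–Rao (column-wise Kronecker) product. **Theorem.** There are an absolute constant $C>0$ and a fixed program for a random access machine with real registers such that the following holds. Let $N\ge 2$, let $r,s,1/\varepsilon\in[N]$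 and $p\in(0,1)$, and set $$t=\max\Big\{4s,\ \frac{512\,r\,\lceil\ln(231N/p)\rceil}{\varepsilon}\Big\},\qquad K=t\,\lceil\log_tN\rceil .$$ There exist a $(K,\lfloor\log_KN\rfloor)$-coherent matrix $W\in\{0,1\}^{m'\times N}$ and a function $f:\mathbb C^m\to\mathbb C^N$, where $m=2b_Nm'$, such that: * every column of $W$ contains exactly $K$ ones; $W$ is also $(K,\alpha)$-coherent for some integer $\alpha\ge0$ with $K\ge4\alpha s+1$; $\widetilde W=\frac1{\sqrt{Kb_N}}\,W\odot B_N'$ has the RIP of order $(64r\lceil\ln(231N/p)\rceil,\varepsilon/8)$; and $m'\le CK^2$, $m\le CK^2\log N$; * given $N,s,K,m',b_N$, the input vector $y\in\mathbb C^m$, and random access to the positions of the ones in the columns of $W$, the program computes $f(y)$ in at most $Cm$ steps for every $y\in\mathbb C^m$, and outputs it as a list of at most $2s$ distinct indices with the corresponding entries, all other entries being zero. (One step is one access to memory or to the table of positions, one addition, subtraction or comparison of integers, or one addition, subtraction, multiplication or comparison of reals.) For a diagonal matrix $D=\mathrm{diag}(d_1,\dots,d_N)$ with $d_i\in\{-1,1\}$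 put $$M=\widetilde WD=\frac1{\sqrt{Kb_N}}(W\odot B_N')D\in\mathbb R^{m\times N}.$$ (i) Let $A\in\mathbb C^{N\times N}$ with singular value decomposition $A=U\Sigma V^*$, $\Sigma=\mathrm{diag}(\sigma_1\ge\dots\ge\sigma_N\ge0)$, and let $A_r=U\,\mathrm{diag}(\sigma_1,\dots,\sigma_r,0,\dots,0)V^*$. If $d_1,\dots,d_N$ are i.i.d. Rademacher random variables, then with probability at least $1-p$ the matrix $M$ is an $\varepsilon$-JL map of the column space of $A_r$, of the column space of $A_r^*$, and of the set of the last $N-r$ columns of $U$ and the last $N-r$ columns of $V$. (ii) For every sign matrix $D$, every $u\in\mathbb C^N$ and every $n\in\mathbb C^m$, $$\Big\|u-\sqrt{Kb_N}\;D\,f(Mu+n)\Big\|_2\le\|u-u_{2s}\|_2+6(1+\sqrt2)\Big(\frac{\|u-u_s\|_1}{\sqrt s}+\beta_m(n)\|n\|_2\Big),\qquad \beta_m(n)=\frac{\|n\|_\infty\sqrt{s\,K\,b_N}}{\|n\|_2},$$ where $\beta_m(n)\|n\|_2$ is read as $0$ for $n=0$. $W$ and $f$ do not depend on $A$, $D$,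 $u$ or $n$. -/

import Mathlib

open MeasureTheory ProbabilityTheory
open scoped ENNReal

namespace SublinearSketch

noncomputable section

/-! ### Vectors: norms and best sparse approximation -/

/-- The `ℓ^q` norm of a complex vector (`q = 1, 2, ∞` are used). -/
def lpNormVec {ι : Type*} [Fintype ι] (q : ℝ≥0∞) (x : ι → ℂ) : ℝ :=
  ‖(WithLp.toLp q x : PiLp q fun _ : ι => ℂ)‖

/-- `x` is `k`-sparse: it has at most `k` nonzero entries. -/
def IsSparse {ι : Type*} (k : ℕ) (x : ι → ℂ) : Prop :=
  (Function.support x).ncard ≤ k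

/-- `‖u - u_k‖_q = inf { ‖u - v‖_q : v is k-sparse }`, the best `k`-term approximation error. -/
def bestApproxError {N : ℕ} (q : ℝ≥0∞) (k : ℕ) (u : Fin N → ℂ) : ℝ :=
  ⨅ v : {v : Fin N → ℂ // IsSparse k v}, lpNormVec q (u - v.1)

/-! ### Johnson–Lindenstrauss maps, RIP, and the singular value decomposition -/

/-- `M` is an `ε`-JL map of the set `S`. -/
def IsJLMap {ι : Type*} [Fintype ι] {N : ℕ} (ε : ℝ) (M : Matrix ι (Fin N) ℂ)
    (S : Set (Fin N → ℂ)) : Prop :=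
  ∀ x ∈ S, (1 - ε) * lpNormVec 2 x ^ 2 ≤ lpNormVec 2 (M.mulVec x) ^ 2 ∧
    lpNormVec 2 (M.mulVec x) ^ 2 ≤ (1 + ε) * lpNormVec 2 x ^ 2

/-- `M` has the restricted isometry property of order `(k, ε)`. -/
def HasRIP {ι : Type*} [Fintype ι] {N : ℕ} (k : ℕ) (ε : ℝ) (M : Matrix ι (Fin N) ℂ) : Prop :=
  IsJLMap ε M {x | IsSparse k x}

/-- `A = U Σ V*` is a singular value decomposition of `A`, with `Σ = diag(σ)` and
`σ₁ ≥ σ₂ ≥ ⋯ ≥ σ_N ≥ 0`. -/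
structure IsSVD {N : ℕ} (A U : Matrix (Fin N) (Fin N) ℂ) (σ : Fin N → ℝ)
    (V : Matrix (Fin N) (Fin N) ℂ) : Prop where
  unitary_left : U ∈ Matrix.unitaryGroup (Fin N) ℂ
  unitary_right : V ∈ Matrix.unitaryGroup (Fin N) ℂ
  antitone : Antitone σ
  nonneg : ∀ j, 0 ≤ σ j
  eq_mul : A = U * Matrix.diagonal (fun j => (σ j : ℂ)) * V.conjTranspose

/-- `A_r = U diag(σ₁, …, σ_r, 0, …, 0) V*`. -/
def truncatedSVD {N : ℕ} (r : ℕ) (U : Matrix (Fin N) (Fin N) ℂ) (σ : Fin N → ℝ)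
    (V : Matrix (Fin N) (Fin N) ℂ) : Matrix (Fin N) (Fin N) ℂ :=
  U * Matrix.diagonal (fun j => if j.val < r then (σ j : ℂ) else 0) * V.conjTranspose

/-- The column space of a matrix. -/
def columnSpace {N : ℕ} (A : Matrix (Fin N) (Fin N) ℂ) : Set (Fin N → ℂ) :=
  Set.range A.mulVec

/-- `M` is an `ε`-JL map of the column space of `A_r`, of the column space of `A_r*`, and of the
set of the left and right singular vectors that belong to the `N - r` smallest singular values. -/
structure SatisfiesJLAssumptions {ι : Type*} [Fintype ι] {N : ℕ} (M : Matrix ι (Fin N) ℂ)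
    (U : Matrix (Fin N) (Fin N) ℂ) (σ : Fin N → ℝ) (V : Matrix (Fin N) (Fin N) ℂ)
    (r : ℕ) (ε : ℝ) : Prop where
  col : IsJLMap ε M (columnSpace (truncatedSVD r U σ V))
  col_adjoint : IsJLMap ε M (columnSpace (truncatedSVD r U σ V).conjTranspose)
  tail : IsJLMap ε M {x | ∃ j : Fin N, r ≤ j.val ∧ ((x = fun i => U i j) ∨ (x = fun i => V i j))}

/-! ### The measurement matrix -/

/-- A `{0,1}`-matrix is `(K, α)`-coherent if every column has at least `K` ones and the inner
product of any two distinct columns is at most `α`. -/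
structure IsCoherent {m' N : ℕ} (W : Matrix (Fin m') (Fin N) ℕ) (K α : ℕ) : Prop where
  zero_or_one : ∀ i j, W i j = 0 ∨ W i j = 1
  ones : ∀ j, K ≤ (Finset.univ.filter fun i => W i j = 1).card
  inner_le : ∀ j l, j ≠ l → ∑ i, W i j * W i l ≤ α

/-- The number `1 + ⌈log₂ N⌉` of rows of the bit testing matrix. -/
def bitRows (N : ℕ) : ℕ := 1 + Nat.clog 2 N

/-- The bit testing matrix `B_N`: with columns indexed from `0`, column `j` is a `1` followed by
the binary digits of `j`, least significant digit first. -/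
def bitTest (N : ℕ) : Matrix (Fin (bitRows N)) (Fin N) ℕ :=
  Matrix.of fun a j => if a.val = 0 then 1 else if j.val.testBit (a.val - 1) then 1 else 0

/-- The extended bit testing matrix `B_N'`: each column of `B_N`, followed by its binary
complement. -/
def extBitTest (N : ℕ) : Matrix (Fin (2 * bitRows N)) (Fin N) ℕ :=
  Matrix.of fun a j =>
    if h : a.val < bitRows N then bitTest N ⟨a.val, h⟩ j
    else 1 - bitTest N ⟨a.val - bitRows N, by have := a.isLt; omega⟩ j

/-- The Khatri–Rao (column-wise Kronecker) product; its rows are indexed by pairs. -/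
def khatriRao {ι κ n R : Type*} [Mul R] (B : Matrix ι n R) (C : Matrix κ n R) :
    Matrix (ι × κ) n R :=
  Matrix.of fun p k => B p.1 k * C p.2 k

/-- The normalization `√(K (1 + ⌈log₂ N⌉))`. -/
def scale (N K : ℕ) : ℝ := Real.sqrt ((K : ℝ) * (bitRows N : ℝ))

/-- The real matrix `(W ⊙ B_N') / √(K (1 + ⌈log₂ N⌉))`. -/
def baseSketch {m' N : ℕ} (K : ℕ) (W : Matrix (Fin m') (Fin N) ℕ) :
    Matrix (Fin m' × Fin (2 * bitRows N)) (Fin N) ℝ :=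
  (scale N K)⁻¹ • (khatriRao W (extBitTest N)).map (fun a : ℕ => (a : ℝ))

/-- The real matrix `(W ⊙ B_N') D / √(K (1 + ⌈log₂ N⌉))` with `D = diag(d)`. -/
def sketch {m' N : ℕ} (K : ℕ) (W : Matrix (Fin m') (Fin N) ℕ) (d : Fin N → ℝ) :
    Matrix (Fin m' × Fin (2 * bitRows N)) (Fin N) ℝ :=
  baseSketch K W * Matrix.diagonal d

/-- A real matrix, seen as a complex one. -/
def toComplex {ι n : Type*} (M : Matrix ι n ℝ) : Matrix ι n ℂ := M.map (fun a : ℝ => (a : ℂ))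

/-- `β_m(n) = ‖n‖_∞ √(s K (1 + ⌈log₂ N⌉)) / ‖n‖₂`. For `n = 0` this is `0`, and only the product
`β_m(n) ‖n‖₂` is used. -/
def beta {ι : Type*} [Fintype ι] (N s K : ℕ) (n : ι → ℂ) : ℝ :=
  lpNormVec ∞ n * Real.sqrt ((s : ℝ) * (K : ℝ) * (bitRows N : ℝ)) / lpNormVec 2 n

/-- The Rademacher law: `±1` with probability `1/2` each. -/
def rademacher : Measure ℝ :=
  (2⁻¹ : ℝ≥0∞) • Measure.dirac 1 + (2⁻¹ : ℝ≥0∞) • Measure.dirac (-1)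

/-! ### Running time: a random access machine with real registers

A machine has registers and arrays that hold natural numbers, and registers and arrays that hold
real numbers. In one step it copies one array entry to or from a register, does one addition or
subtraction of natural numbers, one addition, subtraction or multiplication of real numbers, one
comparison, or one query to a read-only two-argument table of natural numbers. A program is a
finite piece of code, fixed once and for all inputs. -/

/-- The content of the registers and arrays. -/
structure Store where
  nat : ℕ → ℕ
  natArr : ℕ → ℕ → ℕ
  real : ℕ → ℝ
  realArr : ℕ → ℕ → ℝ

/-- The elementary instructions; register and array names are literals of the program. -/
inductive Instr where
  | natConst (dst c : ℕ)
  | natAdd (dst a b : ℕ)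
  | natSub (dst a b : ℕ)
  | natGet (dst arr i : ℕ)
  | natSet (arr i src : ℕ)
  | query (dst a b : ℕ)
  | realAdd (dst a b : ℕ)
  | realSub (dst a b : ℕ)
  | realMul (dst a b : ℕ)
  | realGet (dst arr i : ℕ)
  | realSet (arr i src : ℕ)

/-- Programs: instructions, sequential composition, branching on a comparison `<` of two registers,
and loops controlled by a comparison `<` of two registers of natural numbers. -/
inductive Cmd where
  | instr (c : Instr)
  | seq (c₁ c₂ : Cmd)
  | ifNat (a b : ℕ) (c₁ c₂ : Cmd)
  | ifReal (a b : ℕ) (c₁ c₂ : Cmd)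
  | whileNat (a b : ℕ) (c : Cmd)

/-- `f` with the value at `(a, i)` replaced by `v`. -/
def setEntry {α : Type*} (f : ℕ → ℕ → α) (a i : ℕ) (v : α) : ℕ → ℕ → α :=
  Function.update f a (Function.update (f a) i v)

/-- The effect of one instruction; `T` is the table that can be queried. -/
def Instr.eval (T : ℕ → ℕ → ℕ) : Instr → Store → Store
  | .natConst dst c, σ => { σ with nat := Function.update σ.nat dst c }
  | .natAdd dst a b, σ => { σ with nat := Function.update σ.nat dst (σ.nat a + σ.nat b) }
  | .natSub dst a b, σ => { σ with nat := Function.update σ.nat dst (σ.nat a - σ.nat b) }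
  | .natGet dst arr i, σ =>
      { σ with nat := Function.update σ.nat dst (σ.natArr arr (σ.nat i)) }
  | .natSet arr i src, σ => { σ with natArr := setEntry σ.natArr arr (σ.nat i) (σ.nat src) }
  | .query dst a b, σ => { σ with nat := Function.update σ.nat dst (T (σ.nat a) (σ.nat b)) }
  | .realAdd dst a b, σ => { σ with real := Function.update σ.real dst (σ.real a + σ.real b) }
  | .realSub dst a b, σ => { σ with real := Function.update σ.real dst (σ.real a - σ.real b) }
  | .realMul dst a b, σ => { σ with real := Function.update σ.real dst (σ.real a * σ.real b) }
  | .realGet dst arr i, σ =>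
      { σ with real := Function.update σ.real dst (σ.realArr arr (σ.nat i)) }
  | .realSet arr i src, σ =>
      { σ with realArr := setEntry σ.realArr arr (σ.nat i) (σ.real src) }

/-- `Exec T c σ τ k`: the program `c`, started in `σ` with table `T`, halts in `τ` after exactly
`k` steps. Each instruction and each test of a branch or a loop is one step. -/
inductive Exec (T : ℕ → ℕ → ℕ) : Cmd → Store → Store → ℕ → Prop
  | instr (c : Instr) (σ : Store) : Exec T (.instr c) σ (c.eval T σ) 1
  | seq {c₁ c₂ : Cmd} {σ τ υ : Store} {k l : ℕ} (h₁ : Exec T c₁ σ τ k) (h₂ : Exec T c₂ τ υ l) :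
      Exec T (.seq c₁ c₂) σ υ (k + l)
  | ifNat_true {a b : ℕ} {c₁ c₂ : Cmd} {σ τ : Store} {k : ℕ} (h : σ.nat a < σ.nat b)
      (h₁ : Exec T c₁ σ τ k) : Exec T (.ifNat a b c₁ c₂) σ τ (k + 1)
  | ifNat_false {a b : ℕ} {c₁ c₂ : Cmd} {σ τ : Store} {k : ℕ} (h : ¬ σ.nat a < σ.nat b)
      (h₂ : Exec T c₂ σ τ k) : Exec T (.ifNat a b c₁ c₂) σ τ (k + 1)
  | ifReal_true {a b : ℕ} {c₁ c₂ : Cmd} {σ τ : Store} {k : ℕ} (h : σ.real a < σ.real b)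
      (h₁ : Exec T c₁ σ τ k) : Exec T (.ifReal a b c₁ c₂) σ τ (k + 1)
  | ifReal_false {a b : ℕ} {c₁ c₂ : Cmd} {σ τ : Store} {k : ℕ} (h : ¬ σ.real a < σ.real b)
      (h₂ : Exec T c₂ σ τ k) : Exec T (.ifReal a b c₁ c₂) σ τ (k + 1)
  | while_done {a b : ℕ} {c : Cmd} {σ : Store} (h : ¬ σ.nat a < σ.nat b) :
      Exec T (.whileNat a b c) σ σ 1
  | while_step {a b : ℕ} {c : Cmd} {σ τ υ : Store} {k l : ℕ} (h : σ.nat a < σ.nat b)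
      (h₁ : Exec T c σ τ k) (h₂ : Exec T (.whileNat a b c) τ υ l) :
      Exec T (.whileNat a b c) σ υ (k + l + 1)

/-- The table that describes `W`: the entry `(j, k)` is the row of the `k`-th one (counted from `0`)
of column `j`. -/
def columnTable {m' N : ℕ} (W : Matrix (Fin m') (Fin N) ℕ) (j k : ℕ) : ℕ :=
  Nat.nth (fun i => ∃ (hi : i < m') (hj : j < N), W ⟨i, hi⟩ ⟨j, hj⟩ = 1) k

/-- A finite vector as an array, padded by zeros. -/
def padded {n : ℕ} (x : Fin n → ℝ) (k : ℕ) : ℝ := if h : k < n then x ⟨k, h⟩ else 0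

/-- The initial store: the registers `0, …, 4` hold `N, s, K, m', 1 + ⌈log₂ N⌉`; the real arrays `0`
and `1` hold the real and imaginary parts of the measurements `y`, row by row; all the rest is `0`. -/
def initStore {m' : ℕ} (N s K : ℕ) (y : Fin m' × Fin (2 * bitRows N) → ℂ) : Store where
  nat i := [N, s, K, m', bitRows N].getD i 0
  natArr _ _ := 0
  real _ := 0
  realArr a :=
    if a = 0 then padded fun k => (y (finProdFinEquiv.symm k)).re
    else if a = 1 then padded fun k => (y (finProdFinEquiv.symm k)).im
    else fun _ => 0

/-- The store `τ` lists the vector `x`: register `0` holds the length `c ≤ k` of the list, and the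
`i`-th item of the list, `i < c`, is an index (in the natural number array `0`) with the real and
imaginary parts (in the real arrays `2` and `3`) of the entry of `x` at that index. The indices are
distinct, and all other entries of `x` are `0`. -/
def ListsVector {N : ℕ} (k : ℕ) (τ : Store) (x : Fin N → ℂ) : Prop :=
  τ.nat 0 ≤ k ∧
  (∀ i < τ.nat 0, τ.natArr 0 i < N) ∧
  (∀ i < τ.nat 0, ∀ l < τ.nat 0, τ.natArr 0 i = τ.natArr 0 l → i = l) ∧
  (∀ j : Fin N, ∀ i < τ.nat 0, τ.natArr 0 i = j.val →
    x j = ⟨τ.realArr 2 i, τ.realArr 3 i⟩) ∧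
  (∀ j : Fin N, (∀ i < τ.nat 0, τ.natArr 0 i ≠ j.val) → x j = 0)

/-- The program `c` computes `f` with at most `T₀` steps on every input, and lists each value of `f`
as a `k`-sparse vector. -/
def ComputesSparse {m' N : ℕ} (c : Cmd) (s K : ℕ) (W : Matrix (Fin m') (Fin N) ℕ)
    (f : (Fin m' × Fin (2 * bitRows N) → ℂ) → Fin N → ℂ) (k : ℕ) (T₀ : ℝ) : Prop :=
  ∀ y, ∃ (τ : Store) (steps : ℕ),
    Exec (columnTable W) c (initStore N s K y) τ steps ∧ (steps : ℝ) ≤ T₀ ∧ ListsVector k τ (f y)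

end

end SublinearSketch

open SublinearSketch

namespace SublinearSketch

/-! ### Hypercontractivity for Rademacher polynomials -/

/-! The whole construction rests on one number, `α / K`, the coherence of `W` relative to its column
weight. Columns of `W` are graphs of distinct polynomials of low degree over a prime field with `K <
q ≤ 2K`, so two of them share at most `α = ⌈log_K N⌉ - 1` ones (`exists_coherent_matrix`). The
choice `K = t ⌈log_t N⌉` makes `α / K ≤ 1 / t`, and the two entries of the maximum `t` serve the two
halves of the theorem: `4s` the recovery, the other one the embedding.

Embedding. The normalized sketch has unit columns, and the off-diagonal entries of its Gram matrix
are at most `μ = α / K`. This gives the RIP by comparing the 1-norm and the 2-norm of a sparse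
vector. Random signs turn the off-diagonal Gram form, evaluated at two orthonormal vectors, into a
Rademacher chaos of order two whose coefficients have square sum at most `μ²`. Bonami's inequality
(`sum_walsh_pow_le`, from a two-point inequality and Minkowski) bounds its `2k`-th moment, and
Markov with `k = L` shows that it exceeds `ε / r` only for a proportion `2 exp(-2L)` of the signs
(`card_sesq_le_exp`). A union bound over all pairs of columns of `U` and of `V` suffices, without a
net: every vector in question is a combination of at most `r` of these columns, so entrywise bounds
`ε / r` on the form give distortion `ε`.

Recovery. Fix `j` and a set `S` of `s` indices. At most `sα` rows of column `j` meet another column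
from `S`, and at most `sα` rows receive much of the mass outside `S`, by double counting. Since `K ≥
4αs + 1`, more than half of the rows are good (`card_good_rows`). In good rows the bit tests spell
out `j` whenever the entry is large, and the all-ones test approximates it. Hence large entries get
more than `K / 2` votes, and medians over the rows of a column estimate them. Keeping the `2s`
largest estimates gives the error bound (`recovery_error_le`).

Running time. If `n` indices have more than `K / 2` votes among `m'` blocks, then `nK ≤ 2m'`. So
sorting `K` values for each candidate, and selecting the `2s` largest by repeated scans, costs
`O(m)` (`mul_mul_clog_le`, `decoder_steps_le`). The decoder is an explicit program. Its correctness
and cost are shown together in a calculus of weakest preconditions, with loop invariants that carry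
a budget of remaining steps (`Wp.while`). The function `f` is then chosen among the vectors that the
program lists. -/

theorem sum_range_two_mul_add_one {M : Type*} [AddCommMonoid M] (F : ℕ → M) (k : ℕ) :
    ∑ m ∈ Finset.range (2 * k + 1), F m =
      ∑ i ∈ Finset.range (k + 1), F (2 * i) + ∑ i ∈ Finset.range k, F (2 * i + 1) := by
  induction k with
  | zero => simp
  | succ k ih =>
    rw [show 2 * (k + 1) + 1 = 2 * k + 1 + 1 + 1 by ring, Finset.sum_range_succ,
      Finset.sum_range_succ, ih, Finset.sum_range_succ (fun i => F (2 * i)) (k + 1),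
      Finset.sum_range_succ (fun i => F (2 * i + 1)) k]
    rw [show 2 * (k + 1) = 2 * k + 1 + 1 by ring]
    abel

/-- Consecutive ratios in `i` are `(2k-2i)(2k-2i-1) / ((2i+1)(2i+2))` on the left and `(k-i)/(i+1)`
for the binomial on the right. Their quotient `(2k-2i-1)/(2i+1)` is at most `2k-1`, which pays for
the next power. -/
theorem choose_two_mul_le (k i : ℕ) :
    ((2 * k).choose (2 * i) : ℝ) ≤ (2 * k - 1 : ℝ) ^ i * (k.choose i : ℝ) := by
  induction i with
  | zero => simp
  | succ i ih =>
    rcases Nat.lt_or_ge i k with hik | hik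
    · have h1 := Nat.choose_succ_right_eq (2 * k) (2 * i)
      have h2 := Nat.choose_succ_right_eq (2 * k) (2 * i + 1)
      have h3 := Nat.choose_succ_right_eq k i
      obtain ⟨e, rfl⟩ := Nat.exists_eq_add_of_lt hik
      rw [show 2 * (i + e + 1) - 2 * i = 2 * e + 2 by omega] at h1
      rw [show 2 * (i + e + 1) - (2 * i + 1) = 2 * e + 1 by omega] at h2
      rw [show i + e + 1 - i = e + 1 by omega] at h3
      rw [show 2 * (i + 1) = 2 * i + 1 + 1 by ring]
      have h1' : ((2 * (i + e + 1)).choose (2 * i + 1) : ℝ) * (2 * i + 1) =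
        ((2 * (i + e + 1)).choose (2 * i) : ℝ) * (2 * e + 2) := by exact_mod_cast h1
      have h2' : ((2 * (i + e + 1)).choose (2 * i + 1 + 1) : ℝ) * (2 * i + 1 + 1) =
        ((2 * (i + e + 1)).choose (2 * i + 1) : ℝ) * (2 * e + 1) := by exact_mod_cast h2
      have h3' : ((i + e + 1).choose (i + 1) : ℝ) * (i + 1) =
        ((i + e + 1).choose i : ℝ) * (e + 1) := by exact_mod_cast h3
      set a := ((2 * (i + e + 1)).choose (2 * i) : ℝ)
      set b := ((2 * (i + e + 1)).choose (2 * i + 1) : ℝ)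
      set c := ((2 * (i + e + 1)).choose (2 * i + 1 + 1) : ℝ)
      set x := ((i + e + 1).choose i : ℝ)
      set y := ((i + e + 1).choose (i + 1) : ℝ)
      push_cast at ih ⊢
      have hP : (0 : ℝ) ≤ (2 * (i + e + 1) - 1 : ℝ) ^ i := by
        apply pow_nonneg; have : (0 : ℝ) ≤ i := by positivity
        have : (0 : ℝ) ≤ e := by positivity
        linarith
      set P := (2 * (i + e + 1) - 1 : ℝ) ^ i with hPdef
      have hx : 0 ≤ x := by positivity
      have hc : c * ((i + 1) * (2 * i + 1)) = a * ((e + 1) * (2 * e + 1)) := by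
        linear_combination (2 * (i : ℝ) + 1) / 2 * h2' + (2 * (e : ℝ) + 1) / 2 * h1'
      have hpos : (0 : ℝ) < (i + 1) * (2 * i + 1) := by positivity
      rw [pow_succ, ← hPdef]
      refine le_of_mul_le_mul_right ?_ hpos
      rw [hc]
      have : P * (2 * (i + e + 1) - 1) * y * ((i + 1) * (2 * i + 1)) =
          P * x * ((e + 1) * ((2 * (i + e + 1) - 1) * (2 * i + 1))) := by
        linear_combination P * (2 * (i + e + 1) - 1) * (2 * i + 1) * h3'
      rw [this]
      gcongr
      have : (0 : ℝ) ≤ i := by positivity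
      have : (0 : ℝ) ≤ e := by positivity
      nlinarith
    · have : (2 * k).choose (2 * (i + 1)) = 0 := Nat.choose_eq_zero_of_lt (by omega)
      have h' : k.choose (i + 1) = 0 := Nat.choose_eq_zero_of_lt (by omega)
      simp [this, h']

/-- The two-point hypercontractive inequality. -/
theorem two_point_inequality (k : ℕ) (g h : ℝ) :
    (g + h) ^ (2 * k) + (g - h) ^ (2 * k) ≤ 2 * (g ^ 2 + (2 * k - 1) * h ^ 2) ^ k := by
  have e1 : (g + h) ^ (2 * k) + (g - h) ^ (2 * k) =
      2 * ∑ i ∈ Finset.range (k + 1), (h ^ 2) ^ i * (g ^ 2) ^ (k - i) * ((2 * k).choose (2 * i)) := by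
    rw [sub_eq_add_neg, add_comm g h, add_comm g (-h), add_pow, add_pow, ← Finset.sum_add_distrib,
      sum_range_two_mul_add_one, Finset.mul_sum]
    have : ∀ i ∈ Finset.range k, h ^ (2 * i + 1) * g ^ (2 * k - (2 * i + 1)) *
        ((2 * k).choose (2 * i + 1) : ℝ) + (-h) ^ (2 * i + 1) * g ^ (2 * k - (2 * i + 1)) *
        ((2 * k).choose (2 * i + 1) : ℝ) = 0 := by
      intro i _
      rw [Odd.neg_pow ⟨i, rfl⟩]; ring
    rw [Finset.sum_eq_zero this, add_zero]
    refine Finset.sum_congr rfl fun i hi => ?_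
    rw [Even.neg_pow ⟨i, two_mul i⟩, show 2 * k - 2 * i = 2 * (k - i) by omega, pow_mul, pow_mul]
    ring
  rw [e1, add_comm (g ^ 2), add_pow]
  refine mul_le_mul_of_nonneg_left (Finset.sum_le_sum fun i _ => ?_) zero_le_two
  have := choose_two_mul_le k i
  calc (h ^ 2) ^ i * (g ^ 2) ^ (k - i) * ((2 * k).choose (2 * i) : ℝ)
      ≤ (h ^ 2) ^ i * (g ^ 2) ^ (k - i) * ((2 * k - 1 : ℝ) ^ i * (k.choose i : ℝ)) := by gcongr
    _ = _ := by rw [mul_pow]; ring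

/-- Minkowski's inequality, for the `k`-th moments of nonnegative functions. -/
theorem sum_add_pow_le {Ω : Type*} (s : Finset Ω) (u v : Ω → ℝ) (hu : ∀ x, 0 ≤ u x)
    (hv : ∀ x, 0 ≤ v x) {k : ℕ} (hk : 1 ≤ k) {c A B : ℝ} (hc : 0 ≤ c) (hA : 0 ≤ A) (hB : 0 ≤ B)
    (hu' : ∑ x ∈ s, u x ^ k ≤ c * A ^ k) (hv' : ∑ x ∈ s, v x ^ k ≤ c * B ^ k) :
    ∑ x ∈ s, (u x + v x) ^ k ≤ c * (A + B) ^ k := by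
  have hk' : (1 : ℝ) ≤ k := by exact_mod_cast hk
  have hk0 : k ≠ 0 := by omega
  have key := Real.Lp_add_le_of_nonneg (s := s) (f := u) (g := v) hk' (fun i _ => hu i)
    (fun i _ => hv i)
  simp only [Real.rpow_natCast] at key
  -- Each `k`-th root carries the same factor `c ^ (1/k)`, which therefore passes through Minkowski
  -- and becomes `c` again at the end.
  have root : ∀ {S a : ℝ}, 0 ≤ S → 0 ≤ a → S ≤ c * a ^ k →
      S ^ (1 / (k : ℝ)) ≤ c ^ (1 / (k : ℝ)) * a := by
    intro S a hS ha h
    calc S ^ (1 / (k : ℝ)) ≤ (c * a ^ k) ^ (1 / (k : ℝ)) := by gcongr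
      _ = _ := by
        rw [Real.mul_rpow hc (by positivity), one_div, Real.pow_rpow_inv_natCast ha hk0]
  have hS : 0 ≤ ∑ x ∈ s, (u x + v x) ^ k :=
    Finset.sum_nonneg fun x _ => pow_nonneg (add_nonneg (hu x) (hv x)) _
  have h1 := root (Finset.sum_nonneg fun x _ => pow_nonneg (hu x) _) hA hu'
  have h2 := root (Finset.sum_nonneg fun x _ => pow_nonneg (hv x) _) hB hv'
  have h3 : (∑ x ∈ s, (u x + v x) ^ k) ^ (1 / (k : ℝ)) ≤ c ^ (1 / (k : ℝ)) * (A + B) := by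
    rw [mul_add]; linarith
  calc ∑ x ∈ s, (u x + v x) ^ k = ((∑ x ∈ s, (u x + v x) ^ k) ^ (1 / (k : ℝ))) ^ k := by
        rw [one_div, Real.rpow_inv_natCast_pow hS hk0]
    _ ≤ (c ^ (1 / (k : ℝ)) * (A + B)) ^ k := by gcongr
    _ = _ := by rw [mul_pow, one_div, Real.rpow_inv_natCast_pow hc hk0]

section Walsh

variable {ι : Type*}

/-- The value of a sign as a real number. -/
def signVal (d : ι → ℤˣ) (i : ι) : ℝ := ((d i : ℤ) : ℝ)

theorem signVal_sq (d : ι → ℤˣ) (i : ι) : signVal d i ^ 2 = 1 := by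
  rcases Int.units_eq_one_or (d i) with h | h <;> simp [signVal, h]

theorem signVal_eq (d : ι → ℤˣ) (i : ι) : signVal d i = 1 ∨ signVal d i = -1 := by
  rcases Int.units_eq_one_or (d i) with h | h <;> simp [signVal, h]

/-- The multilinear polynomial with coefficients `a`, in the variables of `V`. -/
def walsh (a : Finset ι → ℝ) (V : Finset ι) (d : ι → ℤˣ) : ℝ :=
  ∑ S ∈ V.powerset, a S * ∏ i ∈ S, signVal d i

variable [DecidableEq ι]

/-- The sign vector `d` with the sign of the `i`-th entry reversed. -/
def flipSign (i : ι) (d : ι → ℤˣ) : ι → ℤˣ := Function.update d i (-d i)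

theorem flipSign_involutive (i : ι) : Function.Involutive (flipSign i) := by
  intro d
  ext j
  by_cases h : j = i
  · subst h; simp [flipSign]
  · simp [flipSign, h]

theorem walsh_flipSign (a : Finset ι → ℝ) {V : Finset ι} {i : ι} (hi : i ∉ V) (d : ι → ℤˣ) :
    walsh a V (flipSign i d) = walsh a V d := by
  refine Finset.sum_congr rfl fun S hS => ?_
  congr 1
  refine Finset.prod_congr rfl fun j hj => ?_
  have : j ≠ i := fun h => hi (h ▸ Finset.mem_powerset.1 hS hj)
  simp [signVal, flipSign, this]

theorem walsh_insert (a : Finset ι → ℝ) {V : Finset ι} {i : ι} (hi : i ∉ V) (d : ι → ℤˣ) :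
    walsh a (insert i V) d =
      walsh a V d + signVal d i * walsh (fun S => a (insert i S)) V d := by
  unfold walsh
  rw [Finset.sum_powerset_insert hi, Finset.mul_sum]
  congr 1
  refine Finset.sum_congr rfl fun S hS => ?_
  rw [Finset.prod_insert (fun h => hi (Finset.mem_powerset.1 hS h))]
  ring

/-- Hypercontractivity (Bonami): the `2k`-th moment of a Rademacher polynomial. -/
theorem sum_walsh_pow_le [Fintype ι] {k : ℕ} (hk : 1 ≤ k) (V : Finset ι) (a : Finset ι → ℝ) :
    ∑ d : ι → ℤˣ, walsh a V d ^ (2 * k) ≤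
      2 ^ Fintype.card ι * (∑ S ∈ V.powerset, (2 * k - 1 : ℝ) ^ S.card * a S ^ 2) ^ k := by
  have hk' : (1 : ℝ) ≤ k := by exact_mod_cast hk
  have hk1 : (0 : ℝ) ≤ 2 * k - 1 := by linarith
  induction V using Finset.induction_on generalizing a with
  | empty => simp [walsh, pow_mul]
  | insert i V hi ih =>
    -- The polynomial is `g + d_i h` with `g` and `h` free of the `i`-th variable, and `b` holds the
    -- coefficients of `h`.
    set b : Finset ι → ℝ := fun S => a (insert i S) with hb
    have hflip : ∑ d : ι → ℤˣ, walsh a (insert i V) d ^ (2 * k) =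
        ∑ d : ι → ℤˣ, (walsh a V d - signVal d i * walsh b V d) ^ (2 * k) := by
      rw [← Equiv.sum_comp (flipSign_involutive i).toPerm]
      refine Finset.sum_congr rfl fun d _ => ?_
      simp only [Function.Involutive.coe_toPerm]
      rw [walsh_insert a hi, walsh_flipSign a hi, walsh_flipSign _ hi]
      simp [flipSign, signVal, sub_eq_add_neg, hb]
    -- Adding the sum to its image under the flip of the `i`-th sign produces `(g+h)^(2k) +
    -- (g-h)^(2k)`, to which the two-point inequality applies.
    have htwo : ∑ d : ι → ℤˣ, walsh a (insert i V) d ^ (2 * k) ≤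
        ∑ d : ι → ℤˣ, (walsh a V d ^ 2 + (2 * k - 1) * walsh b V d ^ 2) ^ k := by
      have h2 : 2 * ∑ d : ι → ℤˣ, walsh a (insert i V) d ^ (2 * k) ≤
          ∑ d : ι → ℤˣ, 2 * (walsh a V d ^ 2 + (2 * k - 1) * walsh b V d ^ 2) ^ k := by
        rw [two_mul]
        conv_lhs => arg 2; rw [hflip]
        rw [← Finset.sum_add_distrib]
        refine Finset.sum_le_sum fun d _ => ?_
        have := two_point_inequality k (walsh a V d) (signVal d i * walsh b V d)
        rwa [mul_pow, signVal_sq, one_mul, ← walsh_insert a hi] at this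
      rw [← Finset.mul_sum] at h2
      linarith
    refine htwo.trans ?_
    have hsplit : ∑ S ∈ (insert i V).powerset, (2 * k - 1 : ℝ) ^ S.card * a S ^ 2 =
        ∑ S ∈ V.powerset, (2 * k - 1 : ℝ) ^ S.card * a S ^ 2 +
        (2 * k - 1) * ∑ S ∈ V.powerset, (2 * k - 1 : ℝ) ^ S.card * b S ^ 2 := by
      rw [Finset.sum_powerset_insert hi, Finset.mul_sum]
      congr 1
      refine Finset.sum_congr rfl fun S hS => ?_
      rw [Finset.card_insert_of_notMem (fun h => hi (Finset.mem_powerset.1 hS h))]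
      ring
    rw [hsplit]
    -- Minkowski for `g²` and `(2k-1) h²`; the induction hypothesis for `a` and for `b` bounds their
    -- `k`-th moments.
    refine sum_add_pow_le _ _ _ (fun d => sq_nonneg _) (fun d => by positivity) hk
      (by positivity) (Finset.sum_nonneg fun S _ => by positivity)
      (mul_nonneg hk1 (Finset.sum_nonneg fun S _ => by positivity)) ?_ ?_
    · simpa only [← pow_mul] using ih a
    · have := mul_le_mul_of_nonneg_left (ih b) (pow_nonneg hk1 k)
      rw [Finset.mul_sum] at this
      calc _ = ∑ d : ι → ℤˣ, (2 * k - 1 : ℝ) ^ k * walsh b V d ^ (2 * k) := by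
            refine Finset.sum_congr rfl fun d _ => ?_
            rw [mul_pow, ← pow_mul]
        _ ≤ _ := this
        _ = _ := by rw [mul_pow]; ring

/-! ### Tails of a Rademacher chaos of order two -/

variable [Fintype ι]

/-- The coefficients of an off-diagonal quadratic form in signs as a multilinear polynomial. -/
def chaosCoeff (c : ι → ι → ℝ) (S : Finset ι) : ℝ :=
  ∑ p ∈ (Finset.univ : Finset ι).offDiag with {p.1, p.2} = S, c p.1 p.2

theorem walsh_chaosCoeff {c : ι → ι → ℝ} (hc : ∀ i, c i i = 0) (d : ι → ℤˣ) :
    walsh (chaosCoeff c) Finset.univ d = ∑ i, ∑ j, c i j * signVal d i * signVal d j := by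
  have h1 : walsh (chaosCoeff c) Finset.univ d =
      ∑ S ∈ (Finset.univ : Finset ι).powerset,
        ∑ p ∈ (Finset.univ : Finset ι).offDiag with {p.1, p.2} = S,
          c p.1 p.2 * signVal d p.1 * signVal d p.2 := by
    refine Finset.sum_congr rfl fun S _ => ?_
    rw [chaosCoeff, Finset.sum_mul]
    refine Finset.sum_congr rfl fun p hp => ?_
    obtain ⟨hp1, rfl⟩ := Finset.mem_filter.1 hp
    rw [Finset.prod_pair (Finset.mem_offDiag.1 hp1).2.2, mul_assoc]
  rw [h1, Finset.sum_fiberwise_of_maps_to (fun p _ => by simp), ← Finset.sum_product',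
    ← Finset.diag_union_offDiag Finset.univ, Finset.sum_union (Finset.disjoint_diag_offDiag _)]
  simp [Finset.sum_diag, hc]

/-- At most two ordered pairs have the same underlying set, so Cauchy–Schwarz costs a factor `2`. No
symmetry of `c` is assumed; the matrices used later are not symmetric. -/
theorem chaosCoeff_sq_le (c : ι → ι → ℝ) (S : Finset ι) :
    chaosCoeff c S ^ 2 ≤
      2 * ∑ p ∈ (Finset.univ : Finset ι).offDiag with {p.1, p.2} = S, c p.1 p.2 ^ 2 := by
  set F := (Finset.univ : Finset ι).offDiag.filter fun p => {p.1, p.2} = S with hF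
  have hcard : F.card ≤ 2 := by
    rcases F.eq_empty_or_nonempty with h | ⟨⟨i, j⟩, h⟩
    · simp [h]
    · refine (Finset.card_le_card (t := {(i, j), (j, i)}) ?_).trans Finset.card_le_two
      rintro ⟨x, y⟩ hxy
      simp only [hF, Finset.mem_filter, Finset.mem_offDiag, Finset.mem_univ, true_and] at h hxy
      have hx : x ∈ ({i, j} : Finset ι) := by rw [h.2, ← hxy.2]; simp
      have hy : y ∈ ({i, j} : Finset ι) := by rw [h.2, ← hxy.2]; simp
      have := hxy.1
      simp only [Finset.mem_insert, Finset.mem_singleton, Prod.mk.injEq] at hx hy ⊢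
      grind
  have h1 := sq_sum_le_card_mul_sum_sq (s := F) (f := fun p => c p.1 p.2)
  refine h1.trans (mul_le_mul_of_nonneg_right (by exact_mod_cast hcard)
    (Finset.sum_nonneg fun p _ => sq_nonneg _))

/-- All sets that carry a coefficient have two elements, so hypercontractivity weighs each of them
by `(2k-1)²`. -/
theorem sum_chaos_pow_le {c : ι → ι → ℝ} (hc : ∀ i, c i i = 0) {k : ℕ} (hk : 1 ≤ k) {V : ℝ}
    (hV : ∑ i, ∑ j, c i j ^ 2 ≤ V) :
    ∑ d : ι → ℤˣ, (∑ i, ∑ j, c i j * signVal d i * signVal d j) ^ (2 * k) ≤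
      2 ^ Fintype.card ι * ((2 * k - 1 : ℝ) ^ 2 * (2 * V)) ^ k := by
  have hk' : (1 : ℝ) ≤ k := by exact_mod_cast hk
  have hk1 : (0 : ℝ) ≤ 2 * k - 1 := by linarith
  have h := sum_walsh_pow_le hk Finset.univ (chaosCoeff c)
  simp only [walsh_chaosCoeff hc] at h
  refine h.trans ?_
  gcongr
  calc ∑ S ∈ (Finset.univ : Finset ι).powerset, (2 * k - 1 : ℝ) ^ S.card * chaosCoeff c S ^ 2
      ≤ ∑ S ∈ (Finset.univ : Finset ι).powerset, (2 * k - 1 : ℝ) ^ 2 *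
        (2 * ∑ p ∈ (Finset.univ : Finset ι).offDiag with {p.1, p.2} = S, c p.1 p.2 ^ 2) := by
        refine Finset.sum_le_sum fun S _ => ?_
        rcases ((Finset.univ : Finset ι).offDiag.filter fun p => {p.1, p.2} = S).eq_empty_or_nonempty
          with h | ⟨p, hp⟩
        · simp [chaosCoeff, h]
        · obtain ⟨hp1, hp2⟩ := Finset.mem_filter.1 hp
          have : S.card = 2 := by
            rw [← hp2, Finset.card_pair (Finset.mem_offDiag.1 hp1).2.2]
          rw [this]
          gcongr
          exact chaosCoeff_sq_le c S
    _ = (2 * k - 1 : ℝ) ^ 2 * (2 * ∑ p ∈ (Finset.univ : Finset ι).offDiag, c p.1 p.2 ^ 2) := by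
        rw [← Finset.mul_sum, ← Finset.mul_sum,
          Finset.sum_fiberwise_of_maps_to (fun p _ => by simp)]
    _ ≤ _ := by
        gcongr
        refine le_trans ?_ hV
        rw [← Finset.sum_product']
        exact Finset.sum_le_sum_of_subset_of_nonneg (fun p _ => by simp)
          fun p _ _ => sq_nonneg _

/-- The proportion of the signs for which a chaos is larger than `T`. -/
theorem card_chaos_le {c : ι → ι → ℝ} (hc : ∀ i, c i i = 0) {k : ℕ} (hk : 1 ≤ k) {V T : ℝ}
    (hT : 0 ≤ T) (hV : ∑ i, ∑ j, c i j ^ 2 ≤ V) :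
    ((Finset.univ.filter fun d : ι → ℤˣ =>
        T < |∑ i, ∑ j, c i j * signVal d i * signVal d j|).card : ℝ) * T ^ (2 * k) ≤
      2 ^ Fintype.card ι * ((2 * k - 1 : ℝ) ^ 2 * (2 * V)) ^ k := by
  -- Markov's inequality for the `2k`-th power.
  refine le_trans ?_ (sum_chaos_pow_le hc hk hV)
  rw [← nsmul_eq_mul, ← Finset.sum_const]
  refine (Finset.sum_le_sum fun d hd => ?_).trans (Finset.sum_le_sum_of_subset_of_nonneg
    (Finset.filter_subset _ _) fun d _ _ => by rw [pow_mul]; positivity)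
  rw [← Even.pow_abs ⟨k, two_mul k⟩ (∑ i, ∑ j, _)]
  have := (Finset.mem_filter.1 hd).2
  gcongr

end Walsh

/-! ### Coherent matrices from Reed–Solomon codes -/

/-- The `{0,1}`-matrix whose columns are the graphs of the polynomials `P j` on `{0, …, K - 1}`. -/
noncomputable def graphMatrix {N : ℕ} (K q : ℕ) (P : Fin N → Polynomial (ZMod q)) :
    Matrix (Fin (K * q)) (Fin N) ℕ :=
  Matrix.of fun i j =>
    if ((P j).eval (((finProdFinEquiv.symm i).1 : ℕ) : ZMod q)).val =
      ((finProdFinEquiv.symm i).2 : ℕ) then 1 else 0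

theorem graphMatrix_apply {N K q : ℕ} (P : Fin N → Polynomial (ZMod q)) (x : Fin K) (y : Fin q)
    (j : Fin N) : graphMatrix K q P (finProdFinEquiv (x, y)) j =
      if ((P j).eval ((x : ℕ) : ZMod q)).val = (y : ℕ) then 1 else 0 := by
  rw [graphMatrix, Matrix.of_apply, Equiv.symm_apply_apply]

theorem sum_graph_eq {q : ℕ} [NeZero q] (v : ZMod q) (F : Fin q → ℕ) :
    ∑ y : Fin q, (if v.val = (y : ℕ) then F y else 0) = F ⟨v.val, ZMod.val_lt v⟩ := by
  rw [Finset.sum_eq_single ⟨v.val, ZMod.val_lt v⟩]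
  · simp
  · intro y _ hy
    rw [if_neg]
    exact fun h => hy (Fin.ext h.symm)
  · simp

theorem graphMatrix_card_col {N K q : ℕ} [NeZero q] (P : Fin N → Polynomial (ZMod q)) (j : Fin N) :
    (Finset.univ.filter fun i => graphMatrix K q P i j = 1).card = K := by
  rw [Finset.card_filter, ← finProdFinEquiv.sum_comp, Fintype.sum_prod_type]
  have : ∀ x : Fin K, ∑ y : Fin q,
      (if graphMatrix K q P (finProdFinEquiv (x, y)) j = 1 then 1 else 0) = 1 := by
    intro x
    refine Eq.trans ?_ (sum_graph_eq ((P j).eval ((x : ℕ) : ZMod q)) (fun _ => 1))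
    refine Finset.sum_congr rfl fun y _ => ?_
    rw [graphMatrix_apply]
    split_ifs <;> simp_all only [not_true]
  simp [this]

/-- The inner product counts the points of `{0, …, K-1}` where the two polynomials agree. These are
roots of a nonzero difference of degree at most `a`, and `K ≤ q` keeps them distinct modulo `q`. -/
theorem graphMatrix_inner {N K q : ℕ} [Fact q.Prime] (hK : K ≤ q)
    (P : Fin N → Polynomial (ZMod q)) {a : ℕ} (hdeg : ∀ j, (P j).degree < (a + 1 : ℕ))
    (hP : Function.Injective P) {j l : Fin N} (hjl : j ≠ l) :
    ∑ i, graphMatrix K q P i j * graphMatrix K q P i l ≤ a := by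
  classical
  rw [← finProdFinEquiv.sum_comp, Fintype.sum_prod_type]
  have h1 : ∀ x : Fin K, ∑ y : Fin q, graphMatrix K q P (finProdFinEquiv (x, y)) j *
      graphMatrix K q P (finProdFinEquiv (x, y)) l =
      if (P j - P l).eval ((x : ℕ) : ZMod q) = 0 then 1 else 0 := by
    intro x
    have := sum_graph_eq ((P j).eval ((x : ℕ) : ZMod q))
      (fun y => if ((P l).eval ((x : ℕ) : ZMod q)).val = (y : ℕ) then 1 else 0)
    calc _ = _ := ?_
      _ = _ := this
      _ = _ := ?_
    · refine Finset.sum_congr rfl fun y _ => ?_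
      rw [graphMatrix_apply, graphMatrix_apply, ite_mul, one_mul, zero_mul]
    · simp only [Polynomial.eval_sub, sub_eq_zero]
      congr 1
      simp only [eq_iff_iff]
      rw [ZMod.val_injective q |>.eq_iff, eq_comm]
  simp only [h1]
  rw [← Finset.card_filter]
  have hne : P j - P l ≠ 0 := sub_ne_zero.2 fun h => hjl (hP h)
  have hd : (P j - P l).natDegree ≤ a := by
    have := (Polynomial.degree_sub_le (P j) (P l)).trans_lt (max_lt (hdeg j) (hdeg l))
    have := (Polynomial.natDegree_lt_iff_degree_lt hne).2 this
    omega
  refine le_trans ?_ ((Polynomial.card_roots' _).trans hd)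
  refine le_trans ?_ (Multiset.toFinset_card_le _)
  refine Finset.card_le_card_of_injOn (fun x => ((x : ℕ) : ZMod q)) ?_ ?_
  · intro x hx
    simpa [hne] using hx
  · intro x _ y _ hxy
    have := (ZMod.natCast_eq_natCast_iff' _ _ _).1 hxy
    rw [Nat.mod_eq_of_lt (x.isLt.trans_le hK), Nat.mod_eq_of_lt (y.isLt.trans_le hK)] at this
    exact Fin.ext this

/-- Bertrand's postulate supplies the prime `q`, hence at most `2K²` rows. There are `q ^ ⌈log_K N⌉
≥ N` polynomials of degree below `⌈log_K N⌉`, enough for `N` different columns. -/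
theorem exists_coherent_matrix {N K : ℕ} (hN : 2 ≤ N) (hK : 2 ≤ K) :
    ∃ (q : ℕ) (W : Matrix (Fin (K * q)) (Fin N) ℕ), K ≤ q ∧ q ≤ 2 * K ∧
      (∀ j, (Finset.univ.filter fun i => W i j = 1).card = K) ∧
      IsCoherent W K (Nat.clog K N - 1) := by
  obtain ⟨q, hq, hKq, hq2⟩ := Nat.exists_prime_lt_and_le_two_mul K (by omega)
  have : Fact q.Prime := ⟨hq⟩
  set a := Nat.clog K N - 1 with ha
  have hclog : 0 < Nat.clog K N := Nat.clog_pos (by omega) hN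
  have hcard : Fintype.card (Fin N) ≤ Fintype.card (Fin (a + 1) → ZMod q) := by
    simp only [Fintype.card_fin, Fintype.card_fun, ZMod.card]
    calc N ≤ K ^ Nat.clog K N := Nat.le_pow_clog (by omega) N
      _ = K ^ (a + 1) := by congr 1; omega
      _ ≤ q ^ (a + 1) := Nat.pow_le_pow_left hKq.le _
  obtain ⟨e⟩ := Function.Embedding.nonempty_of_card_le hcard
  let P : Fin N → Polynomial (ZMod q) := fun j =>
    ((Polynomial.degreeLTEquiv (ZMod q) (a + 1)).symm (e j)).1
  have hinj : Function.Injective P := fun j l h =>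
    e.injective ((Polynomial.degreeLTEquiv (ZMod q) (a + 1)).symm.injective (Subtype.ext h))
  have hdeg : ∀ j, (P j).degree < (a + 1 : ℕ) := fun j =>
    Polynomial.mem_degreeLT.1 ((Polynomial.degreeLTEquiv (ZMod q) (a + 1)).symm (e j)).2
  refine ⟨q, graphMatrix K q P, hKq.le, hq2, graphMatrix_card_col P, ?_, ?_, ?_⟩
  · intro i j
    simp only [graphMatrix, Matrix.of_apply]
    split_ifs <;> simp
  · exact fun j => (graphMatrix_card_col P j).ge
  · exact fun j l hjl => graphMatrix_inner hKq.le P hdeg hinj hjl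

theorem IsCoherent.mono {m' N : ℕ} {W : Matrix (Fin m') (Fin N) ℕ} {K a b : ℕ}
    (h : IsCoherent W K a) (hab : a ≤ b) : IsCoherent W K b :=
  ⟨h.zero_or_one, h.ones, fun j l hjl => (h.inner_le j l hjl).trans hab⟩

theorem clog_sub_one_le_log {K N : ℕ} (hK : 2 ≤ K) (hN : 2 ≤ N) :
    Nat.clog K N - 1 ≤ Nat.log K N := by
  refine Nat.le_log_of_pow_le (by omega) ?_
  simpa using (Nat.pow_pred_clog_lt_self (b := K) (by omega) hN).le

/-! ### Gram matrices and isometry defects -/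

theorem lpNormVec_two_sq {ι : Type*} [Fintype ι] (x : ι → ℂ) :
    lpNormVec 2 x ^ 2 = ∑ i, ‖x i‖ ^ 2 := by
  simp [lpNormVec, EuclideanSpace.norm_sq_eq]

theorem lpNormVec_one {ι : Type*} [Fintype ι] (x : ι → ℂ) :
    lpNormVec 1 x = ∑ i, ‖x i‖ := by
  rw [lpNormVec, PiLp.norm_eq_sum (by simp)]
  simp

theorem lpNormVec_nonneg {ι : Type*} [Fintype ι] (q : ℝ≥0∞) [Fact (1 ≤ q)] (x : ι → ℂ) :
    0 ≤ lpNormVec q x := norm_nonneg _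

theorem norm_le_lpNormVec_top {ι : Type*} [Fintype ι] (x : ι → ℂ) (i : ι) :
    ‖x i‖ ≤ lpNormVec ∞ x := by
  rw [lpNormVec, PiLp.norm_eq_ciSup]
  exact le_ciSup (f := fun i => ‖x i‖) (Set.finite_range _).bddAbove i

/-- The entries of the Gram matrix of the columns of `M`, with the diagonal replaced by `0`. -/
def offGram {ι : Type*} [Fintype ι] {N : ℕ} (M : Matrix ι (Fin N) ℝ) (j l : Fin N) : ℝ :=
  if j = l then 0 else ∑ i, M i j * M i l

/-- The value at `(x, y)` of the sesquilinear form given by a real matrix. -/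
def sesq {N : ℕ} (e : Fin N → Fin N → ℝ) (x y : Fin N → ℂ) : ℂ :=
  ∑ j, ∑ l, (e j l : ℂ) * (starRingEnd ℂ (x j) * y l)

/-- For unit columns the Gram matrix is the identity plus `offGram M`, so the isometry defect at `x`
is the form `sesq (offGram M) x x`. All isometry statements below reduce to bounds on this form. -/
theorem norm_mulVec_sq {ι : Type*} [Fintype ι] {N : ℕ} {M : Matrix ι (Fin N) ℝ}
    (hM : ∀ j, ∑ i, M i j ^ 2 = 1) (x : Fin N → ℂ) :
    ((lpNormVec 2 ((toComplex M).mulVec x) ^ 2 : ℝ) : ℂ) =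
      ((lpNormVec 2 x ^ 2 : ℝ) : ℂ) + sesq (offGram M) x x := by
  have h1 : ((lpNormVec 2 ((toComplex M).mulVec x) ^ 2 : ℝ) : ℂ) =
      ∑ j, ∑ l, ((∑ i, M i j * M i l : ℝ) : ℂ) * (starRingEnd ℂ (x j) * x l) := by
    rw [lpNormVec_two_sq]
    push_cast
    simp only [← Complex.conj_mul', Matrix.mulVec, dotProduct, toComplex, Matrix.map_apply, map_sum,
      map_mul, Complex.conj_ofReal]
    simp only [Finset.sum_mul_sum]
    simp only [Finset.sum_mul]
    rw [Finset.sum_comm]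
    refine Finset.sum_congr rfl fun j _ => ?_
    rw [Finset.sum_comm]
    refine Finset.sum_congr rfl fun l _ => Finset.sum_congr rfl fun i _ => ?_
    ring
  have h2 : ((lpNormVec 2 x ^ 2 : ℝ) : ℂ) =
      ∑ j, ∑ l, ((if j = l then 1 else 0 : ℝ) : ℂ) * (starRingEnd ℂ (x j) * x l) := by
    rw [lpNormVec_two_sq]
    push_cast
    simp [← Complex.conj_mul', apply_ite, ite_mul]
  rw [h1, h2, sesq, ← Finset.sum_add_distrib]
  refine Finset.sum_congr rfl fun j _ => ?_
  rw [← Finset.sum_add_distrib]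
  refine Finset.sum_congr rfl fun l _ => ?_
  rw [← add_mul]
  congr 1
  by_cases h : j = l
  · subst h
    simp only [offGram, if_true, ← pow_two, hM]; simp
  · simp [offGram, h]

theorem isJLMap_of_sesq_le {ι : Type*} [Fintype ι] {N : ℕ} {M : Matrix ι (Fin N) ℝ}
    (hM : ∀ j, ∑ i, M i j ^ 2 = 1) {ε : ℝ} {S : Set (Fin N → ℂ)}
    (h : ∀ x ∈ S, ‖sesq (offGram M) x x‖ ≤ ε * lpNormVec 2 x ^ 2) :
    IsJLMap ε (toComplex M) S := by
  intro x hx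
  have h1 := norm_mulVec_sq hM x
  have h2 := h x hx
  rw [eq_sub_iff_add_eq'.2 h1.symm, ← Complex.ofReal_sub, Complex.norm_real, Real.norm_eq_abs,
    abs_le] at h2
  constructor <;> linarith [h2.1, h2.2]

theorem sq_sum_norm_le_of_isSparse {N k : ℕ} {x : Fin N → ℂ} (hx : IsSparse k x) :
    (∑ j, ‖x j‖) ^ 2 ≤ k * ∑ j, ‖x j‖ ^ 2 := by
  classical
  set F := Finset.univ.filter fun j => x j ≠ 0 with hF
  have hcard : F.card ≤ k := by
    have : Function.support x = ↑F := by ext; simp [hF]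
    rw [IsSparse, this, Set.ncard_coe_finset] at hx
    exact hx
  have h1 : ∑ j, ‖x j‖ = ∑ j ∈ F, ‖x j‖ := by
    rw [hF, Finset.sum_filter_of_ne]; intro j _ h; simpa using h
  have h2 : ∑ j, ‖x j‖ ^ 2 = ∑ j ∈ F, ‖x j‖ ^ 2 := by
    rw [hF, Finset.sum_filter_of_ne]; intro j _ h; simpa using h
  rw [h1, h2]
  exact sq_sum_le_card_mul_sum_sq.trans (mul_le_mul_of_nonneg_right (by exact_mod_cast hcard)
    (Finset.sum_nonneg fun _ _ => sq_nonneg _))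

/-- A double sum with bounded coefficients, for a sparse vector. -/
theorem norm_sum_sum_le_of_isSparse {N k : ℕ} {z : Fin N → Fin N → ℂ} {μ : ℝ}
    (hμ : 0 ≤ μ) (hz : ∀ a b, ‖z a b‖ ≤ μ) {x : Fin N → ℂ} (hx : IsSparse k x) :
    ‖∑ a, ∑ b, z a b * (starRingEnd ℂ (x a) * x b)‖ ≤ μ * k * ∑ j, ‖x j‖ ^ 2 := by
  calc ‖∑ a, ∑ b, z a b * (starRingEnd ℂ (x a) * x b)‖
      ≤ ∑ a, ∑ b, ‖z a b * (starRingEnd ℂ (x a) * x b)‖ :=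
        (norm_sum_le _ _).trans (Finset.sum_le_sum fun a _ => norm_sum_le _ _)
    _ ≤ ∑ a, ∑ b, μ * (‖x a‖ * ‖x b‖) := by
        refine Finset.sum_le_sum fun a _ => Finset.sum_le_sum fun b _ => ?_
        rw [norm_mul, norm_mul, RCLike.norm_conj]
        gcongr
        exact hz a b
    _ = μ * (∑ j, ‖x j‖) ^ 2 := by
        simp_rw [pow_two, Finset.sum_mul_sum, Finset.mul_sum]
    _ ≤ μ * (k * ∑ j, ‖x j‖ ^ 2) := by
        gcongr
        exact sq_sum_norm_le_of_isSparse hx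
    _ = _ := by ring

/-- The form is at most `μ ‖x‖₁²`, and `‖x‖₁² ≤ k ‖x‖₂²` for `k`-sparse `x`. -/
theorem hasRIP_of_offGram_le {ι : Type*} [Fintype ι] {N k : ℕ} {M : Matrix ι (Fin N) ℝ}
    (hM : ∀ j, ∑ i, M i j ^ 2 = 1) {μ ε : ℝ} (hμ : 0 ≤ μ) (h : ∀ j l, |offGram M j l| ≤ μ)
    (hε : μ * k ≤ ε) : HasRIP k ε (toComplex M) := by
  refine isJLMap_of_sesq_le hM fun x hx => ?_
  rw [lpNormVec_two_sq]
  refine (norm_sum_sum_le_of_isSparse (z := fun j l => (offGram M j l : ℂ)) hμ (fun j l => ?_)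
    hx).trans (mul_le_mul_of_nonneg_right hε (Finset.sum_nonneg fun _ _ => sq_nonneg _))
  simpa using h j l

/-! ### The columns of the normalized sketch -/

theorem extBitTest_add {N : ℕ} (a : Fin (bitRows N)) (j : Fin N) :
    extBitTest N (Fin.cast (two_mul _).symm (Fin.castAdd _ a)) j +
      extBitTest N (Fin.cast (two_mul _).symm (Fin.natAdd _ a)) j = 1 := by
  have h : bitTest N a j ≤ 1 := by
    simp only [bitTest, Matrix.of_apply]; split_ifs <;> simp
  simp [extBitTest]
  omega

theorem extBitTest_zero_or_one {N : ℕ} (a : Fin (2 * bitRows N)) (j : Fin N) :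
    extBitTest N a j = 0 ∨ extBitTest N a j = 1 := by
  simp only [extBitTest, bitTest, Matrix.of_apply]
  split_ifs <;> simp

theorem sum_extBitTest {N : ℕ} (j : Fin N) : ∑ a, extBitTest N a j = bitRows N := by
  rw [← (finCongr (two_mul (bitRows N)).symm).sum_comp, Fin.sum_univ_add,
    ← Finset.sum_add_distrib]
  simp only [finCongr_apply, extBitTest_add]
  simp

theorem bitRows_pos (N : ℕ) : 0 < bitRows N := by simp [bitRows]

/-- Inner products of columns of a Khatri–Rao product are products of the inner products of the
factors. -/
theorem sum_baseSketch_mul {m' N K : ℕ} (hK : 0 < K) (W : Matrix (Fin m') (Fin N) ℕ)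
    (j l : Fin N) :
    ∑ i, baseSketch K W i j * baseSketch K W i l =
      (∑ i, (W i j * W i l : ℕ)) * (∑ a, (extBitTest N a j * extBitTest N a l : ℕ)) /
        ((K : ℝ) * bitRows N) := by
  have hs : (scale N K)⁻¹ * (scale N K)⁻¹ = ((K : ℝ) * bitRows N)⁻¹ := by
    rw [← mul_inv, scale, Real.mul_self_sqrt (by positivity)]
  have := bitRows_pos N
  rw [div_eq_mul_inv, ← hs]
  push_cast
  rw [Finset.sum_mul_sum, Finset.sum_mul]
  rw [Fintype.sum_prod_type]
  refine Finset.sum_congr rfl fun i _ => ?_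
  rw [Finset.sum_mul]
  refine Finset.sum_congr rfl fun a _ => ?_
  simp only [baseSketch, khatriRao, Matrix.smul_apply, Matrix.map_apply, Matrix.of_apply,
    smul_eq_mul, Nat.cast_mul]
  ring

theorem sum_baseSketch_sq {m' N K : ℕ} (hK : 0 < K) {W : Matrix (Fin m') (Fin N) ℕ}
    (hW : ∀ i j, W i j = 0 ∨ W i j = 1)
    (hones : ∀ j, (Finset.univ.filter fun i => W i j = 1).card = K) (j : Fin N) :
    ∑ i, baseSketch K W i j ^ 2 = 1 := by
  simp only [pow_two]
  rw [sum_baseSketch_mul hK]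
  have h1 : ∑ i, W i j * W i j = K := by
    rw [← hones j, Finset.card_filter]
    refine Finset.sum_congr rfl fun i _ => ?_
    rcases hW i j with h | h <;> simp [h]
  have h2 : ∑ a, extBitTest N a j * extBitTest N a j = bitRows N := by
    refine Eq.trans (Finset.sum_congr rfl fun i _ => ?_) (sum_extBitTest j)
    rcases extBitTest_zero_or_one i j with h | h <;> simp [h]
  have := bitRows_pos N
  rw [h1, h2]
  field_simp

/-- Each column of `B_N'` has exactly `bitRows N` ones, so the bit-test factor is at most `bitRows
N` and cancels against the normalization. -/
theorem abs_offGram_baseSketch_le {m' N K α : ℕ} (hK : 0 < K) {W : Matrix (Fin m') (Fin N) ℕ}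
    (hW : IsCoherent W K α) (j l : Fin N) :
    |offGram (baseSketch K W) j l| ≤ α / K := by
  rw [offGram]
  split_ifs with h
  · simp; positivity
  have := bitRows_pos N
  rw [sum_baseSketch_mul hK, abs_of_nonneg (by positivity)]
  have h1 := hW.inner_le j l h
  have h2 : ∑ a, extBitTest N a j * extBitTest N a l ≤ bitRows N := by
    refine (Finset.sum_le_sum fun a _ => ?_).trans_eq (sum_extBitTest j)
    rcases extBitTest_zero_or_one a l with h | h <;> simp [h]
  rw [div_le_div_iff₀ (by positivity) (by positivity)]
  have h1' : ((∑ i, W i j * W i l : ℕ) : ℝ) ≤ α := by exact_mod_cast h1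
  have h2' : ((∑ a, extBitTest N a j * extBitTest N a l : ℕ) : ℝ) ≤ bitRows N := by
    exact_mod_cast h2
  calc _ ≤ (α : ℝ) * bitRows N * K := by gcongr
    _ = _ := by ring

theorem sketch_apply {m' N K : ℕ} (W : Matrix (Fin m') (Fin N) ℕ) (d : Fin N → ℝ)
    (i : Fin m' × Fin (2 * bitRows N)) (j : Fin N) :
    sketch K W d i j = baseSketch K W i j * d j := by
  rw [sketch, Matrix.mul_diagonal]

/-- This is where the randomness enters: the isometry defect of the signed sketch is a quadratic
chaos in the signs, without diagonal terms. -/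
theorem offGram_sketch {m' N K : ℕ} (W : Matrix (Fin m') (Fin N) ℕ) (d : Fin N → ℝ)
    (j l : Fin N) :
    offGram (sketch K W d) j l = offGram (baseSketch K W) j l * d j * d l := by
  simp only [offGram, sketch_apply]
  split_ifs
  · simp
  · rw [Finset.sum_mul, Finset.sum_mul]
    exact Finset.sum_congr rfl fun i _ => by ring

/-! ### The Johnson–Lindenstrauss property for subspaces spanned by few columns of a unitary -/

theorem lpNormVec_two_unitary {N : ℕ} {U : Matrix (Fin N) (Fin N) ℂ}
    (hU : U ∈ Matrix.unitaryGroup (Fin N) ℂ) (c : Fin N → ℂ) :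
    lpNormVec 2 (U.mulVec c) ^ 2 = ∑ a, ‖c a‖ ^ 2 := by
  have h1 : ∀ x : Fin N → ℂ, ((∑ i, ‖x i‖ ^ 2 : ℝ) : ℂ) = dotProduct (star x) x := by
    intro x
    simp [dotProduct, Complex.conj_mul']
  rw [lpNormVec_two_sq]
  apply Complex.ofReal_injective
  rw [h1, h1, Matrix.star_mulVec, Matrix.dotProduct_mulVec, Matrix.vecMul_vecMul,
    ← Matrix.dotProduct_mulVec, ← Matrix.star_eq_conjTranspose,
    Matrix.mem_unitaryGroup_iff'.1 hU, Matrix.one_mulVec]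

theorem sesq_mulVec {N : ℕ} (e : Fin N → Fin N → ℝ) (U : Matrix (Fin N) (Fin N) ℂ)
    (c : Fin N → ℂ) :
    sesq e (U.mulVec c) (U.mulVec c) =
      ∑ a, ∑ b, sesq e (fun j => U j a) (fun l => U l b) * (starRingEnd ℂ (c a) * c b) := by
  simp only [sesq, Matrix.mulVec, dotProduct, map_sum, map_mul]
  simp only [Finset.sum_mul_sum]
  simp only [Finset.mul_sum, Finset.sum_mul]
  simp only [← Finset.sum_product', Finset.univ_product_univ]
  -- Both sides are sums over the same four indices; the bijection exchanges the pair of row indices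
  -- with the pair of column indices.
  refine Finset.sum_bij' (fun x _ => (x.2.2.1, x.2.2.2, x.1, x.2.1))
    (fun x _ => (x.2.2.1, x.2.2.2, x.1, x.2.1)) ?_ ?_ ?_ ?_ ?_ <;> intro x _
  · simp
  · simp
  · rfl
  · rfl
  · ring

/-- In the orthonormal basis of the columns of `U` the defect form has entries bounded by `μ`, and
the argument for the RIP applies to the coefficient vector. Finitely many bounds thus control
infinitely many vectors. -/
theorem isJLMap_unitary {ι : Type*} [Fintype ι] {N r : ℕ} {M : Matrix ι (Fin N) ℝ}
    (hM : ∀ j, ∑ i, M i j ^ 2 = 1) {U : Matrix (Fin N) (Fin N) ℂ}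
    (hU : U ∈ Matrix.unitaryGroup (Fin N) ℂ) {ε μ : ℝ} (hμ : 0 ≤ μ) (hμε : μ * r ≤ ε)
    (hz : ∀ a b, ‖sesq (offGram M) (fun j => U j a) (fun l => U l b)‖ ≤ μ) :
    IsJLMap ε (toComplex M) {x | ∃ c, IsSparse r c ∧ x = U.mulVec c} := by
  refine isJLMap_of_sesq_le hM ?_
  rintro x ⟨c, hc, rfl⟩
  rw [lpNormVec_two_unitary hU, sesq_mulVec]
  exact (norm_sum_sum_le_of_isSparse hμ hz hc).trans
    (mul_le_mul_of_nonneg_right hμε (Finset.sum_nonneg fun _ _ => sq_nonneg _))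

theorem IsJLMap.mono {ι : Type*} [Fintype ι] {N : ℕ} {ε : ℝ} {M : Matrix ι (Fin N) ℂ}
    {S T : Set (Fin N → ℂ)} (h : IsJLMap ε M T) (hST : S ⊆ T) : IsJLMap ε M S :=
  fun x hx => h x (hST hx)

theorem isSparse_of_forall_le {N r : ℕ} {c : Fin N → ℂ} (hc : ∀ j, r ≤ j.val → c j = 0) :
    IsSparse r c := by
  have hsub : Function.support c ⊆ ↑(Finset.univ.filter fun j : Fin N => j.val < r) := by
    intro j hj
    by_contra h
    exact hj (hc j (by simpa using h))
  refine (Set.ncard_le_ncard hsub (Finset.finite_toSet _)).trans ?_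
  rw [Set.ncard_coe_finset]
  calc _ ≤ (Finset.range r).card := Finset.card_le_card_of_injOn (fun j => j.val)
        (fun j hj => by simpa using hj) (fun a _ b _ h => Fin.ext h)
    _ = r := Finset.card_range r

theorem isSparse_single {N r : ℕ} (hr : 1 ≤ r) (j : Fin N) (z : ℂ) :
    IsSparse r (Pi.single j z) := by
  refine (Set.ncard_le_ncard (t := {j}) ?_ (Set.finite_singleton j)).trans (by simpa using hr)
  exact Pi.support_single_subset

/-- All the vectors in question have `r`-sparse coefficients with respect to `U` or `V`: the two
column spaces use only the first `r` columns, and a singular vector is a single column, which needs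
`1 ≤ r`. -/
theorem satisfiesJLAssumptions_of_sesq_le {ι : Type*} [Fintype ι] {N r : ℕ} (hr : 1 ≤ r)
    {M : Matrix ι (Fin N) ℝ} (hM : ∀ j, ∑ i, M i j ^ 2 = 1)
    {A U V : Matrix (Fin N) (Fin N) ℂ} {σ : Fin N → ℝ} (h : IsSVD A U σ V) {ε μ : ℝ}
    (hμ : 0 ≤ μ) (hμε : μ * r ≤ ε)
    (hzU : ∀ a b, ‖sesq (offGram M) (fun j => U j a) (fun l => U l b)‖ ≤ μ)
    (hzV : ∀ a b, ‖sesq (offGram M) (fun j => V j a) (fun l => V l b)‖ ≤ μ) :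
    SatisfiesJLAssumptions (toComplex M) U σ V r ε := by
  have hU := isJLMap_unitary hM h.unitary_left hμ hμε hzU
  have hV := isJLMap_unitary hM h.unitary_right hμ hμε hzV
  have hcol : ∀ (X : Matrix (Fin N) (Fin N) ℂ) (j : Fin N),
      (fun i => X i j) = X.mulVec (Pi.single j 1) := by
    intro X j; ext i; simp
  refine ⟨hU.mono ?_, hV.mono ?_, ?_⟩
  · rintro _ ⟨z, rfl⟩
    refine ⟨(Matrix.diagonal (fun j => if j.val < r then (σ j : ℂ) else 0) *
      V.conjTranspose).mulVec z, isSparse_of_forall_le fun j hj => ?_, ?_⟩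
    swap
    · rw [truncatedSVD, Matrix.mul_assoc, ← Matrix.mulVec_mulVec]
    · rw [← Matrix.mulVec_mulVec, Matrix.mulVec_diagonal, if_neg (by omega), zero_mul]
  · rintro _ ⟨z, rfl⟩
    refine ⟨(Matrix.diagonal (star fun j => if j.val < r then (σ j : ℂ) else 0) *
      U.conjTranspose).mulVec z, isSparse_of_forall_le fun j hj => ?_, ?_⟩
    swap
    · rw [truncatedSVD, Matrix.conjTranspose_mul, Matrix.conjTranspose_mul,
        Matrix.conjTranspose_conjTranspose, ← Matrix.mulVec_mulVec, Matrix.diagonal_conjTranspose]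
    · rw [← Matrix.mulVec_mulVec, Matrix.mulVec_diagonal, Pi.star_apply, if_neg (by omega),
        star_zero, zero_mul]
  · rintro x ⟨j, -, rfl | rfl⟩
    · exact hU _ ⟨_, isSparse_single hr j 1, hcol U j⟩
    · exact hV _ ⟨_, isSparse_single hr j 1, hcol V j⟩

/-! ### Random signs -/

theorem measure_eq_signVal {N : ℕ} {Ω : Type*} [MeasurableSpace Ω] (P : Measure Ω)
    {ξ : Fin N → Ω → ℝ} (hmeas : ∀ i, Measurable (ξ i)) (hind : iIndepFun ξ P)
    (hlaw : ∀ i, P.map (ξ i) = rademacher) (d : Fin N → ℤˣ) :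
    P {ω | ∀ i, ξ i ω = signVal d i} = (2⁻¹ : ℝ≥0∞) ^ N := by
  have hset : {ω | ∀ i, ξ i ω = signVal d i} =
      ⋂ i ∈ (Finset.univ : Finset (Fin N)), ξ i ⁻¹' {signVal d i} := by
    ext ω; simp
  rw [hset, hind.measure_inter_preimage_eq_mul Finset.univ
    (fun i _ => measurableSet_singleton _)]
  have : ∀ i, P (ξ i ⁻¹' {signVal d i}) = 2⁻¹ := by
    intro i
    rw [← Measure.map_apply (hmeas i) (measurableSet_singleton _), hlaw, rademacher]
    rcases signVal_eq d i with h | h <;> rw [h] <;>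
      norm_num [Measure.dirac_apply' _ (measurableSet_singleton _), Set.indicator]
  simp [this]

/-- The events that `ξ` equals a given sign vector are disjoint and have probability `2 ^ (-N)`
each, so it is enough to count. Only these events need to be measurable, not the one defined by `Q`.
-/
theorem le_measure_of_card_signs_le {N : ℕ} {Ω : Type*} [MeasurableSpace Ω] (P : Measure Ω)
    {ξ : Fin N → Ω → ℝ} (hmeas : ∀ i, Measurable (ξ i)) (hind : iIndepFun ξ P)
    (hlaw : ∀ i, P.map (ξ i) = rademacher) (Q : (Fin N → ℝ) → Prop) {p : ℝ} (F : Finset (Fin N → ℤˣ))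
    (hF : (F.card : ℝ) ≤ p * 2 ^ N) (hQ : ∀ d ∉ F, Q (signVal d)) :
    ENNReal.ofReal (1 - p) ≤ P {ω | Q fun i => ξ i ω} := by
  classical
  have hsub : (⋃ d ∈ Fᶜ, {ω | ∀ i, ξ i ω = signVal d i}) ⊆ {ω | Q fun i => ξ i ω} := by
    intro ω hω
    simp only [Set.mem_iUnion, Finset.mem_compl] at hω
    obtain ⟨d, hd, h⟩ := hω
    have : (fun i => ξ i ω) = signVal d := funext h
    simpa only [Set.mem_ofPred_eq, this] using hQ d hd
  refine le_trans ?_ (measure_mono hsub)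
  rw [measure_biUnion_finset]
  · simp only [measure_eq_signVal P hmeas hind hlaw, Finset.sum_const, nsmul_eq_mul]
    have hcard : ((Fᶜ.card : ℕ) : ℝ) = 2 ^ N - F.card := by
      rw [Finset.card_compl, Nat.cast_sub (Finset.card_le_univ _)]
      simp
    have h2 : ((Fᶜ.card : ℕ) : ℝ≥0∞) * 2⁻¹ ^ N =
        ENNReal.ofReal (((Fᶜ.card : ℕ) : ℝ) * (2⁻¹) ^ N) := by
      rw [ENNReal.ofReal_mul (by positivity), ENNReal.ofReal_natCast,
        ENNReal.ofReal_pow (by positivity), ENNReal.ofReal_inv_of_pos two_pos]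
      simp
    rw [h2]
    refine ENNReal.ofReal_le_ofReal ?_
    rw [hcard, inv_pow, ← div_eq_mul_inv, le_div_iff₀ (by positivity)]
    linarith
  · intro d _ d' _ hdd'
    refine Set.disjoint_left.2 fun ω h h' => hdd' (funext fun i => ?_)
    have := (h i).symm.trans (h' i)
    simp only [signVal, Int.cast_inj] at this
    exact Units.ext this
  · intro d _
    have : {ω | ∀ i, ξ i ω = signVal d i} = ⋂ i, ξ i ⁻¹' {signVal d i} := by ext; simp
    rw [this]
    exact MeasurableSet.iInter fun i => hmeas i (measurableSet_singleton _)

/-! ### Union bound over the entries of a chaos matrix -/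

theorem card_chaos_le_exp {N k : ℕ} (hk : 1 ≤ k) {c : Fin N → Fin N → ℝ} (hc : ∀ i, c i i = 0)
    {μ T : ℝ} (hV : ∑ i, ∑ j, c i j ^ 2 ≤ μ ^ 2) (hμ : 0 ≤ μ) (hT : 0 < T)
    (hTμ : 256 * k * μ ≤ T) :
    ((Finset.univ.filter fun d : Fin N → ℤˣ =>
        T < |∑ i, ∑ j, c i j * signVal d i * signVal d j|).card : ℝ) ≤
      2 ^ N * Real.exp (-k) ^ 2 := by
  have h := card_chaos_le hc hk hT.le hV
  have hk' : (1 : ℝ) ≤ k := by exact_mod_cast hk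
  -- Per factor, `(2k-1)² · 2μ² ≤ 8k²μ² ≤ (256kμ)² / 9 ≤ T² exp(-2)`, with much room. The `k`-th
  -- power yields `exp(-2k)`.
  have h1 : ((2 * k - 1 : ℝ) ^ 2 * (2 * μ ^ 2)) ^ k ≤ T ^ (2 * k) * Real.exp (-k) ^ 2 := by
    have e1 : Real.exp (-k) ^ 2 = (Real.exp (-2)) ^ k := by
      rw [← Real.exp_nat_mul, ← Real.exp_nat_mul]; congr 1; push_cast; ring
    rw [e1, pow_mul, ← mul_pow]
    have e2 : (1 / 9 : ℝ) ≤ Real.exp (-2) := by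
      rw [Real.exp_neg, one_div]
      refine inv_anti₀ (Real.exp_pos _) ?_
      have := Real.exp_one_lt_d9
      calc Real.exp 2 = Real.exp 1 ^ 2 := by rw [← Real.exp_nat_mul]; norm_num
        _ ≤ 3 ^ 2 := by gcongr; linarith
        _ = 9 := by norm_num
    have e3 : (256 * k * μ) ^ 2 ≤ T ^ 2 := by gcongr
    have e4 : (2 * k - 1 : ℝ) ^ 2 ≤ (2 * k) ^ 2 := by gcongr <;> linarith
    refine pow_le_pow_left₀ (by positivity) ?_ k
    calc (2 * k - 1 : ℝ) ^ 2 * (2 * μ ^ 2) ≤ (2 * k) ^ 2 * (2 * μ ^ 2) := by gcongr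
      _ ≤ (256 * k * μ) ^ 2 * (1 / 9) := by nlinarith [sq_nonneg (k * μ)]
      _ ≤ T ^ 2 * Real.exp (-2) := by gcongr
  have h2 := h.trans (mul_le_mul_of_nonneg_left h1 (by positivity))
  rw [Fintype.card_fin] at h2
  have hTk : 0 < T ^ (2 * k) := by positivity
  refine le_of_mul_le_mul_right (h2.trans_eq ?_) hTk
  ring

/-- The coefficients `e i j * conj (x i) * y j` have square sum at most `μ² ‖x‖² ‖y‖² ≤ μ²`. Real
and imaginary parts are two real chaoses with threshold `T / 2` each, whence the outer factor `2`.
-/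
theorem card_sesq_le_exp {N k : ℕ} (hk : 1 ≤ k) {e : Fin N → Fin N → ℝ} (he : ∀ i, e i i = 0)
    {μ T : ℝ} (heμ : ∀ i j, |e i j| ≤ μ) (hμ : 0 ≤ μ) (hT : 0 < T) (hTμ : 256 * k * μ ≤ T / 2)
    {x y : Fin N → ℂ} (hx : ∑ i, ‖x i‖ ^ 2 ≤ 1) (hy : ∑ i, ‖y i‖ ^ 2 ≤ 1) :
    ((Finset.univ.filter fun d : Fin N → ℤˣ =>
        T < ‖sesq (fun i j => e i j * signVal d i * signVal d j) x y‖).card : ℝ) ≤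
      2 * (2 ^ N * Real.exp (-k) ^ 2) := by
  set z : Fin N → Fin N → ℂ := fun i j => e i j * (starRingEnd ℂ (x i) * y j) with hz
  have hV : ∑ i, ∑ j, ‖z i j‖ ^ 2 ≤ μ ^ 2 := by
    calc ∑ i, ∑ j, ‖z i j‖ ^ 2 ≤ ∑ i, ∑ j, μ ^ 2 * (‖x i‖ ^ 2 * ‖y j‖ ^ 2) := by
          refine Finset.sum_le_sum fun i _ => Finset.sum_le_sum fun j _ => ?_
          simp only [hz, norm_mul, RCLike.norm_conj, Complex.norm_real, Real.norm_eq_abs, mul_pow]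
          have := heμ i j
          gcongr
      _ = μ ^ 2 * ((∑ i, ‖x i‖ ^ 2) * ∑ j, ‖y j‖ ^ 2) := by
          simp_rw [Finset.sum_mul_sum, Finset.mul_sum]
      _ ≤ μ ^ 2 * (1 * 1) := by
          gcongr
      _ = μ ^ 2 := by ring
  have hre : ∑ i, ∑ j, (z i j).re ^ 2 ≤ μ ^ 2 :=
    (Finset.sum_le_sum fun i _ => Finset.sum_le_sum fun j _ =>
      sq_le_sq.2 (by simpa using Complex.abs_re_le_norm (z i j))).trans hV
  have him : ∑ i, ∑ j, (z i j).im ^ 2 ≤ μ ^ 2 :=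
    (Finset.sum_le_sum fun i _ => Finset.sum_le_sum fun j _ =>
      sq_le_sq.2 (by simpa using Complex.abs_im_le_norm (z i j))).trans hV
  have h1 := card_chaos_le_exp hk (c := fun i j => (z i j).re) (by simp [hz, he]) hre hμ
    (half_pos hT) hTμ
  have h2 := card_chaos_le_exp hk (c := fun i j => (z i j).im) (by simp [hz, he]) him hμ
    (half_pos hT) hTμ
  have hs : ∀ d : Fin N → ℤˣ, sesq (fun i j => e i j * signVal d i * signVal d j) x y =
      ∑ i, ∑ j, ((signVal d i * signVal d j : ℝ) : ℂ) * z i j := by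
    intro d
    refine Finset.sum_congr rfl fun i _ => Finset.sum_congr rfl fun j _ => ?_
    simp only [hz]; push_cast; ring
  have hsub : (Finset.univ.filter fun d : Fin N → ℤˣ =>
        T < ‖sesq (fun i j => e i j * signVal d i * signVal d j) x y‖) ⊆
      (Finset.univ.filter fun d : Fin N → ℤˣ =>
        T / 2 < |∑ i, ∑ j, (z i j).re * signVal d i * signVal d j|) ∪
      (Finset.univ.filter fun d : Fin N → ℤˣ =>
        T / 2 < |∑ i, ∑ j, (z i j).im * signVal d i * signVal d j|) := by
    intro d hd
    simp only [Finset.mem_filter, Finset.mem_univ, true_and, Finset.mem_union] at hd ⊢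
    by_contra! hcon
    have h3 := Complex.norm_le_abs_re_add_abs_im
      (sesq (fun i j => e i j * signVal d i * signVal d j) x y)
    rw [hs] at h3 hd
    simp only [Complex.re_sum, Complex.im_sum, Complex.re_ofReal_mul, Complex.im_ofReal_mul] at h3
    have e1 : ∀ i j, signVal d i * signVal d j * (z i j).re =
      (z i j).re * signVal d i * signVal d j := fun i j => by ring
    have e2 : ∀ i j, signVal d i * signVal d j * (z i j).im =
      (z i j).im * signVal d i * signVal d j := fun i j => by ring
    simp only [e1, e2] at h3
    linarith [hcon.1, hcon.2]
  have h4 := (Finset.card_le_card hsub).trans (Finset.card_union_le _ _)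
  have h5 := (Nat.cast_le (α := ℝ)).2 h4
  push_cast at h5
  linarith

theorem card_bad_signs_le {N k : ℕ} (hk : 1 ≤ k) {e : Fin N → Fin N → ℝ} (he : ∀ i, e i i = 0)
    {μ T : ℝ} (heμ : ∀ i j, |e i j| ≤ μ) (hμ : 0 ≤ μ) (hT : 0 < T) (hTμ : 256 * k * μ ≤ T / 2)
    {U : Matrix (Fin N) (Fin N) ℂ} (hU : U ∈ Matrix.unitaryGroup (Fin N) ℂ) :
    ((Finset.univ.filter fun d : Fin N → ℤˣ => ∃ a b, T <
        ‖sesq (fun i j => e i j * signVal d i * signVal d j) (fun i => U i a) (fun i => U i b)‖).card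
        : ℝ) ≤ N ^ 2 * (2 * (2 ^ N * Real.exp (-k) ^ 2)) := by
  classical
  have hcol : ∀ a, ∑ i, ‖U i a‖ ^ 2 ≤ 1 := by
    intro a
    have h := lpNormVec_two_unitary hU (Pi.single a 1)
    rw [lpNormVec_two_sq] at h
    have h2 : ∑ j, ‖(Pi.single a 1 : Fin N → ℂ) j‖ ^ 2 = 1 := by
      rw [Finset.sum_eq_single a] <;> simp +contextual
    simpa [h2] using h.le
  have hsub : (Finset.univ.filter fun d : Fin N → ℤˣ => ∃ a b, T <
        ‖sesq (fun i j => e i j * signVal d i * signVal d j) (fun i => U i a) (fun i => U i b)‖) ⊆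
      (Finset.univ : Finset (Fin N × Fin N)).biUnion fun q =>
        Finset.univ.filter fun d : Fin N → ℤˣ => T <
          ‖sesq (fun i j => e i j * signVal d i * signVal d j) (fun i => U i q.1)
            (fun i => U i q.2)‖ := by
    intro d hd
    simp only [Finset.mem_filter, Finset.mem_univ, true_and, Finset.mem_biUnion] at hd ⊢
    obtain ⟨a, b, h⟩ := hd
    exact ⟨(a, b), h⟩
  have h1 := (Nat.cast_le (α := ℝ)).2 ((Finset.card_le_card hsub).trans Finset.card_biUnion_le)
  refine h1.trans ?_
  rw [Nat.cast_sum]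
  refine (Finset.sum_le_sum fun q _ => card_sesq_le_exp hk he heμ hμ hT hTμ (hcol q.1)
    (hcol q.2)).trans_eq ?_
  simp [pow_two]

/-- With the threshold `ε / r` for every pair of columns, the proportion of bad signs for `U` and
`V` together is at most `2 · N² · 2 exp(-2k) = 4 (N exp(-k))² ≤ 4 (p / 231)² ≤ p`. -/
theorem le_measure_satisfiesJLAssumptions {m' N K r k : ℕ} {W : Matrix (Fin m') (Fin N) ℕ}
    (hr : 1 ≤ r) (hk : 1 ≤ k) (hM : ∀ j, ∑ i, baseSketch K W i j ^ 2 = 1) {μ ε p : ℝ} (hμ : 0 ≤ μ)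
    (hε : 0 < ε) (hp : 0 < p) (hp1 : p < 1)
    (hWμ : ∀ j l, |offGram (baseSketch K W) j l| ≤ μ) (hμε : 512 * r * k * μ ≤ ε)
    (hkp : Real.log (231 * N / p) ≤ k) {A U V : Matrix (Fin N) (Fin N) ℂ} {σ : Fin N → ℝ}
    (h : IsSVD A U σ V) {Ω : Type*} [MeasurableSpace Ω] (P : Measure Ω)
    {ξ : Fin N → Ω → ℝ} (hmeas : ∀ i, Measurable (ξ i)) (hind : iIndepFun ξ P)
    (hlaw : ∀ i, P.map (ξ i) = rademacher) :
    ENNReal.ofReal (1 - p) ≤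
      P {ω | SatisfiesJLAssumptions (toComplex (sketch K W fun i => ξ i ω)) U σ V r ε} := by
  classical
  set e := offGram (baseSketch K W) with he
  have he0 : ∀ i, e i i = 0 := fun i => by simp [he, offGram]
  have hr' : (0 : ℝ) < r := by exact_mod_cast hr
  have hT : 0 < ε / r := by positivity
  have hTμ : 256 * k * μ ≤ ε / r / 2 := by
    rw [div_div, le_div_iff₀ (by positivity)]; linarith
  let bad : Matrix (Fin N) (Fin N) ℂ → Finset (Fin N → ℤˣ) := fun U =>
    Finset.univ.filter fun d : Fin N → ℤˣ => ∃ a b, ε / r <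
      ‖sesq (fun i j => e i j * signVal d i * signVal d j) (fun i => U i a) (fun i => U i b)‖
  refine le_measure_of_card_signs_le P hmeas hind hlaw
    (fun d => SatisfiesJLAssumptions (toComplex (sketch K W d)) U σ V r ε) (bad U ∪ bad V) ?_ ?_
  · have h1 := card_bad_signs_le hk he0 hWμ hμ hT hTμ h.unitary_left
    have h2 := card_bad_signs_le hk he0 hWμ hμ hT hTμ h.unitary_right
    have h3 := (Nat.cast_le (α := ℝ)).2 (Finset.card_union_le (bad U) (bad V))
    push_cast at h3
    refine (h3.trans (add_le_add h1 h2)).trans ?_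
    rcases Nat.eq_zero_or_pos N with rfl | hN
    · simp [hp.le]
    have hN' : (1 : ℝ) ≤ N := by exact_mod_cast hN
    have h4 : Real.exp (-k) ≤ p / (231 * N) := by
      rw [Real.exp_neg, ← inv_div]
      refine inv_anti₀ (by positivity) ?_
      rwa [← Real.log_le_iff_le_exp (by positivity)]
    have h5 : N * Real.exp (-k) ≤ p / 231 := by
      calc N * Real.exp (-k) ≤ N * (p / (231 * N)) := by gcongr
        _ = p / 231 := by field_simp
    have h6 : (N * Real.exp (-k)) ^ 2 ≤ (p / 231) ^ 2 := by gcongr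
    calc _ = 4 * (N * Real.exp (-k)) ^ 2 * 2 ^ N := by ring
      _ ≤ p * 2 ^ N := by
        gcongr
        nlinarith
  · intro d hd
    simp only [Finset.mem_union, not_or, bad, Finset.mem_filter, Finset.mem_univ, true_and,
      not_exists, not_lt] at hd
    have hg : offGram (sketch K W (signVal d)) = fun i j => e i j * signVal d i * signVal d j := by
      ext i j; rw [offGram_sketch]
    refine satisfiesJLAssumptions_of_sesq_le hr (fun j => ?_) h hT.le
      (div_mul_cancel₀ _ hr'.ne').le ?_ ?_
    · simp only [sketch_apply, mul_pow, signVal_sq, mul_one, hM]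
    · rw [hg]; exact hd.1
    · rw [hg]; exact hd.2

/-! ### Keeping the largest estimates -/

theorem lpNormVec_add_le {ι : Type*} [Fintype ι] (q : ℝ≥0∞) [Fact (1 ≤ q)] (x y : ι → ℂ) :
    lpNormVec q (x + y) ≤ lpNormVec q x + lpNormVec q y := by
  simp only [lpNormVec, WithLp.toLp_add]
  exact norm_add_le _ _

/-- The `2`-norm of `x` outside of a set of largest estimated entries. -/
theorem sum_compl_sq_le {N k : ℕ} (x : Fin N → ℂ) {xh : Fin N → ℂ} {R T S : Finset (Fin N)} {e : ℝ}
    (he : 0 ≤ e) (hest : ∀ j ∈ R, ‖xh j - x j‖ ≤ e) (hout : ∀ j ∉ R, ‖x j‖ ≤ 2 * e)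
    (hTR : T ⊆ R) (hT : T = R ∨ T.card = k) (hmax : ∀ j ∈ R \ T, ∀ l ∈ T, ‖xh j‖ ≤ ‖xh l‖)
    (hS : S.card ≤ k) :
    ∑ j ∈ Tᶜ, ‖x j‖ ^ 2 ≤ (√(∑ j ∈ Sᶜ, ‖x j‖ ^ 2) + √k * (2 * e)) ^ 2 := by
  -- `m` is the least modulus of `x` on `T \ S`. An index of `S` that was lost to `T` has an
  -- estimate no larger than that of the minimizer, so its entry is at most `m + 2e`. The entries
  -- gained on `T \ S` pay for the part `m`.
  obtain ⟨m, hm0, hm, hmT⟩ : ∃ m : ℝ, 0 ≤ m ∧ (∀ j ∈ S \ T, ‖x j‖ ≤ m + 2 * e) ∧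
      ((S \ T).card : ℝ) * m ^ 2 ≤ ∑ j ∈ T \ S, ‖x j‖ ^ 2 := by
    -- Here `m = 0` works: either lost indices lie outside `R`, where entries are at most `2e`, or
    -- `T ⊆ S` has the full size `k`, so that nothing is lost.
    by_cases h : T = R ∨ T \ S = ∅
    · refine ⟨0, le_rfl, fun j hj => ?_, by simp; exact Finset.sum_nonneg fun _ _ => sq_nonneg _⟩
      have hj' := Finset.mem_sdiff.1 hj
      rcases h with h | h
      · simpa using hout j (h ▸ hj'.2)
      · rcases hT with hT | hT
        · simpa using hout j (hT ▸ hj'.2)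
        · have h1 : T = S := Finset.eq_of_subset_of_card_le (Finset.sdiff_eq_empty_iff_subset.1 h)
            (by omega)
          exact absurd (h1 ▸ hj'.1) hj'.2
    · push Not at h
      obtain ⟨l, hl, hmin⟩ := Finset.exists_min_image (T \ S) (fun l => ‖x l‖)
        h.2
      have hlT := (Finset.mem_sdiff.1 hl).1
      refine ⟨‖x l‖, norm_nonneg _, fun j hj => ?_, ?_⟩
      · have hj' := Finset.mem_sdiff.1 hj
        by_cases hjR : j ∈ R
        · have h1 := hmax j (Finset.mem_sdiff.2 ⟨hjR, hj'.2⟩) l hlT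
          have h2 := norm_sub_norm_le (x j) (xh j)
          have h3 := norm_sub_norm_le (xh l) (x l)
          have h4 := hest j hjR
          have h5 := hest l (hTR hlT)
          rw [norm_sub_rev] at h4
          linarith
        · have := hout j hjR
          linarith [norm_nonneg (x l)]
      · have hcard : (S \ T).card ≤ (T \ S).card := by
          have h1 := Finset.card_sdiff_add_card_inter S T
          have h2 := Finset.card_sdiff_add_card_inter T S
          rw [Finset.inter_comm] at h2
          have := hT.resolve_left h.1
          omega
        calc ((S \ T).card : ℝ) * ‖x l‖ ^ 2 ≤ ((T \ S).card : ℝ) * ‖x l‖ ^ 2 := by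
              gcongr
          _ = ∑ j ∈ T \ S, ‖x l‖ ^ 2 := by simp
          _ ≤ _ := Finset.sum_le_sum fun j hj => by
              have := hmin j hj
              gcongr
  set X := ∑ j ∈ (S ∪ T)ᶜ, ‖x j‖ ^ 2 with hX
  have e1 : ∑ j ∈ Tᶜ, ‖x j‖ ^ 2 = X + ∑ j ∈ S \ T, ‖x j‖ ^ 2 := by
    rw [hX, ← Finset.sum_union]
    · congr 1; ext j; simp; tauto
    · exact Finset.disjoint_left.2 fun j h1 h2 => by simp at h1 h2; tauto
  have e2 : ∑ j ∈ Sᶜ, ‖x j‖ ^ 2 = X + ∑ j ∈ T \ S, ‖x j‖ ^ 2 := by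
    rw [hX, ← Finset.sum_union]
    · congr 1; ext j; simp; tauto
    · exact Finset.disjoint_left.2 fun j h1 h2 => by simp at h1 h2; tauto
  have hX0 : 0 ≤ X := Finset.sum_nonneg fun _ _ => sq_nonneg _
  set c : ℝ := ((S \ T).card : ℝ) with hc
  have hc0 : 0 ≤ c := by positivity
  have hck : c ≤ k := by
    rw [hc]; exact_mod_cast (Finset.card_le_card Finset.sdiff_subset).trans hS
  set A := √(∑ j ∈ Sᶜ, ‖x j‖ ^ 2) with hA
  have hA2 : A ^ 2 = ∑ j ∈ Sᶜ, ‖x j‖ ^ 2 := Real.sq_sqrt (Finset.sum_nonneg fun _ _ => sq_nonneg _)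
  have h1 : ∑ j ∈ S \ T, ‖x j‖ ^ 2 ≤ c * (m + 2 * e) ^ 2 := by
    calc _ ≤ ∑ j ∈ S \ T, (m + 2 * e) ^ 2 := Finset.sum_le_sum fun j hj => by
          have := hm j hj
          gcongr
      _ = _ := by simp [hc]
  have h2 : √c * m ≤ A := by
    refine abs_le_of_sq_le_sq' ?_ (Real.sqrt_nonneg _) |>.2
    rw [mul_pow, Real.sq_sqrt hc0, hA2, e2]; linarith
  have h3 : √c ^ 2 = c := Real.sq_sqrt hc0
  -- Completing the square: `X + c m² ≤ A²` absorbs the main terms, and `√c m ≤ A` the cross term.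
  calc ∑ j ∈ Tᶜ, ‖x j‖ ^ 2 ≤ X + c * (m + 2 * e) ^ 2 := by rw [e1]; linarith
    _ = X + c * m ^ 2 + 2 * (√c * (2 * e)) * (√c * m) + (√c * (2 * e)) ^ 2 := by
        linear_combination (-4 * e * m - 4 * e ^ 2) * h3
    _ ≤ A ^ 2 + 2 * (√c * (2 * e)) * A + (√c * (2 * e)) ^ 2 := by
        have : X + c * m ^ 2 ≤ A ^ 2 := by rw [hA2, e2]; linarith
        gcongr
    _ = (A + √c * (2 * e)) ^ 2 := by ring
    _ ≤ _ := by gcongr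

/-- The kept entries contribute an error `√k e`, the dropped ones `2 √k e` more than the competitor
`S`, which is an arbitrary set of at most `k` indices. -/
theorem lpNormVec_sub_threshold_le {N k : ℕ} (x : Fin N → ℂ) {xh : Fin N → ℂ}
    {R T S : Finset (Fin N)} {e : ℝ}
    (he : 0 ≤ e) (hest : ∀ j ∈ R, ‖xh j - x j‖ ≤ e) (hout : ∀ j ∉ R, ‖x j‖ ≤ 2 * e)
    (hTR : T ⊆ R) (hTk : T.card ≤ k) (hT : T = R ∨ T.card = k)
    (hmax : ∀ j ∈ R \ T, ∀ l ∈ T, ‖xh j‖ ≤ ‖xh l‖) (hS : S.card ≤ k) :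
    lpNormVec 2 (x - fun j => if j ∈ T then xh j else 0) ≤
      √(∑ j ∈ Sᶜ, ‖x j‖ ^ 2) + 3 * √k * e := by
  have hsplit : (x - fun j => if j ∈ T then xh j else 0) =
      (fun j => if j ∈ T then x j - xh j else 0) + fun j => if j ∈ T then 0 else x j := by
    ext j; by_cases h : j ∈ T <;> simp [h]
  rw [hsplit]
  refine (lpNormVec_add_le 2 _ _).trans ?_
  have h1 : lpNormVec 2 (fun j => if j ∈ T then x j - xh j else 0) ≤ √k * e := by
    refine abs_le_of_sq_le_sq' ?_ (by positivity) |>.2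
    rw [lpNormVec_two_sq, mul_pow, Real.sq_sqrt (by positivity)]
    calc ∑ j, ‖if j ∈ T then x j - xh j else 0‖ ^ 2 = ∑ j ∈ T, ‖x j - xh j‖ ^ 2 := by
          rw [← Finset.sum_filter_add_sum_filter_not Finset.univ (· ∈ T)]
          rw [Finset.filter_mem_eq_inter, Finset.univ_inter]
          rw [Finset.sum_congr rfl (fun j hj => by rw [if_pos hj]), add_eq_left]
          exact Finset.sum_eq_zero fun j hj => by simp [(Finset.mem_filter.1 hj).2]
      _ ≤ ∑ j ∈ T, e ^ 2 := Finset.sum_le_sum fun j hj => by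
          have := hest j (hTR hj)
          rw [norm_sub_rev] at this
          gcongr
      _ = T.card * e ^ 2 := by simp
      _ ≤ k * e ^ 2 := by gcongr
  have h2 : lpNormVec 2 (fun j => if j ∈ T then 0 else x j) ≤
      √(∑ j ∈ Sᶜ, ‖x j‖ ^ 2) + √k * (2 * e) := by
    refine abs_le_of_sq_le_sq' ?_ (by positivity) |>.2
    rw [lpNormVec_two_sq]
    refine le_trans (le_of_eq ?_) (sum_compl_sq_le x he hest hout hTR hT hmax hS)
    rw [← Finset.sum_filter_add_sum_filter_not Finset.univ (· ∈ T)]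
    rw [Finset.sum_eq_zero (fun j hj => by simp [(Finset.mem_filter.1 hj).2]), zero_add]
    refine Finset.sum_congr (by ext; simp) fun j hj => ?_
    rw [if_neg (by simpa using hj)]
  linarith

/-! ### Rows with little interference -/

section Rows

variable {m' N K α s : ℕ} {W : Matrix (Fin m') (Fin N) ℕ}

open Classical in
theorem card_interference_le (hW : IsCoherent W K α) (j : Fin N) {S : Finset (Fin N)}
    (hS : S.card ≤ s) :
    (Finset.univ.filter fun i => W i j = 1 ∧ ∃ l ∈ S, l ≠ j ∧ W i l = 1).card ≤ s * α := by
  classical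
  have hsub : (Finset.univ.filter fun i => W i j = 1 ∧ ∃ l ∈ S, l ≠ j ∧ W i l = 1) ⊆
      (S.erase j).biUnion fun l => Finset.univ.filter fun i => W i j = 1 ∧ W i l = 1 := by
    intro i hi
    simp only [Finset.mem_filter, Finset.mem_univ, true_and, Finset.mem_biUnion,
      Finset.mem_erase] at hi ⊢
    obtain ⟨h1, l, hl, hlj, h2⟩ := hi
    exact ⟨l, ⟨hlj, hl⟩, h1, h2⟩
  refine (Finset.card_le_card hsub).trans ((Finset.card_biUnion_le_card_mul _ _ α ?_).trans ?_)
  · intro l hl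
    refine le_trans ?_ (hW.inner_le j l (Finset.ne_of_mem_erase hl).symm)
    rw [Finset.card_filter]
    refine Finset.sum_le_sum fun i _ => ?_
    split_ifs with h
    · simp [h]
    · exact Nat.zero_le _
  · exact Nat.mul_le_mul_right _ ((Finset.card_le_card (Finset.erase_subset _ _)).trans hS)

/-- Double counting: over the rows of column `j`, an index `l ≠ j` is met at most `α` times, so
these rows receive total mass at most `α s η`, while each heavy row receives more than `η`. -/
theorem card_heavy_tail_le (hW : IsCoherent W K α) (j : Fin N) {S : Finset (Fin N)}
    {x : Fin N → ℝ} (hx : ∀ l, 0 ≤ x l) {η : ℝ} (hη : ∑ l ∈ Sᶜ, x l ≤ s * η) (hη0 : 0 ≤ η) :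
    (Finset.univ.filter fun i => W i j = 1 ∧ η < ∑ l ∈ Sᶜ.erase j, W i l * x l).card ≤ s * α := by
  classical
  set F := Finset.univ.filter fun i => W i j = 1 ∧ η < ∑ l ∈ Sᶜ.erase j, W i l * x l with hF
  have hsum : ∑ i ∈ F, ∑ l ∈ Sᶜ.erase j, W i l * x l ≤ α * (s * η) := by
    calc ∑ i ∈ F, ∑ l ∈ Sᶜ.erase j, W i l * x l
        = ∑ i ∈ F, ∑ l ∈ Sᶜ.erase j, ((W i j * W i l : ℕ) : ℝ) * x l := by
          refine Finset.sum_congr rfl fun i hi => Finset.sum_congr rfl fun l _ => ?_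
          rw [(Finset.mem_filter.1 hi).2.1, one_mul]
      _ ≤ ∑ i, ∑ l ∈ Sᶜ.erase j, ((W i j * W i l : ℕ) : ℝ) * x l :=
          Finset.sum_le_sum_of_subset_of_nonneg (Finset.subset_univ _) fun i _ _ =>
            Finset.sum_nonneg fun l _ => mul_nonneg (by positivity) (hx l)
      _ = ∑ l ∈ Sᶜ.erase j, ((∑ i, W i j * W i l : ℕ) : ℝ) * x l := by
          rw [Finset.sum_comm]
          refine Finset.sum_congr rfl fun l _ => ?_
          rw [Nat.cast_sum, Finset.sum_mul]
      _ ≤ ∑ l ∈ Sᶜ.erase j, α * x l := Finset.sum_le_sum fun l hl => by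
          have := hW.inner_le j l (Finset.ne_of_mem_erase hl).symm
          have := hx l
          gcongr
      _ = α * ∑ l ∈ Sᶜ.erase j, x l := by rw [Finset.mul_sum]
      _ ≤ α * ∑ l ∈ Sᶜ, x l := by
          gcongr ?_ * ?_
          exact Finset.sum_le_sum_of_subset_of_nonneg (Finset.erase_subset _ _) fun l _ _ => hx l
      _ ≤ α * (s * η) := by gcongr
  have hlow : (F.card : ℝ) * η ≤ α * (s * η) := by
    refine le_trans ?_ hsum
    rw [← nsmul_eq_mul, ← Finset.sum_const]
    exact Finset.sum_le_sum fun i hi => (Finset.mem_filter.1 hi).2.2.le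
  -- For `η = 0` one cannot divide by `η`; there the total mass vanishes and no row is heavy.
  rcases hη0.eq_or_lt with h | h
  · rcases F.eq_empty_or_nonempty with h' | h'
    · simp [h']
    · exfalso
      have : ∑ i ∈ F, η < ∑ i ∈ F, ∑ l ∈ Sᶜ.erase j, W i l * x l :=
        Finset.sum_lt_sum_of_nonempty h' fun i hi => (Finset.mem_filter.1 hi).2.2
      rw [← h] at this hsum
      simp at this hsum
      linarith
  · have : (F.card : ℝ) ≤ α * s := by
      refine le_of_mul_le_mul_right ?_ h
      linarith
    have h2 : F.card ≤ α * s := by exact_mod_cast this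
    linarith

/-- More than half of the rows of column `j` are hit by little of the other entries of `x`. -/
theorem card_good_rows (hW : IsCoherent W K α)
    (hones : ∀ j, (Finset.univ.filter fun i => W i j = 1).card = K) (hK : 4 * α * s + 1 ≤ K)
    (j : Fin N) {S : Finset (Fin N)} (hS : S.card ≤ s)
    {x : Fin N → ℝ} (hx : ∀ l, 0 ≤ x l) {η : ℝ} (hη : ∑ l ∈ Sᶜ, x l ≤ s * η) (hη0 : 0 ≤ η) :
    K < 2 * (Finset.univ.filter fun i =>
      W i j = 1 ∧ ∑ l ∈ Finset.univ.erase j, W i l * x l ≤ η).card := by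
  classical
  -- At most `2sα` of the `K` rows are bad, and `2 (K - 2sα) > K` because `4αs + 1 ≤ K`.
  have h1 := card_interference_le hW j hS
  have h2 := card_heavy_tail_le hW j hx hη hη0
  have hsub : (Finset.univ.filter fun i => W i j = 1) ⊆
      (Finset.univ.filter fun i => W i j = 1 ∧ ∑ l ∈ Finset.univ.erase j, W i l * x l ≤ η) ∪
      ((Finset.univ.filter fun i => W i j = 1 ∧ ∃ l ∈ S, l ≠ j ∧ W i l = 1) ∪
      (Finset.univ.filter fun i => W i j = 1 ∧ η < ∑ l ∈ Sᶜ.erase j, W i l * x l)) := by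
    intro i hi
    simp only [Finset.mem_filter, Finset.mem_univ, true_and, Finset.mem_union] at hi ⊢
    by_contra! hcon
    obtain ⟨c1, c2, c3⟩ := hcon
    have d1 := c1 hi
    have d2 := c2 hi
    have d3 := c3 hi
    have : ∑ l ∈ Finset.univ.erase j, W i l * x l = ∑ l ∈ Sᶜ.erase j, (W i l : ℝ) * x l := by
      refine (Finset.sum_subset (Finset.erase_subset_erase _ (Finset.subset_univ _))
        fun l hl hl' => ?_).symm
      have hlj := Finset.ne_of_mem_erase hl
      have hlS : l ∈ S := by
        by_contra hcon; exact hl' (Finset.mem_erase.2 ⟨hlj, by simpa using hcon⟩)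
      have := (hW.zero_or_one i l).resolve_right (d2 l hlS hlj)
      simp [this]
    linarith
  have h3 := (Finset.card_le_card hsub).trans (Finset.card_union_le _ _)
  have h4 := Finset.card_union_le
    (Finset.univ.filter fun i => W i j = 1 ∧ ∃ l ∈ S, l ≠ j ∧ W i l = 1)
    (Finset.univ.filter fun i => W i j = 1 ∧ η < ∑ l ∈ Sᶜ.erase j, W i l * x l)
  rw [hones] at h3
  nlinarith

end Rows

/-! ### Recovery from bit tests and medians -/

/-- The measurement in row `k` of the block `i`, and `0` outside of the range. -/
def rowEntry {m' b : ℕ} (y : Fin m' × Fin b → ℂ) (i k : ℕ) : ℂ :=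
  if h : i < m' ∧ k < b then y (⟨i, h.1⟩, ⟨k, h.2⟩) else 0

/-- The bit tests of block `i` clearly point to the index `j`. -/
def RowDecodes {m' b : ℕ} (y : Fin m' × Fin (2 * b) → ℂ) (i j : ℕ) : Prop :=
  ∀ a, a + 1 < b → if j.testBit a
    then ‖rowEntry y i (b + (a + 1))‖ < ‖rowEntry y i (a + 1)‖
    else ‖rowEntry y i (a + 1)‖ < ‖rowEntry y i (b + (a + 1))‖

/-- At least half of the `K` values that `z` takes on the ones of column `j` are `≤ v`, and at
least half of them are `≥ v`. -/
def IsColumnMedian {m' N : ℕ} (K : ℕ) (W : Matrix (Fin m') (Fin N) ℕ) (z : Fin m' → ℝ) (j : Fin N)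
    (v : ℝ) : Prop :=
  K ≤ 2 * (Finset.univ.filter fun i => W i j = 1 ∧ z i ≤ v).card ∧
  K ≤ 2 * (Finset.univ.filter fun i => W i j = 1 ∧ v ≤ z i).card

open Classical in
/-- `x` arises from `y` by collecting indices to which many blocks point, estimating their entries
by medians, and keeping the `k` largest estimates. -/
def IsRecovery {m' N b : ℕ} (K k : ℕ) (W : Matrix (Fin m') (Fin N) ℕ)
    (y : Fin m' × Fin (2 * b) → ℂ) (x : Fin N → ℂ) : Prop :=
  ∃ (R T : Finset (Fin N)) (est : Fin N → ℂ),
    (∀ j : Fin N, K < 2 * (Finset.univ.filter fun i : Fin m' => RowDecodes y i j).card → j ∈ R) ∧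
    (∀ j ∈ R, IsColumnMedian K W (fun i => (rowEntry y i 0).re) j (est j).re ∧
      IsColumnMedian K W (fun i => (rowEntry y i 0).im) j (est j).im) ∧
    T ⊆ R ∧ T.card ≤ k ∧ (T = R ∨ T.card = k) ∧
    (∀ j ∈ R \ T, ∀ l ∈ T, ‖est j‖ ≤ ‖est l‖) ∧
    x = fun j => if j ∈ T then est j else 0

/-- `G` is a strict majority of the `K` rows, so it meets both the half with values at most `v` and
the half with values at least `v`. This traps `v` between two good values. -/
theorem IsColumnMedian.abs_sub_le {m' N K : ℕ} {W : Matrix (Fin m') (Fin N) ℕ} {z : Fin m' → ℝ}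
    {j : Fin N} {v x δ : ℝ} (h : IsColumnMedian K W z j v)
    (hones : (Finset.univ.filter fun i => W i j = 1).card = K) {G : Finset (Fin m')}
    (hG : ∀ i ∈ G, W i j = 1 ∧ |z i - x| ≤ δ) (hGK : K < 2 * G.card) : |v - x| ≤ δ := by
  have meet : ∀ p : Fin m' → Prop, ∀ [DecidablePred p],
      K ≤ 2 * (Finset.univ.filter fun i => W i j = 1 ∧ p i).card → ∃ i ∈ G, p i := by
    intro p _ hp
    by_contra! hcon
    have hdisj : Disjoint G (Finset.univ.filter fun i => W i j = 1 ∧ p i) :=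
      Finset.disjoint_left.2 fun i h1 h2 => hcon i h1 (Finset.mem_filter.1 h2).2.2
    have hsub : G ∪ (Finset.univ.filter fun i => W i j = 1 ∧ p i) ⊆
        Finset.univ.filter fun i => W i j = 1 := by
      intro i hi
      rcases Finset.mem_union.1 hi with h | h
      · simpa using (hG i h).1
      · simpa using (Finset.mem_filter.1 h).2.1
    have := Finset.card_le_card hsub
    rw [Finset.card_union_of_disjoint hdisj, hones] at this
    omega
  obtain ⟨i, hi, h1⟩ := meet _ h.1
  obtain ⟨l, hl, h2⟩ := meet _ h.2
  have h3 := abs_le.1 (hG i hi).2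
  have h4 := abs_le.1 (hG l hl).2
  rw [abs_le]
  constructor <;> linarith

section

variable {m' N K : ℕ} {W : Matrix (Fin m') (Fin N) ℕ}

theorem scale_pos (hK : 0 < K) : 0 < scale N K := by
  have := bitRows_pos N
  rw [scale]; positivity

/-- The scaled measurements. -/
theorem scale_mul_measurement (hK : 0 < K) (d : Fin N → ℝ) (u : Fin N → ℂ)
    (n : Fin m' × Fin (2 * bitRows N) → ℂ) (i : Fin m') (a : Fin (2 * bitRows N)) :
    (scale N K : ℂ) * ((toComplex (sketch K W d)).mulVec u + n) (i, a) =
      ∑ l, ((W i l * extBitTest N a l : ℕ) : ℂ) * (d l * u l) + scale N K * n (i, a) := by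
  have hs : (scale N K : ℂ) ≠ 0 := by exact_mod_cast (scale_pos hK).ne'
  rw [Pi.add_apply, mul_add, Matrix.mulVec, dotProduct, Finset.mul_sum]
  congr 1
  refine Finset.sum_congr rfl fun l _ => ?_
  simp only [toComplex, Matrix.map_apply, sketch_apply, baseSketch, Matrix.smul_apply, khatriRao,
    Matrix.of_apply, smul_eq_mul]
  push_cast
  field_simp

/-- The interference of the other entries in the measurement `(i, a)`. -/
theorem norm_measurement_sub_le (hK : 0 < K) {d : Fin N → ℝ}
    {u x : Fin N → ℂ} (hx : ∀ l, x l = d l * u l) (n : Fin m' × Fin (2 * bitRows N) → ℂ)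
    {i : Fin m'} (a : Fin (2 * bitRows N)) {j : Fin N} (hj : W i j = 1) :
    ‖(scale N K : ℂ) * ((toComplex (sketch K W d)).mulVec u + n) (i, a) - extBitTest N a j * x j‖ ≤
      ∑ l ∈ Finset.univ.erase j, (W i l * extBitTest N a l : ℕ) * ‖x l‖ +
        scale N K * lpNormVec ∞ n := by
  rw [scale_mul_measurement hK, ← Finset.add_sum_erase _ _ (Finset.mem_univ j), hj, one_mul, hx]
  have : ((extBitTest N a j : ℕ) : ℂ) * (d j * u j) +
      ∑ l ∈ Finset.univ.erase j, ((W i l * extBitTest N a l : ℕ) : ℂ) * (d l * u l) +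
        scale N K * n (i, a) - extBitTest N a j * (d j * u j) =
      ∑ l ∈ Finset.univ.erase j, ((W i l * extBitTest N a l : ℕ) : ℂ) * (d l * u l) +
        scale N K * n (i, a) := by ring
  rw [this]
  refine (norm_add_le _ _).trans (add_le_add ((norm_sum_le _ _).trans_eq ?_) ?_)
  · refine Finset.sum_congr rfl fun l _ => ?_
    rw [norm_mul, Complex.norm_natCast, hx]
  · rw [norm_mul, Complex.norm_real, Real.norm_of_nonneg (scale_pos hK).le]
    exact mul_le_mul_of_nonneg_left (norm_le_lpNormVec_top n _) (scale_pos hK).le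

theorem rowEntry_val {b : ℕ} (y : Fin m' × Fin b → ℂ) (i : Fin m') {k : ℕ} (hk : k < b) :
    rowEntry y i k = y (i, ⟨k, hk⟩) := by
  simp [rowEntry, hk]

theorem extBitTest_low {a : ℕ} (ha : a + 1 < bitRows N) (j : Fin N) :
    extBitTest N ⟨a + 1, by omega⟩ j = if j.val.testBit a then 1 else 0 := by
  simp [extBitTest, bitTest, ha]

theorem extBitTest_high {a : ℕ} (ha : a + 1 < bitRows N) (j : Fin N) :
    extBitTest N ⟨bitRows N + (a + 1), by omega⟩ j = if j.val.testBit a then 0 else 1 := by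
  simp only [extBitTest, bitTest, Matrix.of_apply]
  rw [dif_neg (by simp)]
  simp
  split_ifs <;> rfl

theorem extBitTest_zero (j : Fin N) :
    extBitTest N ⟨0, by have := bitRows_pos N; omega⟩ j = 1 := by
  simp [extBitTest, bitTest, bitRows_pos]

/-- Every other index contributes to exactly one of a test row and its complement, so the
interferences in the two rows add up to at most `η`, not `2η`. With the noise in both rows, `‖x j‖ >
η + 2ν` decides the comparison correctly, where `ν` is the scaled noise level. -/
theorem rowDecodes_of_good (hK : 0 < K) {d : Fin N → ℝ}
    {u x : Fin N → ℂ} (hx : ∀ l, x l = d l * u l) (n : Fin m' × Fin (2 * bitRows N) → ℂ)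
    {i : Fin m'} {j : Fin N} (hj : W i j = 1) {η : ℝ}
    (hη : ∑ l ∈ Finset.univ.erase j, W i l * ‖x l‖ ≤ η)
    (hlarge : η + 2 * (scale N K * lpNormVec ∞ n) < ‖x j‖) :
    RowDecodes ((toComplex (sketch K W d)).mulVec u + n) i j := by
  intro a ha
  set y := (toComplex (sketch K W d)).mulVec u + n with hy
  have hs := scale_pos (N := N) hK
  rw [rowEntry_val _ _ (by omega), rowEntry_val _ _ (by omega)]
  have h1 := norm_measurement_sub_le hK hx n (⟨a + 1, by omega⟩ : Fin (2 * bitRows N)) hj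
  have h2 := norm_measurement_sub_le hK hx n
    (⟨bitRows N + (a + 1), by omega⟩ : Fin (2 * bitRows N)) hj
  rw [← hy] at h1 h2
  set y1 := y (i, ⟨a + 1, by omega⟩)
  set y2 := y (i, ⟨bitRows N + (a + 1), by omega⟩)
  have h3 : ∑ l ∈ Finset.univ.erase j, (W i l * extBitTest N ⟨a + 1, by omega⟩ l : ℕ) * ‖x l‖ +
      ∑ l ∈ Finset.univ.erase j, (W i l * extBitTest N ⟨bitRows N + (a + 1), by omega⟩ l : ℕ) *
        ‖x l‖ ≤ η := by
    refine le_trans (le_of_eq ?_) hη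
    rw [← Finset.sum_add_distrib]
    refine Finset.sum_congr rfl fun l _ => ?_
    rw [extBitTest_low ha, extBitTest_high ha]
    split_ifs <;> simp
  have hn1 : ‖(scale N K : ℂ) * y1‖ = scale N K * ‖y1‖ := by
    rw [norm_mul, Complex.norm_real, Real.norm_of_nonneg hs.le]
  have hn2 : ‖(scale N K : ℂ) * y2‖ = scale N K * ‖y2‖ := by
    rw [norm_mul, Complex.norm_real, Real.norm_of_nonneg hs.le]
  rw [extBitTest_low ha] at h1
  rw [extBitTest_high ha] at h2
  split_ifs at h1 h2 ⊢ with hbit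
  · have h4 := norm_sub_norm_le (x j) ((scale N K : ℂ) * y1)
    rw [norm_sub_rev] at h4
    simp only [Nat.cast_one, one_mul, Nat.cast_zero, zero_mul, sub_zero] at h1 h2
    refine lt_of_mul_lt_mul_left ?_ hs.le
    rw [← hn1, ← hn2]; linarith
  · have h4 := norm_sub_norm_le (x j) ((scale N K : ℂ) * y2)
    rw [norm_sub_rev] at h4
    simp only [Nat.cast_one, one_mul, Nat.cast_zero, zero_mul, sub_zero] at h1 h2
    refine lt_of_mul_lt_mul_left ?_ hs.le
    rw [← hn1, ← hn2]; linarith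

theorem norm_le_sqrt_two_mul {z : ℂ} {δ : ℝ} (h1 : |z.re| ≤ δ) (h2 : |z.im| ≤ δ) :
    ‖z‖ ≤ √2 * δ := by
  have hδ : 0 ≤ δ := (abs_nonneg _).trans h1
  refine abs_le_of_sq_le_sq' ?_ (by positivity) |>.2
  rw [mul_pow, Real.sq_sqrt zero_le_two, Complex.sq_norm, Complex.normSq_apply]
  have := sq_le_sq' (abs_le.1 h1).1 (abs_le.1 h1).2
  have := sq_le_sq' (abs_le.1 h2).1 (abs_le.1 h2).2
  nlinarith

theorem recovery_error_le {α s : ℕ} (hs : 1 ≤ s) (hWc : IsCoherent W K α)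
    (hones : ∀ j, (Finset.univ.filter fun i => W i j = 1).card = K) (hK : 4 * α * s + 1 ≤ K)
    {d : Fin N → ℝ} (hd : ∀ i, d i = 1 ∨ d i = -1) (u : Fin N → ℂ)
    (n : Fin m' × Fin (2 * bitRows N) → ℂ) {xh : Fin N → ℂ}
    (hxh : IsRecovery K (2 * s) W ((toComplex (sketch K W d)).mulVec u + n) xh)
    {S S₂ : Finset (Fin N)} (hS : S.card ≤ s) (hS₂ : S₂.card ≤ 2 * s) :
    lpNormVec 2 (u - fun i => ((scale N K * d i : ℝ) : ℂ) * xh i) ≤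
      √(∑ j ∈ S₂ᶜ, ‖u j‖ ^ 2) + 6 * √s * ((∑ j ∈ Sᶜ, ‖u j‖) / s + scale N K * lpNormVec ∞ n) := by
  classical
  have hK0 : 0 < K := by omega
  have hsc := scale_pos (N := N) hK0
  set η := (∑ j ∈ Sᶜ, ‖u j‖) / s with hη
  set ν := scale N K * lpNormVec ∞ n with hν
  have hη0 : 0 ≤ η := by positivity
  have hν0 : 0 ≤ ν := mul_nonneg hsc.le (lpNormVec_nonneg _ _)
  set x : Fin N → ℂ := fun l => d l * u l with hx
  have hxu : ∀ l, ‖x l‖ = ‖u l‖ := by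
    intro l; rcases hd l with h | h <;> simp [hx, h]
  obtain ⟨R, T, est, hR, hest, hTR, hTk, hT, hmax, rfl⟩ := hxh
  have hs' : (s : ℝ) ≠ 0 := by positivity
  have hgood := fun j => card_good_rows hWc hones hK j hS (x := fun l => ‖x l‖)
    (fun _ => norm_nonneg _) (η := η) (by simp only [hxu, hη]; field_simp; rfl) hη0
  -- An entry above `2√2 (η + ν) ≥ η + 2ν` is decoded in all good rows, hence gets more than `K / 2`
  -- votes.
  have hout : ∀ j ∉ R, ‖x j‖ ≤ 2 * (√2 * (η + ν)) := by
    intro j hj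
    by_contra! hcon
    have h2 : 1 ≤ √2 := by rw [Real.one_le_sqrt]; norm_num
    refine hj (hR j ((hgood j).trans_le (Nat.mul_le_mul_left 2 (Finset.card_le_card ?_))))
    intro i hi
    simp only [Finset.mem_filter, Finset.mem_univ, true_and] at hi ⊢
    refine rowDecodes_of_good hK0 (fun _ => rfl) n hi.1 hi.2 ?_
    rw [← hν]
    refine lt_of_le_of_lt ?_ hcon
    nlinarith
  -- Row `0` of a block is the all-ones test. Medians are taken separately in the real and imaginary
  -- parts, which costs the factor `√2`; the interval bounds are divided by `scale N K` because
  -- `est` is computed from unscaled data.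
  have hest' : ∀ j ∈ R, ‖(scale N K : ℂ) * est j - x j‖ ≤ √2 * (η + ν) := by
    intro j hj
    have hrow : ∀ i ∈ (Finset.univ.filter fun i =>
        W i j = 1 ∧ ∑ l ∈ Finset.univ.erase j, W i l * ‖x l‖ ≤ η), W i j = 1 ∧
        ‖(scale N K : ℂ) * rowEntry ((toComplex (sketch K W d)).mulVec u + n) i 0 - x j‖
          ≤ η + ν := by
      intro i hi
      simp only [Finset.mem_filter, Finset.mem_univ, true_and] at hi
      refine ⟨hi.1, ?_⟩
      have hb := bitRows_pos N
      have h1 := norm_measurement_sub_le hK0 (fun _ => rfl : ∀ l, x l = d l * u l) n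
        (⟨0, by omega⟩ : Fin (2 * bitRows N)) hi.1
      simp only [extBitTest_zero, mul_one, Nat.cast_one, one_mul] at h1
      rw [rowEntry_val _ _ (by omega)]
      linarith [hi.2]
    have hdiv : ∀ a c : ℝ, |a - c / scale N K| ≤ (η + ν) / scale N K →
        |scale N K * a - c| ≤ η + ν := by
      intro a c h
      have e : scale N K * a - c = (a - c / scale N K) * scale N K := by field_simp
      rwa [e, abs_mul, abs_of_pos hsc, ← le_div_iff₀ hsc]
    have hdiv' : ∀ a c : ℝ, |scale N K * a - c| ≤ η + ν →
        |a - c / scale N K| ≤ (η + ν) / scale N K := by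
      intro a c h
      have e : scale N K * a - c = (a - c / scale N K) * scale N K := by field_simp
      rwa [e, abs_mul, abs_of_pos hsc, ← le_div_iff₀ hsc] at h
    refine norm_le_sqrt_two_mul ?_ ?_
    · rw [Complex.sub_re, Complex.re_ofReal_mul]
      refine hdiv _ _ ((hest j hj).1.abs_sub_le (hones j) (fun i hi => ⟨(hrow i hi).1, hdiv' _ _ ?_⟩)
        (hgood j))
      have := (Complex.abs_re_le_norm _).trans (hrow i hi).2
      rwa [Complex.sub_re, Complex.re_ofReal_mul] at this
    · rw [Complex.sub_im, Complex.im_ofReal_mul]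
      refine hdiv _ _ ((hest j hj).2.abs_sub_le (hones j) (fun i hi => ⟨(hrow i hi).1, hdiv' _ _ ?_⟩)
        (hgood j))
      have := (Complex.abs_im_le_norm _).trans (hrow i hi).2
      rwa [Complex.sub_im, Complex.im_ofReal_mul] at this
  have key := lpNormVec_sub_threshold_le x (xh := fun j => (scale N K : ℂ) * est j)
    (by positivity) hest' hout hTR hTk hT (fun j hj l hl => by
      simp only [norm_mul]
      exact mul_le_mul_of_nonneg_left (hmax j hj l hl) (norm_nonneg _)) hS₂
  -- Multiplication by the signs `d` preserves all moduli and is its own inverse.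
  have heq : lpNormVec 2 (u - fun i => ((scale N K * d i : ℝ) : ℂ) * if i ∈ T then est i else 0) =
      lpNormVec 2 (x - fun j => if j ∈ T then (scale N K : ℂ) * est j else 0) := by
    rw [← sq_eq_sq₀ (lpNormVec_nonneg _ _) (lpNormVec_nonneg _ _), lpNormVec_two_sq,
      lpNormVec_two_sq]
    refine Finset.sum_congr rfl fun j _ => ?_
    congr 1
    have hdd : ‖(d j : ℂ)‖ = 1 := by rcases hd j with h | h <;> simp [h]
    have hd2 : (d j : ℂ) * d j = 1 := by rcases hd j with h | h <;> simp [h]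
    have e : (x - fun j => if j ∈ T then (scale N K : ℂ) * est j else 0) j = d j *
        (u - fun i => ((scale N K * d i : ℝ) : ℂ) * if i ∈ T then est i else 0) j := by
      simp only [Pi.sub_apply, hx]
      push_cast
      split_ifs
      · linear_combination (scale N K * est j) * hd2
      · ring
    rw [e, norm_mul, hdd, one_mul]
  rw [heq]
  refine key.trans_eq ?_
  simp only [hxu]
  congr 1
  push_cast
  -- The constant is `3 √(2s) · √2 = 6 √s`.
  rw [Real.sqrt_mul zero_le_two]
  have h2 : √2 * √2 = 2 := Real.mul_self_sqrt zero_le_two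
  linear_combination (3 * √s * (η + ν)) * h2

theorem recovery_error_le_bestApproxError {α s : ℕ} (hs : 1 ≤ s) (hWc : IsCoherent W K α)
    (hones : ∀ j, (Finset.univ.filter fun i => W i j = 1).card = K) (hK : 4 * α * s + 1 ≤ K)
    {d : Fin N → ℝ} (hd : ∀ i, d i = 1 ∨ d i = -1) (u : Fin N → ℂ)
    (n : Fin m' × Fin (2 * bitRows N) → ℂ) {xh : Fin N → ℂ}
    (hxh : IsRecovery K (2 * s) W ((toComplex (sketch K W d)).mulVec u + n) xh) :
    lpNormVec 2 (u - fun i => ((scale N K * d i : ℝ) : ℂ) * xh i) ≤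
      bestApproxError 2 (2 * s) u + 6 * (1 + √2) *
        (bestApproxError 1 s u / √s + beta N s K n * lpNormVec 2 n) := by
  classical
  have hs0 : (0 : ℝ) < s := by exact_mod_cast hs
  -- For `n = 0` the quotient in `beta` is `0 / 0 = 0`, and both sides vanish.
  have hbeta : beta N s K n * lpNormVec 2 n = √s * (scale N K * lpNormVec ∞ n) := by
    have e1 : √((s : ℝ) * K * bitRows N) = √s * scale N K := by
      rw [scale, ← Real.sqrt_mul hs0.le, mul_assoc]
    by_cases hn : lpNormVec 2 n = 0
    · have hn0 : n = 0 := by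
        have h1 := lpNormVec_two_sq n
        rw [hn] at h1
        ext i
        have h2 := (Finset.sum_eq_zero_iff_of_nonneg fun i _ => sq_nonneg ‖n i‖).1
          (by simpa using h1.symm) i (Finset.mem_univ i)
        simpa using h2
      have : lpNormVec ∞ n = 0 := by rw [hn0]; simp [lpNormVec]
      rw [hn, this]; simp
    · rw [beta, div_mul_cancel₀ _ hn, e1]; ring
  have hc : 6 ≤ 6 * (1 + √2) := by nlinarith [Real.sqrt_nonneg 2]
  have hne : ∀ k, Nonempty {v : Fin N → ℂ // IsSparse k v} := fun k =>
    ⟨⟨0, by simp [IsSparse]⟩⟩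
  -- The supports of two arbitrary sparse competitors serve as `S` and `S₂`: off its support a
  -- competitor vanishes, so `u` agrees there with the difference.
  have main : ∀ (v : {v : Fin N → ℂ // IsSparse s v}) (v₂ : {v : Fin N → ℂ // IsSparse (2 * s) v}),
      lpNormVec 2 (u - fun i => ((scale N K * d i : ℝ) : ℂ) * xh i) ≤
      lpNormVec 2 (u - v₂.1) + 6 * (1 + √2) *
        (lpNormVec 1 (u - v.1) / √s + √s * (scale N K * lpNormVec ∞ n)) := by
    intro v v₂
    set S := Finset.univ.filter fun j => v.1 j ≠ 0 with hS
    set S₂ := Finset.univ.filter fun j => v₂.1 j ≠ 0 with hS₂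
    have hcard : ∀ (k : ℕ) (w : Fin N → ℂ), IsSparse k w →
        (Finset.univ.filter fun j => w j ≠ 0).card ≤ k := by
      intro k w hw
      have : Function.support w = ↑(Finset.univ.filter fun j => w j ≠ 0) := by ext; simp
      rwa [IsSparse, this, Set.ncard_coe_finset] at hw
    refine (recovery_error_le hs hWc hones hK hd u n hxh (hcard s v.1 v.2)
      (hcard _ v₂.1 v₂.2)).trans ?_
    have h1 : ∑ j ∈ Sᶜ, ‖u j‖ ≤ lpNormVec 1 (u - v.1) := by
      rw [lpNormVec_one]
      calc ∑ j ∈ Sᶜ, ‖u j‖ = ∑ j ∈ Sᶜ, ‖(u - v.1) j‖ := by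
            refine Finset.sum_congr rfl fun j hj => ?_
            have : v.1 j = 0 := by simpa [hS] using hj
            simp [this]
        _ ≤ _ := Finset.sum_le_sum_of_subset_of_nonneg (Finset.subset_univ _)
            fun _ _ _ => norm_nonneg _
    have h2 : √(∑ j ∈ S₂ᶜ, ‖u j‖ ^ 2) ≤ lpNormVec 2 (u - v₂.1) := by
      rw [Real.sqrt_le_left (lpNormVec_nonneg _ _), lpNormVec_two_sq]
      calc ∑ j ∈ S₂ᶜ, ‖u j‖ ^ 2 = ∑ j ∈ S₂ᶜ, ‖(u - v₂.1) j‖ ^ 2 := by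
            refine Finset.sum_congr rfl fun j hj => ?_
            have : v₂.1 j = 0 := by simpa [hS₂] using hj
            simp [this]
        _ ≤ _ := Finset.sum_le_sum_of_subset_of_nonneg (Finset.subset_univ _)
            fun _ _ _ => sq_nonneg _
    have hν : 0 ≤ scale N K * lpNormVec ∞ n :=
      mul_nonneg (scale_pos (by omega)).le (lpNormVec_nonneg _ _)
    have e3 : 6 * √s * ((∑ j ∈ Sᶜ, ‖u j‖) / s + scale N K * lpNormVec ∞ n) =
        6 * ((∑ j ∈ Sᶜ, ‖u j‖) / √s + √s * (scale N K * lpNormVec ∞ n)) := by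
      have h4 : √(s : ℝ) * √s = s := Real.mul_self_sqrt hs0.le
      have h5 : 0 < √(s : ℝ) := Real.sqrt_pos.2 hs0
      have h7 : (∑ j ∈ Sᶜ, ‖u j‖) / s = (∑ j ∈ Sᶜ, ‖u j‖) / √s / √s := by rw [div_div, h4]
      rw [h7]
      field_simp
    rw [e3]
    have h6 : 0 ≤ lpNormVec 1 (u - v.1) := lpNormVec_nonneg _ _
    gcongr
  rw [hbeta]
  set e := lpNormVec 2 (u - fun i => ((scale N K * d i : ℝ) : ℂ) * xh i)
  have hsq : 0 < √(s : ℝ) := Real.sqrt_pos.2 hs0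
  have hc0 : 0 < 6 * (1 + √2) := by positivity
  -- The two infima are taken one after the other, each time with the inequality solved for the norm
  -- in question.
  have step1 : ∀ v : {v : Fin N → ℂ // IsSparse s v}, e - 6 * (1 + √2) *
        (lpNormVec 1 (u - v.1) / √s + √s * (scale N K * lpNormVec ∞ n)) ≤
        bestApproxError 2 (2 * s) u := by
    intro v
    have := hne (2 * s)
    exact le_ciInf fun v₂ => by linarith [main v v₂]
  have step2 : (((e - bestApproxError 2 (2 * s) u) / (6 * (1 + √2))) -
      √s * (scale N K * lpNormVec ∞ n)) * √s ≤ bestApproxError 1 s u := by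
    have := hne s
    refine le_ciInf fun v => ?_
    rw [← le_div_iff₀ hsq, sub_le_iff_le_add, div_le_iff₀ hc0]
    linarith [step1 v]
  rw [← le_div_iff₀ hsq, sub_le_iff_le_add, div_le_iff₀ hc0] at step2
  linarith

end

/-! ### Weakest preconditions with running times -/

/-- The program `c`, started in `σ`, halts in a store and after a number of steps that satisfy `Q`. -/
def Wp (T : ℕ → ℕ → ℕ) (c : Cmd) (σ : Store) (Q : Store → ℕ → Prop) : Prop :=
  ∃ τ k, Exec T c σ τ k ∧ Q τ k

/-- Execution of a list of instructions. -/
def evalList (T : ℕ → ℕ → ℕ) : List Instr → Store → Store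
  | [], σ => σ
  | c :: l, σ => evalList T l (c.eval T σ)

/-- A sequence of instructions as a program. -/
def block : Instr → List Instr → Cmd
  | c, [] => .instr c
  | c, d :: l => .seq (.instr c) (block d l)

section Wp

variable {T : ℕ → ℕ → ℕ} {σ : Store} {Q Q' : Store → ℕ → Prop} {c c₁ c₂ : Cmd} {a b : ℕ}

theorem Wp.mono (h : Wp T c σ Q') (hQ : ∀ τ k, Q' τ k → Q τ k) : Wp T c σ Q := by
  obtain ⟨τ, k, h1, h2⟩ := h
  exact ⟨τ, k, h1, hQ _ _ h2⟩

theorem Wp.seq (h : Wp T c₁ σ fun τ k => Wp T c₂ τ fun υ l => Q υ (k + l)) :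
    Wp T (.seq c₁ c₂) σ Q := by
  obtain ⟨τ, k, h1, υ, l, h2, h3⟩ := h
  exact ⟨υ, k + l, .seq h1 h2, h3⟩

theorem Wp.ifNat (h₁ : σ.nat a < σ.nat b → Wp T c₁ σ fun τ k => Q τ (k + 1))
    (h₂ : ¬ σ.nat a < σ.nat b → Wp T c₂ σ fun τ k => Q τ (k + 1)) :
    Wp T (.ifNat a b c₁ c₂) σ Q := by
  by_cases h : σ.nat a < σ.nat b
  · obtain ⟨τ, k, h3, h4⟩ := h₁ h
    exact ⟨τ, k + 1, .ifNat_true h h3, h4⟩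
  · obtain ⟨τ, k, h3, h4⟩ := h₂ h
    exact ⟨τ, k + 1, .ifNat_false h h3, h4⟩

theorem Wp.ifReal (h₁ : σ.real a < σ.real b → Wp T c₁ σ fun τ k => Q τ (k + 1))
    (h₂ : ¬ σ.real a < σ.real b → Wp T c₂ σ fun τ k => Q τ (k + 1)) :
    Wp T (.ifReal a b c₁ c₂) σ Q := by
  by_cases h : σ.real a < σ.real b
  · obtain ⟨τ, k, h3, h4⟩ := h₁ h
    exact ⟨τ, k + 1, .ifReal_true h h3, h4⟩
  · obtain ⟨τ, k, h3, h4⟩ := h₂ h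
    exact ⟨τ, k + 1, .ifReal_false h h3, h4⟩

theorem Wp.block {i : Instr} {l : List Instr} (h : Q (evalList T (i :: l) σ) (l.length + 1)) :
    Wp T (block i l) σ Q := by
  induction l generalizing i σ Q with
  | nil => exact ⟨_, _, .instr i σ, h⟩
  | cons d l ih =>
    refine Wp.seq ⟨_, _, .instr i σ, ih ?_⟩
    rw [List.length_cons] at h
    rwa [add_comm 1]

/-- The rule for loops; `I n σ` is an invariant that allows for `n` further steps. -/
theorem Wp.while (I : ℕ → Store → Prop) {n₀ : ℕ} (h₀ : I n₀ σ)
    (hstep : ∀ n τ, I n τ → τ.nat a < τ.nat b →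
      Wp T c τ fun υ k => ∃ n', n' + k + 1 ≤ n ∧ I n' υ)
    (hQ : ∀ n τ k, I n τ → ¬ τ.nat a < τ.nat b → k ≤ n₀ + 1 → Q τ k) :
    Wp T (.whileNat a b c) σ Q := by
  suffices H : ∀ n σ, I n σ → ∃ n' τ k, Exec T (.whileNat a b c) σ τ k ∧ I n' τ ∧
      ¬ τ.nat a < τ.nat b ∧ k ≤ n + 1 by
    obtain ⟨n', τ, k, h1, h2, h3, h4⟩ := H n₀ σ h₀
    exact ⟨τ, k, h1, hQ _ _ _ h2 h3 h4⟩
  intro n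
  induction n using Nat.strong_induction_on with
  | _ n ih =>
    intro σ hI
    by_cases h : σ.nat a < σ.nat b
    · obtain ⟨τ, k, h1, n', h2, h3⟩ := hstep n σ hI h
      obtain ⟨n'', υ, l, h4, h5, h6, h7⟩ := ih n' (by omega) τ h3
      exact ⟨n'', υ, k + l + 1, .while_step h h1 h4, h5, h6, by omega⟩
    · exact ⟨n, σ, 1, .while_done h, hI, h, by omega⟩

end Wp

theorem setEntry_self {α : Type*} (f : ℕ → ℕ → α) (a i : ℕ) (v : α) :
    setEntry f a i v a = Function.update (f a) i v := by
  simp [setEntry]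

theorem setEntry_of_ne {α : Type*} (f : ℕ → ℕ → α) {a a' : ℕ} (h : a' ≠ a) (i : ℕ) (v : α) :
    setEntry f a i v a' = f a' := by
  simp [setEntry, h]

theorem setEntry_apply {α : Type*} (f : ℕ → ℕ → α) (a a' i : ℕ) (v : α) :
    setEntry f a i v a' = if a' = a then Function.update (f a) i v else f a' := by
  split_ifs with h
  · rw [h, setEntry_self]
  · exact setEntry_of_ne f h i v

/-! ### Merging sorted blocks -/

/-- The state of a merge of the sorted ranges `[lo, mid)` and `[mid, hi)` of `A`: the first entries,
up to `i` and `j`, have been merged into `B`, up to `p`. -/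
structure MergeInv (A B B₀ : ℕ → ℝ) (lo mid hi i j p : ℕ) : Prop where
  lo_le : lo ≤ i
  le_mid : i ≤ mid
  mid_le : mid ≤ j
  le_hi : j ≤ hi
  add_eq : i + j = p + mid
  sorted : ∀ x y, lo ≤ x → x ≤ y → y < p → B x ≤ B y
  le_left : ∀ x y, lo ≤ x → x < p → i ≤ y → y < mid → B x ≤ A y
  le_right : ∀ x y, lo ≤ x → x < p → j ≤ y → y < hi → B x ≤ A y
  sum_eq : ∀ F : ℝ → ℕ, ∑ x ∈ Finset.Ico lo p, F (B x) =
    ∑ x ∈ Finset.Ico lo i, F (A x) + ∑ x ∈ Finset.Ico mid j, F (A x)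
  below : ∀ x < lo, B x = B₀ x

theorem MergeInv.init (A B : ℕ → ℝ) {lo mid hi : ℕ} (h₁ : lo ≤ mid) (h₂ : mid ≤ hi) :
    MergeInv A B B lo mid hi lo mid lo where
  lo_le := le_rfl
  le_mid := h₁
  mid_le := le_rfl
  le_hi := h₂
  add_eq := rfl
  sorted x y := by omega
  le_left x y := by omega
  le_right x y := by omega
  sum_eq F := by simp
  below _ _ := rfl

theorem MergeInv.lo_le_p {A B B₀ : ℕ → ℝ} {lo mid hi i j p : ℕ}
    (h : MergeInv A B B₀ lo mid hi i j p) : lo ≤ p := by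
  have := h.lo_le; have := h.mid_le; have := h.add_eq; omega

theorem sum_Ico_update (B : ℕ → ℝ) (F : ℝ → ℕ) {lo p : ℕ} (h : lo ≤ p) (v : ℝ) :
    ∑ x ∈ Finset.Ico lo (p + 1), F (Function.update B p v x) =
      ∑ x ∈ Finset.Ico lo p, F (B x) + F v := by
  rw [Finset.sum_Ico_succ_top h, Function.update_self]
  congr 1
  refine Finset.sum_congr rfl fun x hx => ?_
  rw [Function.update_of_ne (Finset.mem_Ico.1 hx).2.ne]

/-- Everything merged so far lies below everything that remains, by `le_left` and `le_right`. So any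
remaining entry may be appended without breaking the order, and the smaller of the two heads keeps
this separation. -/
theorem MergeInv.take_left {A B B₀ : ℕ → ℝ} {lo mid hi i j p : ℕ}
    (h : MergeInv A B B₀ lo mid hi i j p) (hA : ∀ x y, lo ≤ x → x ≤ y → y < mid → A x ≤ A y)
    (hA' : ∀ x y, mid ≤ x → x ≤ y → y < hi → A x ≤ A y)
    (hi' : i < mid) (hij : j < hi → A i ≤ A j) :
    MergeInv A (Function.update B p (A i)) B₀ lo mid hi (i + 1) j (p + 1) := by
  obtain ⟨h1, h2, h3, h4, h5, h6, h7, h8, h9, h10⟩ := h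
  have hp : lo ≤ p := by omega
  refine ⟨by omega, by omega, h3, h4, by omega, ?_, ?_, ?_, ?_, ?_⟩
  · intro x y hx hxy hy
    by_cases hyp : y = p
    · subst hyp
      by_cases hxp : x = y
      · subst hxp; exact le_rfl
      · rw [Function.update_of_ne hxp, Function.update_self]
        exact h7 x i hx (by omega) le_rfl hi'
    · rw [Function.update_of_ne hyp, Function.update_of_ne (by omega)]
      exact h6 x y hx hxy (by omega)
  · intro x y hx hxp hy hy'
    by_cases hxp' : x = p
    · subst hxp'; rw [Function.update_self]; exact hA i y h1 (by omega) hy'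
    · rw [Function.update_of_ne hxp']; exact h7 x y hx (by omega) (by omega) hy'
  · intro x y hx hxp hy hy'
    by_cases hxp' : x = p
    · subst hxp'; rw [Function.update_self]
      exact (hij (by omega)).trans (hA' j y h3 hy hy')
    · rw [Function.update_of_ne hxp']; exact h8 x y hx (by omega) hy hy'
  · intro F
    rw [sum_Ico_update B F hp, h9, Finset.sum_Ico_succ_top h1]; ring
  · intro x hx
    rw [Function.update_of_ne (by omega)]; exact h10 x hx

theorem MergeInv.take_right {A B B₀ : ℕ → ℝ} {lo mid hi i j p : ℕ}
    (h : MergeInv A B B₀ lo mid hi i j p) (hA : ∀ x y, lo ≤ x → x ≤ y → y < mid → A x ≤ A y)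
    (hA' : ∀ x y, mid ≤ x → x ≤ y → y < hi → A x ≤ A y)
    (hj' : j < hi) (hij : i < mid → A j ≤ A i) :
    MergeInv A (Function.update B p (A j)) B₀ lo mid hi i (j + 1) (p + 1) := by
  obtain ⟨h1, h2, h3, h4, h5, h6, h7, h8, h9, h10⟩ := h
  have hp : lo ≤ p := by omega
  refine ⟨h1, h2, by omega, by omega, by omega, ?_, ?_, ?_, ?_, ?_⟩
  · intro x y hx hxy hy
    by_cases hyp : y = p
    · subst hyp
      by_cases hxp : x = y
      · subst hxp; exact le_rfl
      · rw [Function.update_of_ne hxp, Function.update_self]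
        exact h8 x j hx (by omega) le_rfl hj'
    · rw [Function.update_of_ne hyp, Function.update_of_ne (by omega)]
      exact h6 x y hx hxy (by omega)
  · intro x y hx hxp hy hy'
    by_cases hxp' : x = p
    · subst hxp'; rw [Function.update_self]
      exact (hij (by omega)).trans (hA i y h1 hy hy')
    · rw [Function.update_of_ne hxp']; exact h7 x y hx (by omega) hy hy'
  · intro x y hx hxp hy hy'
    by_cases hxp' : x = p
    · subst hxp'; rw [Function.update_self]; exact hA' j y h3 (by omega) hy'
    · rw [Function.update_of_ne hxp']; exact h8 x y hx (by omega) (by omega) hy'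
  · intro F
    rw [sum_Ico_update B F hp, h9, Finset.sum_Ico_succ_top h3]; ring
  · intro x hx
    rw [Function.update_of_ne (by omega)]; exact h10 x hx

/-- The first `n` entries of `A` are sorted within each block of length `w`. -/
def SortedBlocks (A : ℕ → ℝ) (w n : ℕ) : Prop :=
  ∀ q x y, q * w ≤ x → x ≤ y → y < (q + 1) * w → y < n → A x ≤ A y

/-- The first `n` entries of `A` and of `B` agree up to the order. -/
def SameEntries (A B : ℕ → ℝ) (n : ℕ) : Prop :=
  ∀ F : ℝ → ℕ, ∑ x ∈ Finset.range n, F (A x) = ∑ x ∈ Finset.range n, F (B x)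

theorem sortedBlocks_one (A : ℕ → ℝ) (n : ℕ) : SortedBlocks A 1 n := by
  intro q x y h1 h2 h3 _
  have : x = y := by omega
  rw [this]

/-- The effect of a complete merge of one pair of blocks. -/
theorem MergeInv.finish {A B B₀ : ℕ → ℝ} {w n q lo mid hi i j : ℕ}
    (h : MergeInv A B B₀ lo mid hi i j hi) (hlo : lo = q * (2 * w))
    (hmid : mid = min (lo + w) n) (hhi : hi = min (lo + 2 * w) n)
    (hB : SortedBlocks B₀ (2 * w) lo) (hs : SameEntries B₀ A lo) :
    SortedBlocks B (2 * w) hi ∧ SameEntries B A hi := by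
  have hp := h.lo_le_p
  obtain ⟨h1, h2, h3, h4, h5, h6, h7, h8, h9, h10⟩ := h
  constructor
  · intro q' x y hx hxy hy hyh
    by_cases hylo : y < lo
    · rw [h10 x (by omega), h10 y hylo]
      exact hB q' x y hx hxy hy hylo
    · refine h6 x y ?_ hxy hyh
      -- A block that contains some `y ≥ lo` starts at or after `lo`, since `lo` is a block
      -- boundary. So no block mixes old and newly merged entries.
      have h11 : q * (2 * w) < (q' + 1) * (2 * w) := by omega
      have h12 : q ≤ q' := by
        have := Nat.lt_of_mul_lt_mul_right h11
        omega
      calc lo = q * (2 * w) := hlo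
        _ ≤ q' * (2 * w) := Nat.mul_le_mul_right _ h12
        _ ≤ x := hx
  · intro F
    have hi1 : i = mid := by omega
    have hj1 : j = hi := by omega
    subst hi1 hj1
    rw [Finset.range_eq_Ico, ← Finset.sum_Ico_consecutive _ (Nat.zero_le lo) hp, h9,
      ← Finset.sum_Ico_consecutive (fun x => F (A x)) (Nat.zero_le lo) hp,
      Finset.sum_Ico_consecutive _ h1 h3]
    congr 1
    rw [← Finset.range_eq_Ico, ← hs F]
    exact Finset.sum_congr rfl fun x hx => by rw [h10 x (Finset.mem_range.1 hx)]

/-! ### Merge sort on the machine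

The routine sorts the first `K` entries of the real array `8`, where `K` is the content of
register `2`. The registers `5` and `6` have to hold the constants `1` and `0`. -/

/-- `τ` agrees with `σ` in everything that the sorting routine does not use. -/
def SortFrame (σ τ : Store) : Prop :=
  (∀ r < 40, τ.nat r = σ.nat r) ∧ τ.natArr = σ.natArr ∧ ∀ a < 8, τ.realArr a = σ.realArr a

/-- Move the next entry of the left block. -/
def takeLeftCmd : Cmd :=
  block (.realGet 10 8 44) [.realSet 9 46 10, .natAdd 44 44 5, .natAdd 46 46 5]

/-- Move the next entry of the right block. -/
def takeRightCmd : Cmd :=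
  block (.realGet 10 8 45) [.realSet 9 46 10, .natAdd 45 45 5, .natAdd 46 46 5]

/-- One step of a merge. -/
def mergeStepCmd : Cmd :=
  .ifNat 44 42
    (.ifNat 45 43
      (.seq (block (.realGet 10 8 44) [.realGet 11 8 45]) (.ifReal 11 10 takeRightCmd takeLeftCmd))
      takeLeftCmd)
    takeRightCmd

/-- Merge the pair of blocks that starts at the position in register `41`. -/
def mergeCmd : Cmd :=
  .seq (block (.natAdd 42 41 40) []) <|
  .seq (.ifNat 2 42 (block (.natAdd 42 2 6) []) (block (.natAdd 42 42 6) [])) <|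
  .seq (block (.natAdd 43 42 40) []) <|
  .seq (.ifNat 2 43 (block (.natAdd 43 2 6) []) (block (.natAdd 43 43 6) [])) <|
  .seq (block (.natAdd 44 41 6) [.natAdd 45 42 6, .natAdd 46 41 6]) <|
  .seq (.whileNat 46 43 mergeStepCmd) (block (.natAdd 41 43 6) [])

/-- Copy the merged blocks back. -/
def copyBackCmd : Cmd :=
  .seq (block (.natConst 41 0) [])
    (.whileNat 41 2 (block (.realGet 10 9 41) [.realSet 8 41 10, .natAdd 41 41 5]))

/-- Sort the first entries of the real array `8`. -/
def sortCmd : Cmd :=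
  .seq (block (.natConst 40 1) [])
    (.whileNat 40 2
      (.seq (block (.natConst 41 0) [])
      (.seq (.whileNat 41 2 mergeCmd)
      (.seq copyBackCmd (block (.natAdd 40 40 40) [])))))

theorem wp_takeLeftCmd {T : ℕ → ℕ → ℕ} {σ : Store} {Q : Store → ℕ → Prop}
    (h : ∀ τ, SortFrame σ τ → (∀ r, r ≠ 44 → r ≠ 46 → τ.nat r = σ.nat r) →
      τ.nat 44 = σ.nat 44 + σ.nat 5 → τ.nat 46 = σ.nat 46 + σ.nat 5 →
      τ.realArr 8 = σ.realArr 8 →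
      τ.realArr 9 = Function.update (σ.realArr 9) (σ.nat 46) (σ.realArr 8 (σ.nat 44)) → Q τ 4) :
    Wp T takeLeftCmd σ Q := by
  refine Wp.block (h _ ⟨?_, ?_, ?_⟩ ?_ ?_ ?_ ?_ ?_)
  · intro r hr
    simp only [evalList, Instr.eval, Function.update_apply]
    rw [if_neg (by omega), if_neg (by omega)]
  · rfl
  · intro a ha
    simp only [evalList, Instr.eval, setEntry_apply]
    rw [if_neg (by omega)]
  · intro r h1 h2
    simp only [evalList, Instr.eval, Function.update_apply]
    rw [if_neg h2, if_neg h1]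
  all_goals simp [evalList, Instr.eval, setEntry_apply]

theorem wp_takeRightCmd {T : ℕ → ℕ → ℕ} {σ : Store} {Q : Store → ℕ → Prop}
    (h : ∀ τ, SortFrame σ τ → (∀ r, r ≠ 45 → r ≠ 46 → τ.nat r = σ.nat r) →
      τ.nat 45 = σ.nat 45 + σ.nat 5 → τ.nat 46 = σ.nat 46 + σ.nat 5 →
      τ.realArr 8 = σ.realArr 8 →
      τ.realArr 9 = Function.update (σ.realArr 9) (σ.nat 46) (σ.realArr 8 (σ.nat 45)) → Q τ 4) :
    Wp T takeRightCmd σ Q := by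
  refine Wp.block (h _ ⟨?_, ?_, ?_⟩ ?_ ?_ ?_ ?_ ?_)
  · intro r hr
    simp only [evalList, Instr.eval, Function.update_apply]
    rw [if_neg (by omega), if_neg (by omega)]
  · rfl
  · intro a ha
    simp only [evalList, Instr.eval, setEntry_apply]
    rw [if_neg (by omega)]
  · intro r h1 h2
    simp only [evalList, Instr.eval, Function.update_apply]
    rw [if_neg h2, if_neg h1]
  all_goals simp [evalList, Instr.eval, setEntry_apply]

theorem SortFrame.refl (σ : Store) : SortFrame σ σ := ⟨fun _ _ => rfl, rfl, fun _ _ => rfl⟩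

theorem SortFrame.trans {σ τ υ : Store} (h : SortFrame σ τ) (h' : SortFrame τ υ) :
    SortFrame σ υ :=
  ⟨fun r hr => (h'.1 r hr).trans (h.1 r hr), h'.2.1.trans h.2.1,
    fun a ha => (h'.2.2 a ha).trans (h.2.2 a ha)⟩

theorem SortFrame.set {σ τ : Store} (h : SortFrame σ τ) {r : ℕ} (hr : 40 ≤ r) (v : ℕ) :
    SortFrame σ { τ with nat := Function.update τ.nat r v } :=
  ⟨fun a ha => by simp only; rw [Function.update_of_ne (by omega), h.1 a ha], h.2.1, h.2.2⟩

section

variable {T : ℕ → ℕ → ℕ} {σ : Store}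

theorem wp_mergeStepCmd {B₀ : ℕ → ℝ} {lo mid hi : ℕ} (h5 : σ.nat 5 = 1) (h42 : σ.nat 42 = mid)
    (h43 : σ.nat 43 = hi)
    (hinv : MergeInv (σ.realArr 8) (σ.realArr 9) B₀ lo mid hi (σ.nat 44) (σ.nat 45) (σ.nat 46))
    (hp : σ.nat 46 < hi)
    (hA : ∀ x y, lo ≤ x → x ≤ y → y < mid → σ.realArr 8 x ≤ σ.realArr 8 y)
    (hA' : ∀ x y, mid ≤ x → x ≤ y → y < hi → σ.realArr 8 x ≤ σ.realArr 8 y) :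
    Wp T mergeStepCmd σ fun τ k => k ≤ 9 ∧ SortFrame σ τ ∧ (∀ r < 44, τ.nat r = σ.nat r) ∧
      τ.realArr 8 = σ.realArr 8 ∧ τ.nat 46 = σ.nat 46 + 1 ∧
      MergeInv (τ.realArr 8) (τ.realArr 9) B₀ lo mid hi (τ.nat 44) (τ.nat 45) (τ.nat 46) := by
  have hle := hinv.add_eq
  have hmid := hinv.le_mid
  have hhi := hinv.le_hi
  refine Wp.ifNat (fun h1 => ?_) fun h1 => ?_
  · rw [h42] at h1
    refine Wp.ifNat (fun h2 => ?_) fun h2 => ?_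
    · rw [h43] at h2
      refine Wp.seq (Wp.block (Wp.ifReal (fun h3 => ?_) fun h3 => ?_))
      · refine wp_takeRightCmd fun τ f1 f2 f3 f4 f5 f6 => ⟨by simp, ⟨f1.1, f1.2.1, f1.2.2⟩,
          fun r hr => f2 r (by omega) (by omega), f5, ?_, ?_⟩
        · rw [f4, ← h5]; rfl
        · simp only [evalList, Instr.eval] at f2 f3 f4 f5 f6 h3
          rw [f5, f6, f2 44 (by omega) (by omega), f3, f4, h5]
          refine hinv.take_right hA hA' h2 fun _ => ?_
          simpa using h3.le
      · refine wp_takeLeftCmd fun τ f1 f2 f3 f4 f5 f6 => ⟨by simp, ⟨f1.1, f1.2.1, f1.2.2⟩,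
          fun r hr => f2 r (by omega) (by omega), f5, ?_, ?_⟩
        · rw [f4, ← h5]; rfl
        · simp only [evalList, Instr.eval] at f2 f3 f4 f5 f6 h3
          rw [f5, f6, f2 45 (by omega) (by omega), f3, f4, h5]
          refine hinv.take_left hA hA' h1 fun _ => ?_
          simpa using h3
    · rw [h43] at h2
      refine wp_takeLeftCmd fun τ f1 f2 f3 f4 f5 f6 => ⟨by simp, f1,
          fun r hr => f2 r (by omega) (by omega), f5, by rw [f4, h5], ?_⟩
      rw [f5, f6, f2 45 (by omega) (by omega), f3, f4, h5]
      exact hinv.take_left hA hA' h1 fun h => absurd h h2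
  · rw [h42] at h1
    refine wp_takeRightCmd fun τ f1 f2 f3 f4 f5 f6 => ⟨by simp, f1,
        fun r hr => f2 r (by omega) (by omega), f5, by rw [f4, h5], ?_⟩
    rw [f5, f6, f2 44 (by omega) (by omega), f3, f4, h5]
    exact hinv.take_right hA hA' (by omega) fun h => absurd h h1

theorem wp_mergeLoop {B₀ : ℕ → ℝ} {lo mid hi : ℕ} (h5 : σ.nat 5 = 1) (h42 : σ.nat 42 = mid)
    (h43 : σ.nat 43 = hi)
    (hinv : MergeInv (σ.realArr 8) (σ.realArr 9) B₀ lo mid hi (σ.nat 44) (σ.nat 45) (σ.nat 46))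
    (hA : ∀ x y, lo ≤ x → x ≤ y → y < mid → σ.realArr 8 x ≤ σ.realArr 8 y)
    (hA' : ∀ x y, mid ≤ x → x ≤ y → y < hi → σ.realArr 8 x ≤ σ.realArr 8 y) :
    Wp T (.whileNat 46 43 mergeStepCmd) σ fun τ k => k ≤ 10 * (hi - σ.nat 46) + 1 ∧
      SortFrame σ τ ∧ (∀ r < 44, τ.nat r = σ.nat r) ∧ τ.realArr 8 = σ.realArr 8 ∧
      ∃ i j, MergeInv (τ.realArr 8) (τ.realArr 9) B₀ lo mid hi i j hi := by
  refine Wp.while (n₀ := 10 * (hi - σ.nat 46)) (fun n τ => n = 10 * (hi - τ.nat 46) ∧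
    SortFrame σ τ ∧ (∀ r < 44, τ.nat r = σ.nat r) ∧ τ.realArr 8 = σ.realArr 8 ∧
    MergeInv (τ.realArr 8) (τ.realArr 9) B₀ lo mid hi (τ.nat 44) (τ.nat 45) (τ.nat 46))
    ⟨rfl, SortFrame.refl σ, fun _ _ => rfl, rfl, hinv⟩ ?_ ?_
  · rintro n τ ⟨rfl, g1, g2, g3, g4⟩ hlt
    rw [g2 43 (by omega), h43] at hlt
    refine (wp_mergeStepCmd (by rw [g2 5 (by omega), h5]) (by rw [g2 42 (by omega), h42])
      (by rw [g2 43 (by omega), h43]) g4 hlt (by rwa [g3]) (by rwa [g3])).mono ?_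
    rintro υ k ⟨e1, e2, e3, e4, e5, e6⟩
    exact ⟨10 * (hi - υ.nat 46), by omega, rfl, g1.trans e2,
      fun r hr => (e3 r hr).trans (g2 r hr), e4.trans g3, e6⟩
  · rintro n τ k ⟨rfl, g1, g2, g3, g4⟩ hlt hk
    rw [g2 43 (by omega), h43] at hlt
    have h1 := g4.add_eq
    have h2 := g4.le_mid
    have h3 := g4.le_hi
    refine ⟨hk, g1, g2, g3, τ.nat 44, τ.nat 45, ?_⟩
    have : τ.nat 46 = hi := by omega
    rwa [this] at g4

/-- Clipping at the length of the array allows the last pair of blocks to be short, or its right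
half to be empty. -/
theorem wp_clip {r : ℕ} {Q : Store → ℕ → Prop} (hr : 40 ≤ r) (h6 : σ.nat 6 = 0)
    (h : ∀ τ, SortFrame σ τ → (∀ a, a ≠ r → τ.nat a = σ.nat a) → τ.realArr = σ.realArr →
      τ.nat r = min (σ.nat r) (σ.nat 2) → Q τ 2) :
    Wp T (.ifNat 2 r (block (.natAdd r 2 6) []) (block (.natAdd r r 6) [])) σ Q := by
  refine Wp.ifNat (fun hlt => Wp.block (h _ ⟨?_, rfl, fun _ _ => rfl⟩ ?_ rfl ?_))
    fun hlt => Wp.block (h _ ⟨?_, rfl, fun _ _ => rfl⟩ ?_ rfl ?_)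
  · intro a ha; simp [evalList, Instr.eval, Function.update_apply]; omega
  · intro a ha; simp [evalList, Instr.eval, ha]
  · simp [evalList, Instr.eval, h6]; omega
  · intro a ha; simp [evalList, Instr.eval, Function.update_apply]; omega
  · intro a ha; simp [evalList, Instr.eval, ha]
  · simp [evalList, Instr.eval, h6]; omega

/-- The cost is charged to the progress of register `41`: `10` steps per entry, and a fixed cost of
`12`, loop test included, which is at most `12` per entry because at least one entry is merged. -/
theorem wp_mergeCmd {w q : ℕ} (hw : 0 < w) (h5 : σ.nat 5 = 1) (h6 : σ.nat 6 = 0)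
    (h40 : σ.nat 40 = w) (h41 : σ.nat 41 = q * (2 * w)) (hlt : σ.nat 41 < σ.nat 2)
    (hA : SortedBlocks (σ.realArr 8) w (σ.nat 2))
    (hB : SortedBlocks (σ.realArr 9) (2 * w) (σ.nat 41))
    (hs : SameEntries (σ.realArr 9) (σ.realArr 8) (σ.nat 41)) :
    Wp T mergeCmd σ fun τ k => k + 1 ≤ 22 * (τ.nat 41 - σ.nat 41) ∧
      SortFrame σ τ ∧ τ.nat 40 = w ∧ τ.realArr 8 = σ.realArr 8 ∧ σ.nat 41 < τ.nat 41 ∧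
      τ.nat 41 = min ((q + 1) * (2 * w)) (σ.nat 2) ∧
      SortedBlocks (τ.realArr 9) (2 * w) (τ.nat 41) ∧
      SameEntries (τ.realArr 9) (τ.realArr 8) (τ.nat 41) := by
  set n := σ.nat 2 with hn
  set lo := σ.nat 41 with hlo
  refine Wp.seq (Wp.block ?_)
  simp only [evalList, Instr.eval, List.length_nil]
  refine Wp.seq (wp_clip (by omega) (by simpa using h6) fun τ₁ f1 f2 f3 f4 => ?_)
  have f1' : SortFrame σ τ₁ := ((SortFrame.refl σ).set (by omega) _).trans f1
  have f2' : ∀ a, a ≠ 42 → τ₁.nat a = σ.nat a := fun a ha => by rw [f2 a ha]; simp [ha]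
  have f4' : τ₁.nat 42 = min (lo + w) n := by rw [f4]; simp [h40, ← hlo, ← hn]
  clear f1 f2 f4
  refine Wp.seq (Wp.block ?_)
  simp only [evalList, Instr.eval, List.length_nil]
  refine Wp.seq (wp_clip (by omega) (by simpa [f2'] using h6) fun τ₂ g1 g2 g3 g4 => ?_)
  have g1' : SortFrame σ τ₂ := (f1'.set (by omega) _).trans g1
  have g2' : ∀ a, a ≠ 42 → a ≠ 43 → τ₂.nat a = σ.nat a := fun a h1 h2 => by
    rw [g2 a h2]; simp [h2, f2' a h1]
  have g42 : τ₂.nat 42 = min (lo + w) n := by rw [g2 42 (by omega)]; simpa using f4'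
  have g43 : τ₂.nat 43 = min (lo + 2 * w) n := by
    rw [g4]; simp [f2', f4', h40, ← hn]; omega
  have g8 : τ₂.realArr = σ.realArr := by rw [g3, f3]
  clear g1 g2 g4
  refine Wp.seq (Wp.block ?_)
  simp only [evalList, Instr.eval, List.length_nil, List.length_cons]
  set mid := min (lo + w) n with hmid
  set hi := min (lo + 2 * w) n with hhi
  have b1 : lo ≤ mid := by omega
  have b2 : mid ≤ hi := by omega
  refine Wp.seq ((wp_mergeLoop (B₀ := σ.realArr 9) (lo := lo) (mid := mid) (hi := hi)
    (by simp [g2', h5]) (by simp [g42]) (by simp [g43]) ?_ ?_ ?_).mono ?_)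
  · simp [g2', h6, g42, g8, ← hlo]
    exact MergeInv.init _ _ b1 b2
  · simp only [g8]
    intro x y hx hxy hy
    refine hA (2 * q) x y ?_ hxy ?_ (by omega)
    · rw [show 2 * q * w = q * (2 * w) by ring]; omega
    · rw [show (2 * q + 1) * w = q * (2 * w) + w by ring]; omega
  · simp only [g8]
    intro x y hx hxy hy
    refine hA (2 * q + 1) x y ?_ hxy ?_ (by omega)
    · rw [show (2 * q + 1) * w = q * (2 * w) + w by ring]; omega
    · rw [show (2 * q + 1 + 1) * w = q * (2 * w) + 2 * w by ring]; omega
  · rintro τ k ⟨e1, e2, e3, e4, i, j, e5⟩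
    refine Wp.block ?_
    simp only [evalList, Instr.eval, List.length_nil]
    have e43 : τ.nat 43 = hi := by rw [e3 43 (by omega)]; simp [g43]
    have e6 : τ.nat 6 = 0 := by rw [e3 6 (by omega)]; simp [g2', h6]
    have e40 : τ.nat 40 = w := by rw [e3 40 (by omega)]; simp [g2', h40]
    have e2' : SortFrame σ τ :=
      (((g1'.set (by omega) _).set (by omega) _).set (by omega) _).trans e2
    have e4' : τ.realArr 8 = σ.realArr 8 := by rw [e4, g8]
    rw [e4'] at e5
    simp only [Function.update_self, e43, e6, e4', add_zero]
    have hq : (q + 1) * (2 * w) = lo + 2 * w := by rw [h41]; ring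
    obtain ⟨d1, d2⟩ := e5.finish h41 hmid hhi hB hs
    refine ⟨?_, e2'.set (by omega) _, by simpa using e40, ?_, by omega, by rw [hq],
      d1, d2⟩
    · simp [g2', h6, ← hlo] at e1
      omega
    · trivial

theorem wp_copyBackCmd (h5 : σ.nat 5 = 1) :
    Wp T copyBackCmd σ fun τ k => k ≤ 4 * σ.nat 2 + 2 ∧
      SortFrame σ τ ∧ τ.nat 40 = σ.nat 40 ∧ ∀ x < σ.nat 2, τ.realArr 8 x = σ.realArr 9 x := by
  set n := σ.nat 2 with hn
  refine Wp.seq (Wp.block ?_)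
  simp only [evalList, Instr.eval, List.length_nil]
  refine Wp.while (n₀ := 4 * n) (fun m τ => m = 4 * (n - τ.nat 41) ∧ SortFrame σ τ ∧
    τ.nat 40 = σ.nat 40 ∧ τ.realArr 9 = σ.realArr 9 ∧
    ∀ x < τ.nat 41, τ.realArr 8 x = σ.realArr 9 x) ?_ ?_ ?_
  · refine ⟨by simp, (SortFrame.refl σ).set (by omega) _, by simp, rfl, by simp⟩
  · rintro m τ ⟨rfl, f1, f2, f3, f4⟩ hlt
    have e5 : τ.nat 5 = 1 := by rw [f1.1 5 (by omega), h5]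
    rw [f1.1 2 (by omega), ← hn] at hlt
    refine Wp.block ⟨4 * (n - (τ.nat 41 + 1)), by simp; omega, ?_⟩
    simp only [evalList, Instr.eval]
    refine ⟨by simp [e5], f1.trans ⟨fun r hr => ?_, rfl, fun a ha => ?_⟩, by simpa using f2, ?_, ?_⟩
    · simp only [Function.update_apply]; rw [if_neg (by omega)]
    · simp only [setEntry_apply]; rw [if_neg (by omega)]
    · simpa [setEntry_apply] using f3
    · simp only [setEntry_apply, Function.update_self, e5, if_true]
      intro x hx
      by_cases hx' : x = τ.nat 41
      · simp [hx', f3]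
      · rw [Function.update_of_ne hx']; exact f4 x (by omega)
  · rintro m τ k ⟨rfl, f1, f2, f3, f4⟩ hlt hk
    rw [f1.1 2 (by omega), ← hn] at hlt
    exact ⟨by omega, f1, f2, fun x hx => f4 x (by omega)⟩

/-- Bottom-up merge sort: after `e` passes the blocks of length `2 ^ e` are sorted, so `⌈log₂ K⌉`
passes suffice. A pass merges (`22` per entry), copies back (`4` per entry) and has a bounded
overhead, at most `36` per entry in total. -/
theorem wp_sortCmd (h5 : σ.nat 5 = 1) (h6 : σ.nat 6 = 0) :
    Wp T sortCmd σ fun τ k => k ≤ 36 * σ.nat 2 * Nat.clog 2 (σ.nat 2) + 2 ∧ SortFrame σ τ ∧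
      (∀ x y, x ≤ y → y < σ.nat 2 → τ.realArr 8 x ≤ τ.realArr 8 y) ∧
      SameEntries (τ.realArr 8) (σ.realArr 8) (σ.nat 2) := by
  set n := σ.nat 2 with hn
  refine Wp.seq (Wp.block ?_)
  simp only [evalList, Instr.eval, List.length_nil]
  refine Wp.while (n₀ := 36 * n * Nat.clog 2 n) (fun m τ => ∃ e ≤ Nat.clog 2 n,
    m = 36 * n * (Nat.clog 2 n - e) ∧ τ.nat 40 = 2 ^ e ∧ SortFrame σ τ ∧
    SortedBlocks (τ.realArr 8) (2 ^ e) n ∧ SameEntries (τ.realArr 8) (σ.realArr 8) n) ?_ ?_ ?_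
  · exact ⟨0, Nat.zero_le _, by simp, by simp, (SortFrame.refl σ).set (by omega) _,
      sortedBlocks_one _ _, fun F => rfl⟩
  · rintro m τ ⟨e, he, rfl, f1, f2, f3, f4⟩ hlt
    have e2 : τ.nat 2 = n := f2.1 2 (by omega)
    have e5 : τ.nat 5 = 1 := by rw [f2.1 5 (by omega), h5]
    have e6 : τ.nat 6 = 0 := by rw [f2.1 6 (by omega), h6]
    rw [f1, e2] at hlt
    have he' : e < Nat.clog 2 n := (Nat.lt_clog_iff_pow_lt (by omega)).2 hlt
    have hw : 0 < 2 ^ e := by positivity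
    refine Wp.seq (Wp.block ?_)
    simp only [evalList, Instr.eval, List.length_nil]
    refine Wp.seq (Wp.while (n₀ := 22 * n) (fun m υ => m = 22 * (n - υ.nat 41) ∧ SortFrame σ υ ∧
      υ.nat 40 = 2 ^ e ∧ υ.realArr 8 = τ.realArr 8 ∧
      (∃ q, υ.nat 41 = min (q * (2 * 2 ^ e)) n) ∧
      SortedBlocks (υ.realArr 9) (2 * 2 ^ e) (υ.nat 41) ∧
      SameEntries (υ.realArr 9) (υ.realArr 8) (υ.nat 41)) ?_ ?_ ?_)
    · refine ⟨by simp, f2.set (by omega) _, by simpa using f1,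
        rfl, ⟨0, by simp⟩, ?_, ?_⟩
      · simp only [Function.update_self]; intro q x y _ _ _ h; omega
      · simp only [Function.update_self]; intro F; simp
    · rintro m υ ⟨rfl, g1, g2, g3, ⟨q, g4⟩, g5, g6⟩ hlt'
      have hlt'' := hlt'
      rw [g1.1 2 (by omega), ← hn] at hlt''
      refine (wp_mergeCmd (w := 2 ^ e) (q := q) hw (by rw [g1.1 5 (by omega), h5])
        (by rw [g1.1 6 (by omega), h6]) g2 (by omega) hlt' ?_ g5 g6).mono ?_
      · rw [g1.1 2 (by omega), g3]; exact f3
      · rintro κ k ⟨d1, d2, d3, d4, d5, d6, d7, d8⟩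
        rw [g1.1 2 (by omega), ← hn] at d6
        exact ⟨22 * (n - κ.nat 41), by omega, rfl, g1.trans d2, d3, d4.trans g3, ⟨q + 1, d6⟩,
          d7, d8⟩
    · rintro m υ k ⟨rfl, g1, g2, g3, ⟨q, g4⟩, g5, g6⟩ hlt' hk
      rw [g1.1 2 (by omega), ← hn] at hlt'
      have g41 : υ.nat 41 = n := by omega
      rw [g41] at g5 g6
      refine Wp.seq ((wp_copyBackCmd (by rw [g1.1 5 (by omega), h5])).mono ?_)
      rintro κ l ⟨d1, d2, d3, d4⟩
      rw [g1.1 2 (by omega), ← hn] at d1 d4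
      refine Wp.block ?_
      simp only [evalList, Instr.eval, List.length_nil]
      refine ⟨36 * n * (Nat.clog 2 n - (e + 1)), ?_, e + 1, he', rfl, ?_, ?_, ?_, ?_⟩
      · have : Nat.clog 2 n - e = Nat.clog 2 n - (e + 1) + 1 := by omega
        rw [this, mul_add, mul_one]
        omega
      · simp [d3, g2, pow_succ]; ring
      · exact (g1.trans d2).set (by omega) _
      · intro q x y h1 h2 h3 h4
        rw [d4 x (by omega), d4 y h4]
        rw [pow_succ, mul_comm (2 ^ e)] at h1 h3
        exact g5 q x y h1 h2 h3 h4
      · intro F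
        rw [Finset.sum_congr rfl (fun x hx => by rw [d4 x (Finset.mem_range.1 hx)]), g6 F, g3, f4 F]
  · rintro m τ k ⟨e, he, rfl, f1, f2, f3, f4⟩ hlt hk
    rw [f1, f2.1 2 (by omega), ← hn] at hlt
    refine ⟨by omega, f2, fun x y hxy hy => ?_, f4⟩
    exact f3 0 x y (by simp) hxy (by omega) hy

end

/-! ### Collecting the candidates -/

/-- The index that the bit tests of a block point to; `E` lists the squared moduli of the
measurements, and the block starts at `base`. -/
noncomputable def decodeBits (E : ℕ → ℝ) (b base : ℕ) : ℕ :=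
  ∑ a ∈ Finset.range (b - 1), if E (base + b + (a + 1)) < E (base + (a + 1)) then 2 ^ a else 0

/-- The number of the first `i` blocks that point to `j`. -/
def votes (dec : ℕ → ℕ) (i j : ℕ) : ℕ := ((Finset.range i).filter fun x => dec x = j).card

theorem votes_succ (dec : ℕ → ℕ) (i j : ℕ) :
    votes dec (i + 1) j = votes dec i j + if dec i = j then 1 else 0 := by
  rw [votes, Finset.range_add_one, Finset.filter_insert]
  split_ifs with h
  · rw [Finset.card_insert_of_notMem (by simp)]; rfl
  · rfl

/-- After `i` blocks, `cnt` holds the numbers of votes, and the list `cand` of length `n` holds the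
indices below `N` with more than `K / 2` votes. -/
structure CandInv (dec : ℕ → ℕ) (K N i n : ℕ) (cand cnt : ℕ → ℕ) : Prop where
  cnt_eq : ∀ j < N, cnt j = votes dec i j
  mem : ∀ c < n, cand c < N ∧ K < 2 * votes dec i (cand c)
  inj : ∀ c < n, ∀ c' < n, cand c = cand c' → c = c'
  complete : ∀ j < N, K < 2 * votes dec i j → ∃ c < n, cand c = j

section

variable {dec cand cnt : ℕ → ℕ} {K N i n : ℕ}

theorem CandInv.skip (h : CandInv dec K N i n cand cnt) (hN : ¬ dec i < N) :
    CandInv dec K N (i + 1) n cand cnt := by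
  have hv : ∀ j < N, votes dec (i + 1) j = votes dec i j := fun j hj => by
    rw [votes_succ, if_neg (by omega), add_zero]
  obtain ⟨h1, h2, h3, h4⟩ := h
  refine ⟨fun j hj => by rw [hv j hj, h1 j hj], fun c hc => ?_, h3, fun j hj hK => ?_⟩
  · have := h2 c hc
    rwa [hv _ this.1]
  · rw [hv j hj] at hK; exact h4 j hj hK

theorem CandInv.vote (h : CandInv dec K N i n cand cnt)
    (hK : K < 2 * (cnt (dec i) + 1) → K < 2 * cnt (dec i)) :
    CandInv dec K N (i + 1) n cand (Function.update cnt (dec i) (cnt (dec i) + 1)) := by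
  obtain ⟨h1, h2, h3, h4⟩ := h
  refine ⟨fun j hj => ?_, fun c hc => ?_, h3, fun j hj hKj => ?_⟩
  · rw [votes_succ]
    by_cases hj' : dec i = j
    · subst hj'; simp [h1 _ hj]
    · rw [Function.update_of_ne (Ne.symm hj'), if_neg hj', h1 j hj, add_zero]
  · have := h2 c hc
    rw [votes_succ]
    exact ⟨this.1, by omega⟩
  · rw [votes_succ] at hKj
    by_cases hj' : dec i = j
    · subst hj'
      rw [if_pos rfl, ← h1 _ hj] at hKj
      exact h4 _ hj (by rw [← h1 _ hj]; exact hK hKj)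
    · rw [if_neg hj', add_zero] at hKj
      exact h4 j hj hKj

/-- An index is listed at the moment when its count first exceeds `K / 2`. As counts grow by one,
this happens once, so the list has no repetitions and needs no search. -/
theorem CandInv.add (h : CandInv dec K N i n cand cnt) (hN : dec i < N)
    (hK : K < 2 * (cnt (dec i) + 1)) (hK' : ¬ K < 2 * cnt (dec i)) :
    CandInv dec K N (i + 1) (n + 1) (Function.update cand n (dec i))
      (Function.update cnt (dec i) (cnt (dec i) + 1)) := by
  obtain ⟨h1, h2, h3, h4⟩ := h
  have hnew : ∀ c < n, cand c ≠ dec i := by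
    intro c hc hc'
    have := (h2 c hc).2
    rw [hc', ← h1 _ hN] at this
    exact hK' this
  refine ⟨fun j hj => ?_, fun c hc => ?_, fun c hc c' hc' hcc => ?_, fun j hj hKj => ?_⟩
  · rw [votes_succ]
    by_cases hj' : dec i = j
    · subst hj'; simp [h1 _ hj]
    · rw [Function.update_of_ne (Ne.symm hj'), if_neg hj', h1 j hj, add_zero]
  · rw [votes_succ]
    by_cases hcn : c = n
    · subst hcn; simp [← h1 _ hN, hN, hK]
    · rw [Function.update_of_ne hcn]
      have := h2 c (by omega)
      exact ⟨this.1, by omega⟩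
  · by_cases hcn : c = n <;> by_cases hcn' : c' = n
    · omega
    · subst hcn
      rw [Function.update_self, Function.update_of_ne hcn'] at hcc
      exact absurd hcc.symm (hnew c' (by omega))
    · subst hcn'
      rw [Function.update_self, Function.update_of_ne hcn] at hcc
      exact absurd hcc (hnew c (by omega))
    · rw [Function.update_of_ne hcn, Function.update_of_ne hcn'] at hcc
      exact h3 c (by omega) c' (by omega) hcc
  · rw [votes_succ] at hKj
    by_cases hj' : dec i = j
    · exact ⟨n, by omega, by simpa using hj'⟩
    · rw [if_neg hj', add_zero] at hKj
      obtain ⟨c, hc, rfl⟩ := h4 j hj hKj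
      exact ⟨c, by omega, Function.update_of_ne (by omega) _ _⟩

/-- Each block votes once and each listed index has more than `K / 2` votes. This bound keeps the
later phases within the linear budget. -/
theorem CandInv.length_mul_le (h : CandInv dec K N i n cand cnt) : n * K ≤ 2 * i := by
  have h1 : ∑ c ∈ Finset.range n, votes dec i (cand c) ≤ i := by
    simp only [votes]
    rw [← Finset.card_biUnion]
    · refine (Finset.card_le_card (t := Finset.range i) ?_).trans_eq (Finset.card_range i)
      intro x hx
      simp only [Finset.mem_biUnion, Finset.mem_filter] at hx
      obtain ⟨_, _, hx, _⟩ := hx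
      exact hx
    · intro c hc c' hc' hcc
      refine Finset.disjoint_left.2 fun x hx hx' => hcc ?_
      simp only [Finset.mem_filter] at hx hx'
      exact h.inj c (by simpa using hc) c' (by simpa using hc') (hx.2.symm.trans hx'.2)
  have h2 : ∑ c ∈ Finset.range n, K ≤ ∑ c ∈ Finset.range n, 2 * votes dec i (cand c) :=
    Finset.sum_le_sum fun c hc => (h.mem c (Finset.mem_range.1 hc)).2.le
  rw [← Finset.mul_sum] at h2
  simp at h2
  omega

theorem CandInv.length_le (h : CandInv dec K N i n cand cnt) : n ≤ N := by
  have := Finset.card_le_card_of_injOn (s := Finset.range n) (t := Finset.range N) cand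
    (fun c hc => by simpa using (h.mem c (by simpa using hc)).1)
    (fun c hc c' hc' hcc => h.inj c (by simpa using hc) c' (by simpa using hc') hcc)
  simpa using this

end

/-- Compare the two measurements of one bit test. -/
def bitCmd : Cmd :=
  .seq (block (.realGet 0 0 16) [.realGet 1 1 16, .realMul 0 0 0, .realMul 1 1 1, .realAdd 0 0 1,
    .realGet 2 0 17, .realGet 3 1 17, .realMul 2 2 2, .realMul 3 3 3, .realAdd 2 2 3]) <|
  .seq (.ifReal 2 0 (block (.natAdd 15 15 14) []) (block (.natAdd 15 15 6) []))
    (block (.natAdd 14 14 14) [.natAdd 16 16 5, .natAdd 17 17 5, .natAdd 13 13 5])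

/-- Write the index to which the block at the position in register `11` points to register `15`. -/
def decodeCmd : Cmd :=
  .seq (block (.natConst 13 1) [.natConst 14 1, .natConst 15 0, .natAdd 16 11 5, .natAdd 17 16 4])
    (.whileNat 13 4 bitCmd)

/-- Count a vote for the index in register `15`. -/
def voteCmd : Cmd :=
  .ifNat 15 0
    (.seq (block (.natGet 18 1 15) [.natAdd 19 18 18, .natAdd 18 18 5, .natSet 1 15 18,
        .natAdd 20 18 18])
      (.ifNat 2 20
        (.ifNat 2 19 (block (.natAdd 18 18 6) []) (block (.natSet 2 12 15) [.natAdd 12 12 5]))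
        (block (.natAdd 18 18 6) [])))
    (block (.natAdd 18 18 6) [])

/-- Decode all blocks, and list the indices with many votes. -/
def candidatesCmd : Cmd :=
  .seq (block (.natConst 5 1) [.natConst 10 0, .natConst 11 0, .natConst 12 0])
    (.whileNat 10 3 (.seq decodeCmd (.seq voteCmd
      (block (.natSet 3 10 11) [.natAdd 11 11 4, .natAdd 11 11 4, .natAdd 10 10 5]))))

section

variable {T : ℕ → ℕ → ℕ} {σ : Store}

/-- The squared moduli of the complex numbers in the real arrays `0` and `1`. -/
def energy (σ : Store) (k : ℕ) : ℝ := σ.realArr 0 k * σ.realArr 0 k + σ.realArr 1 k * σ.realArr 1 k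

theorem wp_decodeCmd (h5 : σ.nat 5 = 1) (h6 : σ.nat 6 = 0) :
    Wp T decodeCmd σ fun τ k => k ≤ 17 * σ.nat 4 + 6 ∧
      (∀ r, r < 13 ∨ 17 < r → τ.nat r = σ.nat r) ∧ τ.natArr = σ.natArr ∧ τ.realArr = σ.realArr ∧
      τ.nat 15 = decodeBits (energy σ) (σ.nat 4) (σ.nat 11) := by
  set b := σ.nat 4 with hb
  set base := σ.nat 11 with hbase
  refine Wp.seq (Wp.block ?_)
  simp only [evalList, Instr.eval, List.length_nil, List.length_cons]
  -- Register `14` runs through the powers of two by doubling, as there is no multiplication of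
  -- integers. The alternative `e = 0` covers `b = 0`, where the loop is not entered.
  refine Wp.while (n₀ := 17 * (b - 1)) (fun m τ => m = 17 * (b - τ.nat 13) ∧
    (∀ r, r < 13 ∨ 17 < r → τ.nat r = σ.nat r) ∧ τ.natArr = σ.natArr ∧ τ.realArr = σ.realArr ∧
    ∃ e, τ.nat 13 = e + 1 ∧ (e = 0 ∨ e + 1 ≤ b) ∧ τ.nat 14 = 2 ^ e ∧ τ.nat 16 = base + (e + 1) ∧
      τ.nat 17 = base + b + (e + 1) ∧
      τ.nat 15 = ∑ a ∈ Finset.range e, if energy σ (base + b + (a + 1)) < energy σ (base + (a + 1))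
        then 2 ^ a else 0) ?_ ?_ ?_
  · refine ⟨by simp, fun r hr => ?_, rfl, rfl, 0, ?_⟩
    · simp only [Function.update_apply]
      rw [if_neg (by omega), if_neg (by omega), if_neg (by omega), if_neg (by omega),
        if_neg (by omega)]
    · simp [h5, ← hb, ← hbase]; omega
  · rintro m τ ⟨rfl, f1, f2, f3, e, f4, -, f5, f6, f7, f8⟩ hlt
    have e4 : τ.nat 4 = b := f1 4 (by omega)
    have e5 : τ.nat 5 = 1 := by rw [f1 5 (by omega), h5]
    have e6 : τ.nat 6 = 0 := by rw [f1 6 (by omega), h6]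
    rw [e4, f4] at hlt
    refine Wp.seq (Wp.block (Wp.seq (Wp.ifReal (fun h => ?_) fun h => ?_)))
    all_goals
      refine Wp.block (Wp.block ?_)
      simp only [evalList, Instr.eval, List.length_nil, List.length_cons] at h ⊢
      refine ⟨17 * (b - (τ.nat 13 + 1)), by omega, by simp [e5], fun r hr => ?_, f2, f3, e + 1, ?_⟩
      · simp only [Function.update_apply]
        rw [if_neg (by omega), if_neg (by omega), if_neg (by omega), if_neg (by omega),
          if_neg (by omega)]
        exact f1 r hr
      · simp [f6, f7, f3] at h
        simp [e5, f4, f5, f6, f7, f8, e6, Finset.sum_range_succ]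
        refine ⟨by omega, by ring, by ring, by ring, ?_⟩
        simp [energy, h]
  · rintro m τ k ⟨rfl, f1, f2, f3, e, f4, f9, f5, f6, f7, f8⟩ hlt hk
    have e4 : τ.nat 4 = b := f1 4 (by omega)
    rw [e4] at hlt
    refine ⟨by omega, f1, f2, f3, ?_⟩
    have : e = b - 1 := by omega
    rw [f8, this, decodeBits]

theorem wp_voteCmd {dec : ℕ → ℕ} {i : ℕ} (h5 : σ.nat 5 = 1) (h15 : σ.nat 15 = dec i)
    (h : CandInv dec (σ.nat 2) (σ.nat 0) i (σ.nat 12) (σ.natArr 2) (σ.natArr 1)) :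
    Wp T voteCmd σ fun τ k => k ≤ 10 ∧
      (∀ r, r ≠ 12 → r ≠ 18 → r ≠ 19 → r ≠ 20 → τ.nat r = σ.nat r) ∧
      (∀ a, a ≠ 1 → a ≠ 2 → τ.natArr a = σ.natArr a) ∧ τ.realArr = σ.realArr ∧
      CandInv dec (τ.nat 2) (τ.nat 0) (i + 1) (τ.nat 12) (τ.natArr 2) (τ.natArr 1) := by
  refine Wp.ifNat (fun h1 => Wp.seq (Wp.block (Wp.ifNat (fun h2 => Wp.ifNat (fun h3 => Wp.block ?_)
    fun h3 => Wp.block ?_) fun h2 => Wp.block ?_))) fun h1 => Wp.block ?_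
  · simp [evalList, Instr.eval, h15, h5] at h1 h2 h3 ⊢
    refine ⟨fun r a1 a2 a3 a4 => by simp [*],
      fun a b1 b2 => by simp [setEntry_apply, b1], ?_⟩
    simp only [setEntry_self, setEntry_of_ne σ.natArr (show 2 ≠ 1 by decide)]
    exact h.vote fun _ => by omega
  · simp [evalList, Instr.eval, h15, h5] at h1 h2 h3 ⊢
    refine ⟨fun r a1 a2 a3 a4 => by simp [*],
      fun a b1 b2 => by simp [setEntry_apply, b1, b2], ?_⟩
    simp only [setEntry_apply, if_true, show (2 : ℕ) ≠ 1 by decide, show (1 : ℕ) ≠ 2 by decide,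
      if_false]
    exact h.add h1 (by omega) (by omega)
  · simp [evalList, Instr.eval, h15, h5] at h1 h2 ⊢
    refine ⟨fun r a1 a2 a3 a4 => by simp [*],
      fun a b1 b2 => by simp [setEntry_apply, b1], ?_⟩
    simp only [setEntry_self, setEntry_of_ne σ.natArr (show 2 ≠ 1 by decide)]
    exact h.vote fun _ => by omega
  · simp [evalList, Instr.eval, h15] at h1 ⊢
    exact ⟨fun r a1 a2 a3 a4 => by simp [*], h.skip (by omega)⟩

/-- The vote counters occupy `N` places, too many to be initialized in time `O(m)`; the hypothesis
`h1` uses that memory starts at `0`. Array `3` tabulates the starting positions of the blocks, which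
later replaces integer multiplication. -/
theorem wp_candidatesCmd (h1 : σ.natArr 1 = 0) (h6 : σ.nat 6 = 0) :
    Wp T candidatesCmd σ fun τ k => k ≤ σ.nat 3 * (17 * σ.nat 4 + 21) + 5 ∧
      (∀ r < 5, τ.nat r = σ.nat r) ∧ τ.nat 5 = 1 ∧ (∀ r, r = 6 ∨ 20 < r → τ.nat r = σ.nat r) ∧
      (∀ a, a = 0 ∨ 3 < a → τ.natArr a = σ.natArr a) ∧ τ.realArr = σ.realArr ∧
      (∀ x < σ.nat 3, τ.natArr 3 x = x * (2 * σ.nat 4)) ∧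
      ∃ cnt, CandInv (fun x => decodeBits (energy σ) (σ.nat 4) (x * (2 * σ.nat 4)))
        (σ.nat 2) (σ.nat 0) (σ.nat 3) (τ.nat 12) (τ.natArr 2) cnt := by
  set b := σ.nat 4 with hb
  set m' := σ.nat 3 with hm'
  set dec : ℕ → ℕ := fun x => decodeBits (energy σ) b (x * (2 * b)) with hdec
  refine Wp.seq (Wp.block ?_)
  simp only [evalList, Instr.eval, List.length_nil, List.length_cons]
  refine Wp.while (n₀ := m' * (17 * b + 21)) (fun m τ => m = (m' - τ.nat 10) * (17 * b + 21) ∧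
      τ.nat 10 ≤ m' ∧ (∀ r < 5, τ.nat r = σ.nat r) ∧ τ.nat 5 = 1 ∧
      (∀ r, r = 6 ∨ 20 < r → τ.nat r = σ.nat r) ∧
      (∀ a, a = 0 ∨ 3 < a → τ.natArr a = σ.natArr a) ∧ τ.realArr = σ.realArr ∧
      τ.nat 11 = τ.nat 10 * (2 * b) ∧
      (∀ x < τ.nat 10, τ.natArr 3 x = x * (2 * b)) ∧
      CandInv dec (σ.nat 2) (σ.nat 0) (τ.nat 10) (τ.nat 12) (τ.natArr 2) (τ.natArr 1)) ?_ ?_ ?_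
  · refine ⟨by simp, by simp, fun r hr => ?_, by simp, fun r hr => ?_, fun _ _ => rfl, rfl,
      by simp, by simp, ⟨fun j _ => ?_, ?_, ?_, ?_⟩⟩
    · simp only [Function.update_apply]
      rw [if_neg (by omega), if_neg (by omega), if_neg (by omega), if_neg (by omega)]
    · simp only [Function.update_apply]
      rw [if_neg (by omega), if_neg (by omega), if_neg (by omega), if_neg (by omega)]
    · simp [h1, votes]
    all_goals simp [votes]
  · rintro m τ ⟨rfl, f0, f1, f2, f3, f4, f5, f6, f7, f8⟩ hlt
    rw [f1 3 (by omega), ← hm'] at hlt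
    refine Wp.seq ((wp_decodeCmd f2 (by rw [f3 6 (by omega), h6])).mono ?_)
    rintro τ₁ k₁ ⟨g1, g2, g3, g4, g5⟩
    rw [f1 4 (by omega), ← hb] at g1
    have g5' : τ₁.nat 15 = dec (τ.nat 10) := by
      have hE : energy τ = energy σ := by funext k; simp only [energy, f5]
      rw [g5, f1 4 (by omega), f6, hE]
    refine Wp.seq ((wp_voteCmd (dec := dec) (i := τ.nat 10) (by rw [g2 5 (by omega), f2]) g5'
      (by rw [g2 2 (by omega), g2 0 (by omega), g2 12 (by omega), g3, f1 2 (by omega),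
            f1 0 (by omega)]; exact f8)).mono ?_)
    rintro τ₂ k₂ ⟨d1, d2, d3, d4, d5⟩
    have e : ∀ r, r < 12 → τ₂.nat r = τ.nat r := fun r hr => by
      rw [d2 r (by omega) (by omega) (by omega) (by omega), g2 r (by omega)]
    refine Wp.block ?_
    simp only [evalList, Instr.eval, List.length_nil, List.length_cons]
    refine ⟨(m' - (τ.nat 10 + 1)) * (17 * b + 21), ?_, ?_, ?_, fun r hr => ?_, ?_, fun r hr => ?_,
      fun a ha => ?_, ?_, ?_, ?_, ?_⟩
    · have : m' - τ.nat 10 = m' - (τ.nat 10 + 1) + 1 := by omega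
      rw [this, add_mul, one_mul]
      omega
    · simp [e, f2]
    · simp [e, f2]; omega
    · simp only [Function.update_apply]
      rw [if_neg (by omega), if_neg (by omega), if_neg (by omega), e r (by omega), f1 r hr]
    · simp [e, f2]
    · simp only [Function.update_apply]
      rw [if_neg (by omega), if_neg (by omega), if_neg (by omega),
        d2 r (by omega) (by omega) (by omega) (by omega), g2 r (by omega), f3 r hr]
    · simp only [setEntry_apply]
      rw [if_neg (by omega), d3 a (by omega) (by omega), g3, f4 a ha]
    · simp [d4, g4, f5]
    · simp [e, f6, f1, f2, ← hb]; ring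
    · simp only [setEntry_self, Function.update_self]
      simp [e, f2, f6]
      intro x hx
      by_cases hx' : x = τ.nat 10
      · simp [hx']
      · rw [Function.update_of_ne hx', d3 3 (by omega) (by omega), g3, f7 x (by omega)]
    · simp [setEntry_apply, e, f2]
      rw [e 2 (by omega), e 0 (by omega), f1 2 (by omega), f1 0 (by omega)] at d5
      exact d5
  · rintro m τ k ⟨rfl, f0, f1, f2, f3, f4, f5, f6, f7, f8⟩ hlt hk
    rw [f1 3 (by omega), ← hm'] at hlt
    have h10 : τ.nat 10 = m' := by omega
    rw [h10] at f7 f8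
    exact ⟨by omega, f1, f2, f3, f4, f5, f7, _, f8⟩

end

/-! ### Medians -/

/-- At least half of the values `f 0, …, f (K - 1)` are `≤ v`, and at least half are `≥ v`. -/
def IsMedian (K : ℕ) (f : ℕ → ℝ) (v : ℝ) : Prop :=
  K ≤ 2 * ((Finset.range K).filter fun k => f k ≤ v).card ∧
  K ≤ 2 * ((Finset.range K).filter fun k => v ≤ f k).card

theorem isMedian_of_sorted {K : ℕ} (hK : 0 < K) {f A : ℕ → ℝ}
    (hA : ∀ x y, x ≤ y → y < K → A x ≤ A y) (h : SameEntries A f K) : IsMedian K f (A (K / 2)) := by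
  classical
  have hcard : ∀ (P : ℝ → Prop) [DecidablePred P], ((Finset.range K).filter fun k => P (f k)).card =
      ((Finset.range K).filter fun k => P (A k)).card := by
    intro P _
    rw [Finset.card_filter, Finset.card_filter]
    -- Equality of the sums of all functions, applied to indicators, gives equality of counts.
    exact (h fun x => if P x then 1 else 0).symm
  constructor
  · rw [hcard fun x => x ≤ A (K / 2)]
    have : Finset.range (K / 2 + 1) ⊆ (Finset.range K).filter fun k => A k ≤ A (K / 2) := by
      intro k hk
      rw [Finset.mem_range] at hk
      simp only [Finset.mem_filter, Finset.mem_range]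
      exact ⟨by omega, hA k _ (by omega) (by omega)⟩
    have := Finset.card_le_card this
    rw [Finset.card_range] at this
    omega
  · rw [hcard fun x => A (K / 2) ≤ x]
    have : Finset.Ico (K / 2) K ⊆ (Finset.range K).filter fun k => A (K / 2) ≤ A k := by
      intro k hk
      rw [Finset.mem_Ico] at hk
      simp only [Finset.mem_filter, Finset.mem_range]
      exact ⟨by omega, hA _ k (by omega) (by omega)⟩
    have := Finset.card_le_card this
    rw [Nat.card_Ico] at this
    omega

/-- Write half of register `2`, rounded down, to register `26`. -/
def halfCmd : Cmd :=
  .seq (block (.natConst 26 0) [.natConst 28 1])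
    (.whileNat 28 2 (block (.natAdd 26 26 5) [.natAdd 28 28 5, .natAdd 28 28 5]))

/-- Write the median of the values of the array `arr` on the rows of the column in register `22`
to the array `out`, at the position in register `21`. -/
def medianCmd (arr out : ℕ) : Cmd :=
  .seq (block (.natConst 23 0) []) <|
  .seq (.whileNat 23 2 (block (.query 24 22 23) [.natGet 25 3 24, .realGet 4 arr 25,
    .realSet 8 23 4, .natAdd 23 23 5])) <|
  .seq sortCmd (block (.realGet 4 8 26) [.realSet out 21 4])

/-- Estimate the entries at all candidates. -/
def estimatesCmd : Cmd :=
  .seq (block (.natConst 21 0) []) <|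
  .whileNat 21 12 <|
  .seq (block (.natGet 22 2 21) []) <|
  .seq (medianCmd 0 4) <|
  .seq (medianCmd 1 5) <|
  block (.realGet 0 4 21) [.realGet 1 5 21, .realMul 0 0 0, .realMul 1 1 1, .realAdd 0 0 1,
    .realSet 6 21 0, .natAdd 21 21 5]

section

variable {T : ℕ → ℕ → ℕ} {σ : Store}

/-- Division is replaced by counting: register `28` runs through `2i + 1`, and the loop stops at the
first `i` with `2i + 1 ≥ K`, which is `K / 2` rounded down. -/
theorem wp_halfCmd (h5 : σ.nat 5 = 1) :
    Wp T halfCmd σ fun τ k => k ≤ 4 * σ.nat 2 + 3 ∧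
      (∀ r, r ≠ 26 → r ≠ 28 → τ.nat r = σ.nat r) ∧ τ.natArr = σ.natArr ∧ τ.realArr = σ.realArr ∧
      τ.nat 26 = σ.nat 2 / 2 := by
  refine Wp.seq (Wp.block ?_)
  simp only [evalList, Instr.eval, List.length_nil, List.length_cons]
  refine Wp.while (n₀ := 4 * σ.nat 2) (fun m τ => m = 4 * (σ.nat 2 - τ.nat 26) ∧
    (∀ r, r ≠ 26 → r ≠ 28 → τ.nat r = σ.nat r) ∧ τ.natArr = σ.natArr ∧ τ.realArr = σ.realArr ∧
    τ.nat 28 = 2 * τ.nat 26 + 1 ∧ τ.nat 26 ≤ σ.nat 2 / 2) ?_ ?_ ?_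
  · exact ⟨by simp, fun r h1 h2 => by simp [h1, h2], rfl, rfl, by simp, by simp⟩
  · rintro m τ ⟨rfl, f1, f2, f3, f4, f5⟩ hlt
    rw [f1 2 (by omega) (by omega), f4] at hlt
    have e5 : τ.nat 5 = 1 := by rw [f1 5 (by omega) (by omega), h5]
    refine Wp.block ⟨4 * (σ.nat 2 - (τ.nat 26 + 1)), by simp; omega, ?_⟩
    simp only [evalList, Instr.eval]
    refine ⟨by simp [e5], fun r h1 h2 => by simp [h1, h2, f1], f2, f3, by simp [e5]; omega,
      by simp [e5]; omega⟩
  · rintro m τ k ⟨rfl, f1, f2, f3, f4, f5⟩ hlt hk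
    rw [f1 2 (by omega) (by omega), f4] at hlt
    exact ⟨by omega, f1, f2, f3, by omega⟩

theorem wp_medianCmd {arr out : ℕ} (harr : arr < 8) (hout : out < 8) (h5 : σ.nat 5 = 1)
    (h6 : σ.nat 6 = 0) (h26 : σ.nat 26 = σ.nat 2 / 2) (hK : 0 < σ.nat 2) :
    Wp T (medianCmd arr out) σ fun τ k =>
      k ≤ 6 * σ.nat 2 + 36 * σ.nat 2 * Nat.clog 2 (σ.nat 2) + 6 ∧
      (∀ r < 23, τ.nat r = σ.nat r) ∧ τ.nat 26 = σ.nat 26 ∧ τ.natArr = σ.natArr ∧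
      ∃ v, IsMedian (σ.nat 2) (fun x => σ.realArr arr (σ.natArr 3 (T (σ.nat 22) x))) v ∧
        ∀ a < 8, τ.realArr a =
          if a = out then Function.update (σ.realArr out) (σ.nat 21) v else σ.realArr a := by
  set K := σ.nat 2 with hKdef
  refine Wp.seq (Wp.block ?_)
  simp only [evalList, Instr.eval, List.length_nil]
  refine Wp.seq (Wp.while (n₀ := 6 * K) (fun m τ => m = 6 * (K - τ.nat 23) ∧
    (∀ r, r ≠ 23 → r ≠ 24 → r ≠ 25 → τ.nat r = σ.nat r) ∧ τ.natArr = σ.natArr ∧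
    (∀ a < 8, τ.realArr a = σ.realArr a) ∧ τ.nat 23 ≤ K ∧
    ∀ x < τ.nat 23, τ.realArr 8 x = σ.realArr arr (σ.natArr 3 (T (σ.nat 22) x))) ?_ ?_ ?_)
  · exact ⟨by simp, fun r h1 h2 h3 => by simp [h1], rfl, fun _ _ => rfl, by simp, by simp⟩
  · rintro m τ ⟨rfl, f1, f2, f3, f4, f5⟩ hlt
    rw [f1 2 (by omega) (by omega) (by omega), ← hKdef] at hlt
    have e5 : τ.nat 5 = 1 := by rw [f1 5 (by omega) (by omega) (by omega), h5]
    refine Wp.block ⟨6 * (K - (τ.nat 23 + 1)), by simp; omega, ?_⟩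
    simp only [evalList, Instr.eval]
    refine ⟨by simp [e5], fun r h1 h2 h3 => by simp [h1, h2, h3, f1], f2, fun a ha => ?_,
      by simp [e5]; omega, ?_⟩
    · rw [setEntry_of_ne _ (by omega)]; exact f3 a ha
    · simp [setEntry_apply, e5]
      intro x hx
      by_cases hx' : x = τ.nat 23
      · simp [hx', f3 arr harr, f2, f1]
      · rw [Function.update_of_ne hx']; exact f5 x (by omega)
  · rintro m τ k ⟨rfl, f1, f2, f3, f4, f5⟩ hlt hk
    have e2 : τ.nat 2 = K := f1 2 (by omega) (by omega) (by omega)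
    rw [e2] at hlt
    refine Wp.seq ((wp_sortCmd (by rw [f1 5 (by omega) (by omega) (by omega), h5])
      (by rw [f1 6 (by omega) (by omega) (by omega), h6])).mono ?_)
    rintro υ l ⟨g1, g2, g3, g4⟩
    rw [e2] at g1 g3 g4
    refine Wp.block ?_
    simp only [evalList, Instr.eval, List.length_nil, List.length_cons]
    have e26 : υ.nat 26 = K / 2 := by
      rw [g2.1 26 (by omega), f1 26 (by omega) (by omega) (by omega), h26]
    have e21 : υ.nat 21 = σ.nat 21 := by
      rw [g2.1 21 (by omega), f1 21 (by omega) (by omega) (by omega)]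
    refine ⟨by omega, fun r hr => ?_, by rw [e26, h26], g2.2.1.trans f2, υ.realArr 8 (K / 2), ?_,
      fun a ha => ?_⟩
    · rw [g2.1 r (by omega), f1 r (by omega) (by omega) (by omega)]
    · refine isMedian_of_sorted hK g3 fun F => ?_
      rw [g4 F]
      refine Finset.sum_congr rfl fun x hx => ?_
      rw [f5 x (by have := Finset.mem_range.1 hx; omega)]
    · rw [setEntry_apply, e26, e21, Function.update_self]
      split_ifs with h
      · subst h; rw [g2.2.2 a ha, f3 a ha]
      · rw [g2.2.2 a ha, f3 a ha]

/-- The summand `72 K ⌈log₂ K⌉` comes from two sorts per candidate, one for each of the real and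
imaginary parts. Squared moduli are stored, since the machine has no square roots and only
comparisons matter. -/
theorem wp_estimatesCmd (h5 : σ.nat 5 = 1) (h6 : σ.nat 6 = 0) (h26 : σ.nat 26 = σ.nat 2 / 2)
    (hK : 0 < σ.nat 2) :
    Wp T estimatesCmd σ fun τ k =>
      k ≤ σ.nat 12 * (72 * σ.nat 2 * Nat.clog 2 (σ.nat 2) + 12 * σ.nat 2 + 21) + 2 ∧
      (∀ r < 21, τ.nat r = σ.nat r) ∧ τ.natArr = σ.natArr ∧
      (∀ a, a < 4 → τ.realArr a = σ.realArr a) ∧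
      ∀ c < σ.nat 12,
        IsMedian (σ.nat 2) (fun x => σ.realArr 0 (σ.natArr 3 (T (σ.natArr 2 c) x)))
          (τ.realArr 4 c) ∧
        IsMedian (σ.nat 2) (fun x => σ.realArr 1 (σ.natArr 3 (T (σ.natArr 2 c) x)))
          (τ.realArr 5 c) ∧
        τ.realArr 6 c = τ.realArr 4 c * τ.realArr 4 c + τ.realArr 5 c * τ.realArr 5 c := by
  set K := σ.nat 2 with hKdef
  set n := σ.nat 12 with hn
  set D := 72 * K * Nat.clog 2 K + 12 * K + 21 with hD
  refine Wp.seq (Wp.block ?_)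
  simp only [evalList, Instr.eval, List.length_nil]
  refine Wp.while (n₀ := n * D) (fun m τ => m = (n - τ.nat 21) * D ∧
    (∀ r < 21, τ.nat r = σ.nat r) ∧ τ.nat 26 = σ.nat 26 ∧ τ.natArr = σ.natArr ∧
    (∀ a, a < 4 → τ.realArr a = σ.realArr a) ∧ τ.nat 21 ≤ n ∧
    ∀ c < τ.nat 21,
        IsMedian K (fun x => σ.realArr 0 (σ.natArr 3 (T (σ.natArr 2 c) x)))
          (τ.realArr 4 c) ∧
        IsMedian K (fun x => σ.realArr 1 (σ.natArr 3 (T (σ.natArr 2 c) x)))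
          (τ.realArr 5 c) ∧
        τ.realArr 6 c = τ.realArr 4 c * τ.realArr 4 c + τ.realArr 5 c * τ.realArr 5 c) ?_ ?_ ?_
  · refine ⟨by simp, fun r hr => ?_, by simp, rfl, fun _ _ => rfl, by simp, by simp⟩
    simp only; rw [Function.update_of_ne (by omega)]
  · rintro m τ ⟨rfl, f1, f2, f3, f4, f5, f6⟩ hlt
    rw [f1 12 (by omega), ← hn] at hlt
    have e2 : τ.nat 2 = K := f1 2 (by omega)
    refine Wp.seq (Wp.block ?_)
    simp only [evalList, Instr.eval, List.length_nil]
    refine Wp.seq ((wp_medianCmd (by omega) (by omega) (by simp [f1, h5]) (by simp [f1, h6])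
      (by simp [f1, f2, h26, ← hKdef]) (by simp [e2, hK])).mono ?_)
    rintro τ₁ k₁ ⟨g1, g2, g3, g4, v, g5, g6⟩
    simp [e2, f3, f4] at g1 g3 g4 g5 g6
    have g2' : ∀ r < 22, τ₁.nat r = τ.nat r := fun r hr => by
      rw [g2 r (by omega)]; simp only; rw [Function.update_of_ne (by omega)]
    have g22 : τ₁.nat 22 = σ.natArr 2 (τ.nat 21) := by rw [g2 22 (by omega)]; simp [f3]
    refine Wp.seq ((wp_medianCmd (by omega) (by omega) (by simp [g2', f1, h5])
      (by simp [g2', f1, h6])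
      (by simp [g2', f1, g3, f2, h26, ← hKdef]) (by simp [g2', e2, hK])).mono ?_)
    rintro τ₂ k₂ ⟨d1, d2, d3, d4, w, d5, d6⟩
    rw [g2' 2 (by omega), e2] at d1 d5
    rw [g22, g4, g6 1 (by omega), if_neg (by omega), f4 1 (by omega)] at d5
    rw [g2' 21 (by omega)] at d6
    have d2' : ∀ r < 22, τ₂.nat r = τ.nat r := fun r hr => by rw [d2 r (by omega), g2' r hr]
    have d3' : τ₂.nat 26 = σ.nat 26 := by rw [d3, g3, f2]
    have d4' : τ₂.natArr = σ.natArr := by rw [d4, g4]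
    have r4 : τ₂.realArr 4 = Function.update (τ.realArr 4) (τ.nat 21) v := by
      rw [d6 4 (by omega), if_neg (by omega), g6 4 (by omega), if_pos rfl]
    have r5 : τ₂.realArr 5 = Function.update (τ.realArr 5) (τ.nat 21) w := by
      rw [d6 5 (by omega), if_pos rfl, g6 5 (by omega), if_neg (by omega)]
    have r6 : τ₂.realArr 6 = τ.realArr 6 := by
      rw [d6 6 (by omega), if_neg (by omega), g6 6 (by omega), if_neg (by omega)]
    have e5 : τ.nat 5 = 1 := by rw [f1 5 (by omega), h5]
    refine Wp.block ?_
    simp only [evalList, Instr.eval, List.length_nil, List.length_cons]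
    refine ⟨(n - (τ.nat 21 + 1)) * D, ?_, ?_, fun r hr => ?_, by simpa using d3', d4',
      fun a ha => ?_, ?_, ?_⟩
    · have : n - τ.nat 21 = n - (τ.nat 21 + 1) + 1 := by omega
      have h2 : 72 * K * Nat.clog 2 K = 36 * K * Nat.clog 2 K + 36 * K * Nat.clog 2 K := by ring
      rw [this, add_mul, one_mul]
      omega
    · simp [d2', e5]
    · rw [Function.update_of_ne (by omega), d2' r (by omega), f1 r hr]
    · rw [setEntry_of_ne _ (by omega), d6 a (by omega), if_neg (by omega), g6 a (by omega),
        if_neg (by omega), f4 a ha]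
    · simp [d2', e5]; omega
    · simp [e5, d2', setEntry_apply, r4, r5, r6]
      intro c hc
      by_cases hc' : c = τ.nat 21
      · subst hc'; simpa using ⟨g5, d5⟩
      · simp only [Function.update_of_ne hc']
        exact f6 c (by omega)
  · rintro m τ k ⟨rfl, f1, f2, f3, f4, f5, f6⟩ hlt hk
    rw [f1 12 (by omega), ← hn] at hlt
    have h21 : τ.nat 21 = n := by omega
    rw [h21] at f6
    exact ⟨by omega, f1, f3, f4, f6⟩

end

/-! ### Selecting the largest estimates -/

/-- `o` of the `n` positions, marked in `used`, have been listed by `pos`, and none of the other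
positions has a larger magnitude. -/
structure SelInv (n o : ℕ) (used : ℕ → ℕ) (mag : ℕ → ℝ) (pos : ℕ → ℕ) : Prop where
  lt : ∀ i < o, pos i < n
  inj : ∀ i < o, ∀ l < o, pos i = pos l → i = l
  used_iff : ∀ c < n, used c = 0 ↔ ∀ i < o, pos i ≠ c
  max : ∀ c < n, used c = 0 → ∀ i < o, mag c ≤ mag (pos i)

theorem SelInv.exists_unused {n o : ℕ} {used pos : ℕ → ℕ} {mag : ℕ → ℝ}
    (h : SelInv n o used mag pos) (ho : o < n) : ∃ c < n, used c = 0 := by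
  -- Pigeonhole: `o < n` listed positions cannot exhaust all `n`.
  obtain ⟨c, hc, hc'⟩ := Finset.exists_mem_notMem_of_card_lt_card
    (s := (Finset.range o).image pos) (t := Finset.range n)
    (Finset.card_image_le.trans_lt (by simpa using ho))
  rw [Finset.mem_range] at hc
  refine ⟨c, hc, (h.used_iff c hc).2 fun i hi hic => hc' ?_⟩
  exact Finset.mem_image.2 ⟨i, Finset.mem_range.2 hi, hic⟩

theorem SelInv.pick {n o b : ℕ} {used pos : ℕ → ℕ} {mag : ℕ → ℝ} (h : SelInv n o used mag pos)
    (hb : b < n) (hub : used b = 0) (hmax : ∀ c < n, used c = 0 → mag c ≤ mag b) :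
    SelInv n (o + 1) (Function.update used b 1) mag (Function.update pos o b) := by
  obtain ⟨h1, h2, h3, h4⟩ := h
  have hnew : ∀ i < o, pos i ≠ b := (h3 b hb).1 hub
  have hpos : ∀ i < o, Function.update pos o b i = pos i := fun i hi =>
    Function.update_of_ne (by omega) _ _
  refine ⟨fun i hi => ?_, fun i hi l hl hil => ?_, fun c hc => ?_, fun c hc hcu i hi => ?_⟩
  · rcases Nat.lt_succ_iff_lt_or_eq.1 hi with hi | rfl
    · rw [hpos i hi]; exact h1 i hi
    · simpa using hb
  · rcases Nat.lt_succ_iff_lt_or_eq.1 hi with hi | rfl <;>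
      rcases Nat.lt_succ_iff_lt_or_eq.1 hl with hl | rfl
    · rw [hpos i hi, hpos l hl] at hil; exact h2 i hi l hl hil
    · rw [hpos i hi, Function.update_self] at hil; exact absurd hil (hnew i hi)
    · rw [hpos l hl, Function.update_self] at hil; exact absurd hil.symm (hnew l hl)
    · rfl
  · by_cases hcb : c = b
    · subst hcb
      simp only [Function.update_self, one_ne_zero, false_iff, not_forall, not_not]
      exact ⟨o, by omega, by simp⟩
    · rw [Function.update_of_ne hcb, h3 c hc]
      refine ⟨fun h i hi => ?_, fun h i hi => by rw [← hpos i hi]; exact h i (by omega)⟩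
      rcases Nat.lt_succ_iff_lt_or_eq.1 hi with hi | rfl
      · rw [hpos i hi]; exact h i hi
      · simpa using Ne.symm hcb
  · have hcb : c ≠ b := by rintro rfl; simp at hcu
    rw [Function.update_of_ne hcb] at hcu
    rcases Nat.lt_succ_iff_lt_or_eq.1 hi with hi | rfl
    · rw [hpos i hi]; exact h4 c hc hcu i hi
    · simpa using hmax c hc hcu

/-- Compare the position in register `32` with the best one so far. -/
def scanCmd : Cmd :=
  .seq (block (.natGet 35 4 32) [.realGet 5 6 32]) <|
  .seq (.ifNat 35 5
      (.ifNat 33 5 (block (.natAdd 34 32 6) [.natConst 33 1, .realGet 6 6 32])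
        (.ifReal 6 5 (block (.natAdd 34 32 6) [.natConst 33 1, .realGet 6 6 32])
          (block (.natAdd 35 35 6) [])))
      (block (.natAdd 35 35 6) [])) <|
  block (.natAdd 32 32 5) []

/-- Append the largest unused estimate to the output. -/
def pickCmd : Cmd :=
  .seq (block (.natConst 32 0) [.natConst 33 0, .natConst 34 0]) <|
  .seq (.whileNat 32 12 scanCmd) <|
  block (.natSet 4 34 5) [.natGet 36 2 34, .natSet 0 31 36, .realGet 0 4 34, .realSet 2 31 0,
    .realGet 0 5 34, .realSet 3 31 0, .natAdd 31 31 5]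

/-- Output the largest estimates. -/
def selectCmd : Cmd :=
  .seq (block (.natAdd 29 1 1) [.natConst 31 0]) <|
  .seq (.ifNat 12 29 (block (.natAdd 30 12 6) []) (block (.natAdd 30 29 6) [])) <|
  .seq (.whileNat 31 30 pickCmd) (block (.natAdd 0 31 6) [])

section

variable {T : ℕ → ℕ → ℕ} {σ : Store}

/-- The state of the search for the largest unused estimate. -/
def ScanInv (used : ℕ → ℕ) (mag : ℕ → ℝ) (τ : Store) : Prop :=
  (τ.nat 33 = 0 ∧ ∀ c < τ.nat 32, used c ≠ 0) ∨
  (τ.nat 33 = 1 ∧ τ.nat 34 < τ.nat 32 ∧ used (τ.nat 34) = 0 ∧ τ.real 6 = mag (τ.nat 34) ∧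
    ∀ c < τ.nat 32, used c = 0 → mag c ≤ mag (τ.nat 34))

theorem wp_scanCmd (h5 : σ.nat 5 = 1) (h6 : σ.nat 6 = 0)
    (hinv : ScanInv (σ.natArr 4) (σ.realArr 6) σ) :
    Wp T scanCmd σ fun τ k => k ≤ 9 ∧ (∀ r < 32, τ.nat r = σ.nat r) ∧ τ.natArr = σ.natArr ∧
      τ.realArr = σ.realArr ∧ τ.nat 32 = σ.nat 32 + 1 ∧
      ScanInv (σ.natArr 4) (σ.realArr 6) τ := by
  have hframe : ∀ {f : ℕ → ℕ} {a b c d u v w x r : ℕ}, r < 32 → 32 ≤ a → 32 ≤ b → 32 ≤ c → 32 ≤ d →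
      Function.update (Function.update (Function.update (Function.update f a u) b v) c w) d x r =
        f r := by
    intro f a b c d u v w x r hr ha hb hc hd
    rw [Function.update_of_ne (by omega), Function.update_of_ne (by omega),
      Function.update_of_ne (by omega), Function.update_of_ne (by omega)]
  have hframe' : ∀ {f : ℕ → ℕ} {a b c u v w r : ℕ}, r < 32 → 32 ≤ a → 32 ≤ b → 32 ≤ c →
      Function.update (Function.update (Function.update f a u) b v) c w r = f r := by
    intro f a b c u v w r hr ha hb hc
    rw [Function.update_of_ne (by omega), Function.update_of_ne (by omega),
      Function.update_of_ne (by omega)]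
  refine Wp.seq (Wp.block (Wp.seq (Wp.ifNat (fun h1 => Wp.ifNat (fun h2 => Wp.block (Wp.block ?_))
    fun h2 => Wp.ifReal (fun h3 => Wp.block (Wp.block ?_)) fun h3 => Wp.block (Wp.block ?_))
    fun h1 => Wp.block (Wp.block ?_))))
  · simp only [evalList, Instr.eval, List.length_nil, List.length_cons] at h1 h2 ⊢
    refine ⟨by simp, fun r hr => hframe hr (by omega) (by omega) (by omega) (by omega), trivial, trivial,
      by simp [h5], Or.inr ?_⟩
    simp [h5, h6] at h1 h2 ⊢
    refine ⟨h1, fun c hc hcu => ?_⟩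
    rcases hinv with ⟨_, g⟩ | ⟨g, _⟩
    · by_cases hc' : c = σ.nat 32
      · rw [hc']
      · exact absurd hcu (g c (by omega))
    · omega
  · simp only [evalList, Instr.eval, List.length_nil, List.length_cons] at h1 h2 h3 ⊢
    refine ⟨by simp, fun r hr => hframe hr (by omega) (by omega) (by omega) (by omega), trivial, trivial,
      by simp [h5], Or.inr ?_⟩
    simp [h5, h6] at h1 h2 h3 ⊢
    refine ⟨h1, fun c hc hcu => ?_⟩
    rcases hinv with ⟨g, _⟩ | ⟨_, _, _, g1, g2⟩
    · omega
    · by_cases hc' : c = σ.nat 32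
      · rw [hc']
      · rw [g1] at h3
        exact (g2 c (by omega) hcu).trans h3.le
  · simp only [evalList, Instr.eval, List.length_nil, List.length_cons] at h1 h2 h3 ⊢
    refine ⟨by simp, fun r hr => hframe' hr (by omega) (by omega) (by omega), trivial, trivial,
      by simp [h5], Or.inr ?_⟩
    simp [h5] at h1 h2 h3 ⊢
    rcases hinv with ⟨g, _⟩ | ⟨g0, g3, g4, g1, g2⟩
    · omega
    · refine ⟨g0, by omega, g4, g1, fun c hc hcu => ?_⟩
      by_cases hc' : c = σ.nat 32
      · rw [hc', ← g1]; exact h3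
      · exact g2 c (by omega) hcu
  · simp only [evalList, Instr.eval, List.length_nil, List.length_cons] at h1 ⊢
    refine ⟨by simp, fun r hr => hframe' hr (by omega) (by omega) (by omega), trivial, trivial,
      by simp [h5], ?_⟩
    simp [h5] at h1
    have h1' : σ.natArr 4 (σ.nat 32) ≠ 0 := by omega
    unfold ScanInv at hinv ⊢
    simp [h5]
    rcases hinv with ⟨g, g'⟩ | ⟨g0, g3, g4, g1, g2⟩
    · refine Or.inl ⟨g, fun c hc => ?_⟩
      by_cases hc' : c = σ.nat 32
      · rw [hc']; exact h1'
      · exact g' c (by omega)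
    · refine Or.inr ⟨g0, by omega, g4, g1, fun c hc hcu => ?_⟩
      by_cases hc' : c = σ.nat 32
      · rw [hc'] at hcu; exact absurd hcu h1'
      · exact g2 c (by omega) hcu

theorem wp_pickCmd {pos : ℕ → ℕ} (h5 : σ.nat 5 = 1) (h6 : σ.nat 6 = 0)
    (hinv : SelInv (σ.nat 12) (σ.nat 31) (σ.natArr 4) (σ.realArr 6) pos)
    (ho : σ.nat 31 < σ.nat 12) :
    Wp T pickCmd σ fun τ k => k ≤ 10 * σ.nat 12 + 12 ∧ (∀ r < 31, τ.nat r = σ.nat r) ∧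
      τ.nat 31 = σ.nat 31 + 1 ∧ (∀ a, a ≠ 0 → a ≠ 4 → τ.natArr a = σ.natArr a) ∧
      (∀ a, a ≠ 2 → a ≠ 3 → τ.realArr a = σ.realArr a) ∧
      ∃ b, SelInv (σ.nat 12) (σ.nat 31 + 1) (τ.natArr 4) (τ.realArr 6)
          (Function.update pos (σ.nat 31) b) ∧
        τ.natArr 0 = Function.update (σ.natArr 0) (σ.nat 31) (σ.natArr 2 b) ∧
        τ.realArr 2 = Function.update (σ.realArr 2) (σ.nat 31) (σ.realArr 4 b) ∧
        τ.realArr 3 = Function.update (σ.realArr 3) (σ.nat 31) (σ.realArr 5 b) := by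
  set n := σ.nat 12 with hn
  refine Wp.seq (Wp.block ?_)
  simp only [evalList, Instr.eval, List.length_nil, List.length_cons]
  refine Wp.seq (Wp.while (n₀ := 10 * n) (fun m τ => m = 10 * (n - τ.nat 32) ∧
    (∀ r < 32, τ.nat r = σ.nat r) ∧ τ.natArr = σ.natArr ∧ τ.realArr = σ.realArr ∧ τ.nat 32 ≤ n ∧
    ScanInv (σ.natArr 4) (σ.realArr 6) τ) ?_ ?_ ?_)
  · refine ⟨by simp, fun r hr => ?_, rfl, rfl, by simp, Or.inl (by simp)⟩
    simp only
    rw [Function.update_of_ne (by omega), Function.update_of_ne (by omega),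
      Function.update_of_ne (by omega)]
  · rintro m τ ⟨rfl, f1, f2, f3, f4, f5⟩ hlt
    rw [f1 12 (by omega), ← hn] at hlt
    refine (wp_scanCmd (by rw [f1 5 (by omega), h5]) (by rw [f1 6 (by omega), h6])
      (by rwa [f2, f3])).mono ?_
    rintro υ k ⟨g1, g2, g3, g4, g5, g6⟩
    rw [f2, f3] at g6
    exact ⟨10 * (n - υ.nat 32), by omega, rfl, fun r hr => (g2 r hr).trans (f1 r hr), g3.trans f2,
      g4.trans f3, by omega, g6⟩
  · rintro m τ k ⟨rfl, f1, f2, f3, f4, f5⟩ hlt hk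
    rw [f1 12 (by omega), ← hn] at hlt
    have h32 : τ.nat 32 = n := by omega
    have e31 : τ.nat 31 = σ.nat 31 := f1 31 (by omega)
    have e5 : τ.nat 5 = 1 := by rw [f1 5 (by omega), h5]
    obtain ⟨c, hc, hcu⟩ := hinv.exists_unused ho
    rcases f5 with ⟨_, g⟩ | ⟨g0, g3, g4, g1, g2⟩
    · exact absurd hcu (g c (by omega))
    · rw [h32] at g3 g2
      refine Wp.block ?_
      simp only [evalList, Instr.eval, List.length_nil, List.length_cons]
      refine ⟨by omega, fun r hr => ?_, by simp [e31, e5], fun a h0 h4 => ?_, fun a h2' h3' => ?_,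
        τ.nat 34, ?_, ?_, ?_, ?_⟩
      · rw [Function.update_of_ne (by omega), Function.update_of_ne (by omega), f1 r (by omega)]
      · simp [setEntry_apply, h0, h4, f2]
      · simp [setEntry_apply, h2', h3', f3]
      · simp [setEntry_apply, f2, f3, e5]
        exact hinv.pick g3 g4 g2
      · simp [setEntry_apply, f2, e31]
      · simp [setEntry_apply, f3, e31]
      · simp [setEntry_apply, f3, e31]

/-- A full scan for each of the at most `2s` outputs is affordable, because `4sn ≤ Kn ≤ 2m'` in the
application. The marks in array `4` again rely on memory that starts at `0`. -/
theorem wp_selectCmd (h5 : σ.nat 5 = 1) (h6 : σ.nat 6 = 0) (h4 : σ.natArr 4 = 0) :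
    Wp T selectCmd σ fun τ k => k ≤ (2 * σ.nat 1) * (10 * σ.nat 12 + 13) + 6 ∧
      τ.nat 0 = min (2 * σ.nat 1) (σ.nat 12) ∧
      ∃ pos used, SelInv (σ.nat 12) (τ.nat 0) used (σ.realArr 6) pos ∧
        ∀ i < τ.nat 0, τ.natArr 0 i = σ.natArr 2 (pos i) ∧ τ.realArr 2 i = σ.realArr 4 (pos i) ∧
          τ.realArr 3 i = σ.realArr 5 (pos i) := by
  set n := σ.nat 12 with hn
  set l := 2 * σ.nat 1 with hl
  have main : ∀ υ : Store, (∀ r < 29, υ.nat r = σ.nat r) → υ.nat 30 = min l n → υ.nat 31 = 0 →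
      υ.natArr = σ.natArr → υ.realArr = σ.realArr →
      Wp T (.seq (.whileNat 31 30 pickCmd) (block (.natAdd 0 31 6) [])) υ fun τ k =>
        k ≤ l * (10 * n + 13) + 2 ∧ τ.nat 0 = min l n ∧
        ∃ pos used, SelInv n (τ.nat 0) used (σ.realArr 6) pos ∧
          ∀ i < τ.nat 0, τ.natArr 0 i = σ.natArr 2 (pos i) ∧ τ.realArr 2 i = σ.realArr 4 (pos i) ∧
            τ.realArr 3 i = σ.realArr 5 (pos i) := by
    intro υ u1 u2 u3 u4 u5
    refine Wp.seq (Wp.while (n₀ := min l n * (10 * n + 13)) (fun m τ =>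
      m = (min l n - τ.nat 31) * (10 * n + 13) ∧ τ.nat 31 ≤ min l n ∧
      (∀ r < 29, τ.nat r = σ.nat r) ∧ τ.nat 30 = min l n ∧
      (∀ a, a ≠ 0 → a ≠ 4 → τ.natArr a = σ.natArr a) ∧
      (∀ a, a ≠ 2 → a ≠ 3 → τ.realArr a = σ.realArr a) ∧
      ∃ pos, SelInv n (τ.nat 31) (τ.natArr 4) (σ.realArr 6) pos ∧
        ∀ i < τ.nat 31, τ.natArr 0 i = σ.natArr 2 (pos i) ∧ τ.realArr 2 i = σ.realArr 4 (pos i) ∧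
          τ.realArr 3 i = σ.realArr 5 (pos i)) ?_ ?_ ?_)
    · refine ⟨by simp [u3], by omega, u1, u2, fun a _ _ => by rw [u4], fun a _ _ => by rw [u5],
        id, ⟨?_, ?_, ?_, ?_⟩, ?_⟩ <;> simp [u3, u4, h4]
    · rintro m τ ⟨rfl, f1, f2, f3, f4, f5, pos, f6, f7⟩ hlt
      rw [f3] at hlt
      have e12 : τ.nat 12 = n := f2 12 (by omega)
      refine (wp_pickCmd (pos := pos) (by rw [f2 5 (by omega), h5]) (by rw [f2 6 (by omega), h6])
        (by rw [e12, f5 6 (by omega) (by omega)]; exact f6) (by omega)).mono ?_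
      rintro κ k ⟨g1, g2, g3, g4, g5, b, g6, g7, g8, g9⟩
      rw [e12] at g1 g6
      rw [g5 6 (by omega) (by omega), f5 6 (by omega) (by omega)] at g6
      rw [f4 2 (by omega) (by omega)] at g7
      rw [f5 4 (by omega) (by omega)] at g8
      rw [f5 5 (by omega) (by omega)] at g9
      refine ⟨(min l n - κ.nat 31) * (10 * n + 13), ?_, rfl, by omega,
        fun r hr => (g2 r (by omega)).trans (f2 r hr), (g2 30 (by omega)).trans f3,
        fun a h0 h4 => (g4 a h0 h4).trans (f4 a h0 h4),
        fun a h2 h3 => (g5 a h2 h3).trans (f5 a h2 h3), _, by rw [g3]; exact g6, ?_⟩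
      · have : min l n - τ.nat 31 = min l n - κ.nat 31 + 1 := by omega
        rw [this, add_mul, one_mul]
        omega
      · rw [g3, g7, g8, g9]
        intro i hi
        by_cases hi' : i = τ.nat 31
        · subst hi'; simp
        · simp only [Function.update_of_ne hi']
          exact f7 i (by omega)
    · rintro m τ k ⟨rfl, f1, f2, f3, f4, f5, pos, f6, f7⟩ hlt hk
      rw [f3] at hlt
      have e31 : τ.nat 31 = min l n := by omega
      have e6 : τ.nat 6 = 0 := by rw [f2 6 (by omega), h6]
      refine Wp.block ?_
      simp only [evalList, Instr.eval, List.length_nil, Function.update_self, e6, add_zero]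
      refine ⟨?_, e31, pos, _, f6, f7⟩
      have : min l n * (10 * n + 13) ≤ l * (10 * n + 13) := Nat.mul_le_mul_right _ (min_le_left _ _)
      omega
  refine Wp.seq (Wp.block (Wp.seq (Wp.ifNat (fun h => Wp.block ((main _ ?_ ?_ ?_ ?_ ?_).mono ?_))
    fun h => Wp.block ((main _ ?_ ?_ ?_ ?_ ?_).mono ?_))))
  all_goals simp [evalList, Instr.eval, ← hn, h6] at h ⊢
  · intro r hr
    rw [Function.update_of_ne (by omega), Function.update_of_ne (by omega),
      Function.update_of_ne (by omega)]
  · omega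
  · intro τ k a1 a2 pos used a3 a4
    exact ⟨by omega, a2, pos, ⟨used, a3⟩, a4⟩
  · intro r hr
    rw [Function.update_of_ne (by omega), Function.update_of_ne (by omega),
      Function.update_of_ne (by omega)]
  · omega
  · intro τ k a1 a2 pos used a3 a4
    exact ⟨by omega, a2, pos, ⟨used, a3⟩, a4⟩

end

/-! ### The decoder -/

/-- The decoder: collect candidates, estimate their entries, and output the largest ones. -/
def decoderCmd : Cmd :=
  .seq candidatesCmd <| .seq halfCmd <| .seq estimatesCmd selectCmd

theorem sum_testBit (j n : ℕ) :
    ∑ a ∈ Finset.range n, (if j.testBit a then 2 ^ a else 0) = j % 2 ^ n := by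
  induction n with
  | zero => simp [Nat.mod_one]
  | succ n ih =>
    rw [Finset.sum_range_succ, ih, Nat.mod_pow_succ, Nat.testBit_eq_decide_div_mod_eq]
    rcases Nat.mod_two_eq_zero_or_one (j / 2 ^ n) with h | h <;> simp [h]

section

variable {m' N s K : ℕ}

theorem initStore_realArr (y : Fin m' × Fin (2 * bitRows N) → ℂ) {i k : ℕ} (hi : i < m')
    (hk : k < 2 * bitRows N) :
    (initStore N s K y).realArr 0 (i * (2 * bitRows N) + k) = (rowEntry y i k).re ∧
      (initStore N s K y).realArr 1 (i * (2 * bitRows N) + k) = (rowEntry y i k).im := by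
  have hlt : i * (2 * bitRows N) + k < m' * (2 * bitRows N) := by
    calc i * (2 * bitRows N) + k < i * (2 * bitRows N) + 2 * bitRows N := by omega
      _ = (i + 1) * (2 * bitRows N) := by ring
      _ ≤ _ := Nat.mul_le_mul_right _ hi
  have hsymm : finProdFinEquiv.symm (⟨i * (2 * bitRows N) + k, hlt⟩ : Fin (m' * (2 * bitRows N))) =
      (⟨i, hi⟩, ⟨k, hk⟩) := by
    rw [Equiv.symm_apply_eq]
    ext
    simp [mul_comm, add_comm]
  constructor <;> simp [initStore, padded, hlt, hsymm, rowEntry, hi, hk, -finProdFinEquiv_symm_apply]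

theorem energy_initStore (y : Fin m' × Fin (2 * bitRows N) → ℂ) {i k : ℕ} (hi : i < m')
    (hk : k < 2 * bitRows N) :
    energy (initStore N s K y) (i * (2 * bitRows N) + k) = ‖rowEntry y i k‖ ^ 2 := by
  obtain ⟨h1, h2⟩ := initStore_realArr (s := s) (K := K) y hi hk
  rw [energy, h1, h2, Complex.sq_norm, Complex.normSq_apply]

/-- The tests give `j` modulo `2 ^ (bitRows N - 1)`, and this power is at least `N > j`. Comparing
squared moduli is equivalent to comparing moduli. -/
theorem decodeBits_of_rowDecodes (y : Fin m' × Fin (2 * bitRows N) → ℂ) {i j : ℕ} (hi : i < m')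
    (hj : j < N) (h : RowDecodes y i j) :
    decodeBits (energy (initStore N s K y)) (bitRows N) (i * (2 * bitRows N)) = j := by
  have hb : bitRows N - 1 = Nat.clog 2 N := by simp [bitRows]
  have hjb : j % 2 ^ (bitRows N - 1) = j := by
    rw [hb]; exact Nat.mod_eq_of_lt (hj.trans_le (Nat.le_pow_clog (by omega) N))
  refine Eq.trans ?_ ((sum_testBit j _).trans hjb)
  refine Finset.sum_congr rfl fun a ha => ?_
  have ha' : a + 1 < bitRows N := by have := Finset.mem_range.1 ha; omega
  have h1 := h a ha'
  rw [add_assoc, energy_initStore y hi (by omega), energy_initStore y hi (by omega)]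
  congr 1
  rw [eq_iff_iff, sq_lt_sq₀ (norm_nonneg _) (norm_nonneg _)]
  split_ifs at h1 with hbit
  · simp [hbit, h1]
  · simp [hbit, h1.le]

theorem columnTable_spec {W : Matrix (Fin m') (Fin N) ℕ} {j : Fin N}
    (hones : (Finset.univ.filter fun i => W i j = 1).card = K) :
    (∀ x < K, ∃ h : columnTable W j x < m', W ⟨columnTable W j x, h⟩ j = 1) ∧
      Set.InjOn (columnTable W j) (Set.Iio K) := by
  classical
  set p : ℕ → Prop := fun i => ∃ (hi : i < m') (hj : j.val < N), W ⟨i, hi⟩ ⟨j.val, hj⟩ = 1 with hp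
  have hfin : (Set.ofPred p).Finite := (Set.finite_lt_nat m').subset fun i hi => hi.1
  have hcard : hfin.toFinset.card = K := by
    rw [← hones]
    refine (Finset.card_bij (fun i _ => i.val) ?_ ?_ ?_).symm
    · intro i hi
      exact hfin.mem_toFinset.2 ⟨i.isLt, j.isLt, (Finset.mem_filter.1 hi).2⟩
    · intro a _ b _ h; exact Fin.ext h
    · intro i hi
      obtain ⟨hi1, hi2, h⟩ := hfin.mem_toFinset.1 hi
      exact ⟨⟨i, hi1⟩, by simpa using h, rfl⟩
  constructor
  · intro x hx
    have := Nat.nth_mem_of_lt_card hfin (n := x) (hx.trans_eq hcard.symm)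
    obtain ⟨h1, h2, h3⟩ := this
    exact ⟨h1, h3⟩
  · have := Nat.nth_injOn hfin
    rw [hcard] at this
    exact this

/-- The table enumerates `K` ones of the column without repetition, so counts over positions `x < K`
are bounded by counts over rows; the definition of a median asks only for lower bounds. -/
theorem IsMedian.isColumnMedian {W : Matrix (Fin m') (Fin N) ℕ} {j : Fin N}
    (hones : (Finset.univ.filter fun i => W i j = 1).card = K) {z : Fin m' → ℝ} {f : ℕ → ℝ} {v : ℝ}
    (h : IsMedian K f v)
    (hf : ∀ x < K, ∀ h : columnTable W j x < m', f x = z ⟨columnTable W j x, h⟩) :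
    IsColumnMedian K W z j v := by
  classical
  obtain ⟨h1, h2⟩ := columnTable_spec hones
  have key : ∀ P : ℝ → Prop, ∀ [DecidablePred P],
      ((Finset.range K).filter fun x => P (f x)).card ≤
        (Finset.univ.filter fun i => W i j = 1 ∧ P (z i)).card := by
    intro P _
    rw [← Finset.card_map Fin.valEmbedding]
    refine Finset.card_le_card_of_injOn (columnTable W j) ?_ ?_
    · intro x hx
      simp only [Finset.coe_filter, Finset.mem_range, Set.mem_ofPred_eq] at hx
      obtain ⟨h3, h4⟩ := h1 x hx.1
      simp only [Finset.coe_map, Set.mem_image, Finset.mem_coe, Finset.mem_filter, Finset.mem_univ,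
        true_and, Fin.valEmbedding_apply]
      exact ⟨⟨_, h3⟩, ⟨h4, by rw [← hf x hx.1 h3]; exact hx.2⟩, rfl⟩
    · intro x hx x' hx' hxx
      simp only [Finset.coe_filter, Finset.mem_range, Set.mem_ofPred_eq] at hx hx'
      exact h2 hx.1 hx'.1 hxx
  exact ⟨h.1.trans (Nat.mul_le_mul_left 2 (key fun t => t ≤ v)),
    h.2.trans (Nat.mul_le_mul_left 2 (key fun t => v ≤ t))⟩

/-- From the data computed by the machine to the recovered vector. -/
theorem exists_isRecovery {W : Matrix (Fin m') (Fin N) ℕ}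
    {y : Fin m' × Fin (2 * bitRows N) → ℂ} {n k : ℕ} {cand cnt pos used : ℕ → ℕ}
    {re im mag : ℕ → ℝ} {τ : Store}
    (hcand : CandInv (fun x => decodeBits (energy (initStore N s K y)) (bitRows N)
      (x * (2 * bitRows N))) K N m' n cand cnt)
    (hre : ∀ c < n, ∀ h : cand c < N,
      IsColumnMedian K W (fun i => (rowEntry y i 0).re) ⟨cand c, h⟩ (re c))
    (him : ∀ c < n, ∀ h : cand c < N,
      IsColumnMedian K W (fun i => (rowEntry y i 0).im) ⟨cand c, h⟩ (im c))
    (hmag : ∀ c < n, mag c = re c * re c + im c * im c)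
    (hlen : τ.nat 0 = min k n) (hsel : SelInv n (τ.nat 0) used mag pos)
    (hout : ∀ i < τ.nat 0, τ.natArr 0 i = cand (pos i) ∧ τ.realArr 2 i = re (pos i) ∧
      τ.realArr 3 i = im (pos i)) :
    ∃ x, IsRecovery K k W y x ∧ ListsVector k τ x := by
  classical
  set o := τ.nat 0 with ho
  -- The estimates are stored by position in the candidate list; `cand` is injective on the list, so
  -- the chosen position is the right one.
  let est : Fin N → ℂ := fun j => if h : ∃ c < n, cand c = j.val then
    ⟨re h.choose, im h.choose⟩ else 0
  have hest : ∀ c < n, ∀ h : cand c < N, est ⟨cand c, h⟩ = ⟨re c, im c⟩ := by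
    intro c hc h
    have hex : ∃ c' < n, cand c' = cand c := ⟨c, hc, rfl⟩
    have : hex.choose = c := hcand.inj _ hex.choose_spec.1 _ hc hex.choose_spec.2
    simp only [est]
    rw [dif_pos hex, this]
  have hnorm : ∀ c < n, ∀ h : cand c < N, ‖est ⟨cand c, h⟩‖ ^ 2 = mag c := by
    intro c hc h
    rw [hest c hc h, hmag c hc, Complex.sq_norm, Complex.normSq_apply]
  set R : Finset (Fin N) := Finset.univ.filter fun j => ∃ c < n, cand c = j.val with hR
  set S : Finset (Fin N) := Finset.univ.filter fun j => ∃ i < o, cand (pos i) = j.val with hS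
  have hlt : ∀ i < o, cand (pos i) < N := fun i hi => (hcand.mem _ (hsel.lt i hi)).1
  have hinj : ∀ i < o, ∀ l < o, cand (pos i) = cand (pos l) → i = l := fun i hi l hl h =>
    hsel.inj i hi l hl (hcand.inj _ (hsel.lt i hi) _ (hsel.lt l hl) h)
  have hScard : S.card = o := by
    rw [← Finset.card_range o]
    refine (Finset.card_bij (fun i hi => (⟨cand (pos i), hlt i (Finset.mem_range.1 hi)⟩ : Fin N))
      ?_ ?_ ?_).symm
    · intro i hi
      simp only [hS, Finset.mem_filter, Finset.mem_univ, true_and]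
      exact ⟨i, Finset.mem_range.1 hi, rfl⟩
    · intro i hi l hl h
      exact hinj i (Finset.mem_range.1 hi) l (Finset.mem_range.1 hl) (Fin.mk.inj h)
    · intro j hj
      simp only [hS, Finset.mem_filter, Finset.mem_univ, true_and] at hj
      obtain ⟨i, hi, h⟩ := hj
      exact ⟨i, Finset.mem_range.2 hi, Fin.ext h⟩
  have hSR : S ⊆ R := by
    intro j hj
    simp only [hS, hR, Finset.mem_filter, Finset.mem_univ, true_and] at hj ⊢
    obtain ⟨i, hi, h⟩ := hj
    exact ⟨_, hsel.lt i hi, h⟩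
  refine ⟨fun j => if j ∈ S then est j else 0, ⟨R, S, est, ?_, ?_, hSR, by omega, ?_, ?_, rfl⟩, ?_⟩
  · intro j hj
    simp only [hR, Finset.mem_filter, Finset.mem_univ, true_and]
    refine hcand.complete j j.isLt (hj.trans_le (Nat.mul_le_mul_left 2 ?_))
    rw [votes, ← Finset.card_map Fin.valEmbedding]
    refine Finset.card_le_card fun i hi => ?_
    simp only [Finset.mem_map, Finset.mem_filter, Finset.mem_univ, true_and,
      Fin.valEmbedding_apply] at hi
    obtain ⟨i, hi, rfl⟩ := hi
    simp only [Finset.mem_filter, Finset.mem_range]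
    exact ⟨i.isLt, decodeBits_of_rowDecodes y i.isLt j.isLt hi⟩
  · intro j hj
    simp only [hR, Finset.mem_filter, Finset.mem_univ, true_and] at hj
    obtain ⟨c, hc, h⟩ := hj
    have hcN : cand c < N := h ▸ j.isLt
    have hj' : j = ⟨cand c, hcN⟩ := Fin.ext h.symm
    rw [hj', hest c hc hcN]
    exact ⟨hre c hc hcN, him c hc hcN⟩
  -- If there are at most `k` candidates, all of them are kept; otherwise exactly `k`.
  · rcases le_total n k with h | h
    · left
      refine Finset.eq_of_subset_of_card_le hSR ?_
      rw [hScard]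
      have h1 : R.map Fin.valEmbedding ⊆ (Finset.range n).image cand := by
        intro a ha
        simp only [hR, Finset.mem_map, Finset.mem_filter, Finset.mem_univ, true_and,
          Fin.valEmbedding_apply] at ha
        obtain ⟨j, ⟨c, hc, hcj⟩, rfl⟩ := ha
        exact Finset.mem_image.2 ⟨c, Finset.mem_range.2 hc, hcj⟩
      have h2 := (Finset.card_le_card h1).trans Finset.card_image_le
      rw [Finset.card_map, Finset.card_range] at h2
      omega
    · right; omega
  · intro j hj l hl
    simp only [hR, hS, Finset.mem_sdiff, Finset.mem_filter, Finset.mem_univ, true_and] at hj hl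
    obtain ⟨⟨c, hc, hcj⟩, hjS⟩ := hj
    obtain ⟨i, hi, hil⟩ := hl
    have hcN : cand c < N := hcj ▸ j.isLt
    have hj' : j = ⟨cand c, hcN⟩ := Fin.ext hcj.symm
    have hl' : l = ⟨cand (pos i), hlt i hi⟩ := Fin.ext hil.symm
    rw [← sq_le_sq₀ (norm_nonneg _) (norm_nonneg _), hj', hl', hnorm c hc hcN,
      hnorm _ (hsel.lt i hi) (hlt i hi)]
    refine hsel.max c hc ((hsel.used_iff c hc).2 fun i' hi' hic => hjS ⟨i', hi', ?_⟩) i hi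
    rw [hic, hcj]
  · refine ⟨by omega, fun i hi => ?_, fun i hi l hl h => ?_, fun j i hi h => ?_, fun j h => ?_⟩
    · rw [(hout i hi).1]; exact hlt i hi
    · rw [(hout i hi).1, (hout l hl).1] at h
      exact hinj i hi l hl h
    · rw [(hout i hi).1] at h
      have hj' : j = ⟨cand (pos i), hlt i hi⟩ := Fin.ext h.symm
      have hjS : j ∈ S := by
        simp only [hS, Finset.mem_filter, Finset.mem_univ, true_and]
        exact ⟨i, hi, h⟩
      simp only
      rw [if_pos hjS, hj', hest _ (hsel.lt i hi), (hout i hi).2.1, (hout i hi).2.2]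
    · simp only
      rw [if_neg]
      intro hjS
      simp only [hS, Finset.mem_filter, Finset.mem_univ, true_and] at hjS
      obtain ⟨i, hi, h'⟩ := hjS
      exact h i hi (by rw [(hout i hi).1, h'])

theorem wp_decoderCmd {W : Matrix (Fin m') (Fin N) ℕ} (hK : 0 < K)
    (hones : ∀ j, (Finset.univ.filter fun i => W i j = 1).card = K)
    (y : Fin m' × Fin (2 * bitRows N) → ℂ) :
    Wp (columnTable W) decoderCmd (initStore N s K y) fun τ k =>
      (∃ n, n * K ≤ 2 * m' ∧ n ≤ N ∧ k ≤ m' * (17 * bitRows N + 21) + 4 * K +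
        n * (72 * K * Nat.clog 2 K + 12 * K + 21) + 2 * s * (10 * n + 13) + 16) ∧
      ∃ x, IsRecovery K (2 * s) W y x ∧ ListsVector (2 * s) τ x := by
  set σ := initStore N s K y with hσ
  refine Wp.seq ((wp_candidatesCmd rfl rfl).mono ?_)
  rintro τ₁ k₁ ⟨a1, a2, a3, a4, a5, a6, a7, cnt, a8⟩
  have s0 : σ.nat 0 = N := rfl
  have s1 : σ.nat 1 = s := rfl
  have s2 : σ.nat 2 = K := rfl
  have s3 : σ.nat 3 = m' := rfl
  have s4 : σ.nat 4 = bitRows N := rfl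
  have s6 : σ.nat 6 = 0 := rfl
  rw [s3, s4] at a1 a7
  rw [s0, s2, s3, s4] at a8
  refine Wp.seq ((wp_halfCmd a3).mono ?_)
  rintro τ₂ k₂ ⟨b1, b2, b3, b4, b5⟩
  have t2 : τ₁.nat 2 = K := by rw [a2 2 (by omega), s2]
  rw [t2] at b1 b5
  have c2 : τ₂.nat 2 = K := by rw [b2 2 (by omega) (by omega), t2]
  have c5 : τ₂.nat 5 = 1 := by rw [b2 5 (by omega) (by omega), a3]
  have c6 : τ₂.nat 6 = 0 := by rw [b2 6 (by omega) (by omega), a4 6 (by omega), s6]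
  have c12 : τ₂.nat 12 = τ₁.nat 12 := b2 12 (by omega) (by omega)
  refine Wp.seq ((wp_estimatesCmd c5 c6 (by rw [b5, c2]) (by rw [c2]; exact hK)).mono ?_)
  rintro τ₃ k₃ ⟨d1, d2, d3, d4, d5⟩
  rw [c12, c2] at d1 d5
  refine (wp_selectCmd (by rw [d2 5 (by omega), c5]) (by rw [d2 6 (by omega), c6])
    (by rw [d3, b3, a5 4 (by omega)]; rfl)).mono ?_
  rintro τ k₄ ⟨e1, e2, pos, used, e3, e4⟩
  have f1 : τ₃.nat 1 = s := by rw [d2 1 (by omega), b2 1 (by omega) (by omega), a2 1 (by omega), s1]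
  have f12 : τ₃.nat 12 = τ₁.nat 12 := by rw [d2 12 (by omega), c12]
  rw [f1, f12] at e1 e2
  rw [f12] at e3
  refine ⟨⟨τ₁.nat 12, a8.length_mul_le, a8.length_le, by omega⟩, ?_⟩
  have harr : τ₃.natArr 2 = τ₁.natArr 2 := by rw [d3, b3]
  rw [harr] at e4
  rw [b3, b4, a6] at d5
  have hb := bitRows_pos N
  have hrow : ∀ j : Fin N, ∀ x < K, ∀ h : columnTable W j x < m',
      τ₁.natArr 3 (columnTable W j x) = columnTable W j x * (2 * bitRows N) + 0 :=
    fun j x _ h => by rw [a7 _ h, add_zero]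
  refine exists_isRecovery a8 (fun c hc h => ?_) (fun c hc h => ?_) (fun c hc => (d5 c hc).2.2)
    e2 e3 e4
  · refine (d5 c hc).1.isColumnMedian (hones _) fun x hx hlt => ?_
    have := hrow ⟨_, h⟩ x hx hlt
    simp only at this hlt ⊢
    rw [this, (initStore_realArr y hlt (by omega)).1]
  · refine (d5 c hc).2.1.isColumnMedian (hones _) fun x hx hlt => ?_
    have := hrow ⟨_, h⟩ x hx hlt
    simp only at this hlt ⊢
    rw [this, (initStore_realArr y hlt (by omega)).2]

end

/-! ### Parameters -/

/-- The parameter `K` is not polynomially bounded in `N`, since `p` may be tiny. If `K ≤ N²`, then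
`log K` is `O(log N)` and `nK ≤ 2m'` suffices. Otherwise `n ≤ N ≤ √K` and `log₂ K ≤ 2√K` up to
rounding, so the product is at most `2K² ≤ 2m'`. -/
theorem mul_mul_clog_le {n K N m' : ℕ} (h1 : n * K ≤ 2 * m') (h2 : n ≤ N) (h3 : K ^ 2 ≤ m') :
    n * K * Nat.clog 2 K ≤ 4 * (m' * bitRows N) := by
  have hb := bitRows_pos N
  rcases le_total K (N ^ 2) with h | h
  · have h4 : Nat.clog 2 K ≤ 2 * bitRows N := by
      refine (Nat.clog_le_iff_le_pow one_lt_two).2 (h.trans ?_)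
      calc N ^ 2 ≤ (2 ^ Nat.clog 2 N) ^ 2 :=
            Nat.pow_le_pow_left (Nat.le_pow_clog one_lt_two N) 2
        _ = 2 ^ (2 * Nat.clog 2 N) := by rw [← pow_mul, mul_comm]
        _ ≤ 2 ^ (2 * bitRows N) := Nat.pow_le_pow_right two_pos (by rw [bitRows]; omega)
    calc n * K * Nat.clog 2 K ≤ 2 * m' * (2 * bitRows N) := Nat.mul_le_mul h1 h4
      _ = _ := by ring
  · set a := Nat.sqrt K with ha
    have h4 : Nat.clog 2 K ≤ 2 * a := by
      refine (Nat.clog_le_iff_le_pow one_lt_two).2 ?_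
      calc K ≤ (a + 1) ^ 2 := by rw [sq]; exact (Nat.lt_succ_sqrt K).le
        _ ≤ (2 ^ a) ^ 2 := Nat.pow_le_pow_left Nat.lt_two_pow_self 2
        _ = 2 ^ (2 * a) := by rw [← pow_mul, mul_comm]
    have h5 : n ≤ a := h2.trans (Nat.le_sqrt'.2 h)
    have h6 : a * a ≤ K := Nat.sqrt_le K
    calc n * K * Nat.clog 2 K ≤ a * K * (2 * a) :=
          Nat.mul_le_mul (Nat.mul_le_mul_right K h5) h4
      _ = 2 * (K * (a * a)) := by ring
      _ ≤ 2 * (K * K) := by gcongr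
      _ = 2 * K ^ 2 := by ring
      _ ≤ 4 * (m' * bitRows N) := by nlinarith

/-- Every term is at most a multiple of `m' * bitRows N`: sorting by `mul_mul_clog_le`, selection by
`4sn ≤ nK ≤ 2m'`, and the lower-order terms by `K ≤ m'` and `2m' ≤ m' * bitRows N`. -/
theorem decoder_steps_le {n K N m' s k : ℕ} (hs : 4 * s ≤ K) (hK : 1 ≤ K) (hb : 2 ≤ bitRows N)
    (h1 : n * K ≤ 2 * m') (h2 : n ≤ N) (h3 : K ^ 2 ≤ m')
    (hk : k ≤ m' * (17 * bitRows N + 21) + 4 * K + n * (72 * K * Nat.clog 2 K + 12 * K + 21) +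
      2 * s * (10 * n + 13) + 16) :
    k ≤ 200 * (m' * (2 * bitRows N)) := by
  have h4 := mul_mul_clog_le h1 h2 h3
  have h5 : K ≤ m' := (Nat.le_self_pow two_ne_zero K).trans h3
  have h6 : 4 * s * n ≤ K * n := Nat.mul_le_mul_right n hs
  have h7 : n ≤ n * K := Nat.le_mul_of_pos_right n hK
  have h8 : m' * 2 ≤ m' * bitRows N := Nat.mul_le_mul_left m' hb
  have e : m' * (17 * bitRows N + 21) + 4 * K + n * (72 * K * Nat.clog 2 K + 12 * K + 21) +
      2 * s * (10 * n + 13) + 16 = 17 * (m' * bitRows N) + 21 * m' + 4 * K +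
        72 * (n * K * Nat.clog 2 K) + 12 * (n * K) + 21 * n + 5 * (4 * s * n) + 26 * s + 16 := by
    ring
  have e' : 200 * (m' * (2 * bitRows N)) = 400 * (m' * bitRows N) := by ring
  rw [mul_comm K n] at h6
  omega

theorem bitRows_le_mul_log {N : ℕ} (hN : 2 ≤ N) : (bitRows N : ℝ) ≤ 6 * Real.log N := by
  have hlog : 1 ≤ Nat.log 2 N := Nat.log_pos one_lt_two hN
  have h1 : bitRows N ≤ 3 * Nat.log 2 N := by
    have : Nat.clog 2 N ≤ Nat.log 2 N + 1 :=
      (Nat.clog_le_iff_le_pow one_lt_two).2 (Nat.lt_pow_succ_log_self one_lt_two N).le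
    rw [bitRows]; omega
  have h2 : (Nat.log 2 N : ℝ) * Real.log 2 ≤ Real.log N := by
    rw [← Real.log_pow]
    refine Real.log_le_log (by positivity) ?_
    exact_mod_cast Nat.pow_log_le_self 2 (by omega)
  have h3 : (1 : ℝ) / 2 ≤ Real.log 2 := by have := Real.log_two_gt_d9; linarith
  calc (bitRows N : ℝ) ≤ 3 * Nat.log 2 N := by exact_mod_cast h1
    _ ≤ 6 * (Nat.log 2 N * Real.log 2) := by
      have : (0 : ℝ) ≤ Nat.log 2 N := by positivity
      nlinarith
    _ ≤ 6 * Real.log N := by linarith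

end SublinearSketch

/-! ### Choice of the parameters and assembly of the theorem. -/

theorem mainTheorem9 :
    ∃ (C : ℝ) (decoder : Cmd), 0 < C ∧
      ∀ (N r s q : ℕ) (p : ℝ), 2 ≤ N → r ∈ Finset.Icc 1 N → s ∈ Finset.Icc 1 N →
        q ∈ Finset.Icc 1 N → p ∈ Set.Ioo (0 : ℝ) 1 →
      -- `ε = 1 / q`
      ∀ (ε : ℝ) (L t K : ℕ), ε = 1 / (q : ℝ) →
        L = ⌈Real.log (231 * (N : ℝ) / p)⌉₊ →
        t = max (4 * s) (512 * r * L * q) →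
        K = t * Nat.clog t N →
      ∃ (m' : ℕ) (W : Matrix (Fin m') (Fin N) ℕ)
        (f : (Fin m' × Fin (2 * bitRows N) → ℂ) → Fin N → ℂ),
        -- the matrix `W`
        IsCoherent W K (Nat.log K N) ∧
        (∀ j, (Finset.univ.filter fun i => W i j = 1).card = K) ∧
        (∃ α : ℕ, 4 * α * s + 1 ≤ K ∧ IsCoherent W K α) ∧
        HasRIP (64 * r * L) (ε / 8) (toComplex (baseSketch K W)) ∧
        -- the number of measurements
        (m' : ℝ) ≤ C * (K : ℝ) ^ 2 ∧
        ((m' * (2 * bitRows N) : ℕ) : ℝ) ≤ C * (K : ℝ) ^ 2 * Real.log N ∧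
        -- the running time and the sparsity of the decoder
        ComputesSparse decoder s K W f (2 * s) (C * ((m' * (2 * bitRows N) : ℕ) : ℝ)) ∧
        -- (i)
        (∀ (A U V : Matrix (Fin N) (Fin N) ℂ) (σ : Fin N → ℝ), IsSVD A U σ V →
          ∀ (Ω : Type*) [MeasurableSpace Ω] (P : Measure Ω) [IsProbabilityMeasure P]
            (ξ : Fin N → Ω → ℝ), (∀ i, Measurable (ξ i)) → iIndepFun ξ P →
            (∀ i, P.map (ξ i) = rademacher) →
            ENNReal.ofReal (1 - p) ≤
              P {ω | SatisfiesJLAssumptions (toComplex (sketch K W fun i => ξ i ω)) U σ V r ε}) ∧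
        -- (ii)
        (∀ d : Fin N → ℝ, (∀ i, d i = 1 ∨ d i = -1) →
          ∀ (u : Fin N → ℂ) (n : Fin m' × Fin (2 * bitRows N) → ℂ),
            lpNormVec 2 (u - fun i => ((scale N K * d i : ℝ) : ℂ) *
                f ((toComplex (sketch K W d)).mulVec u + n) i) ≤
              bestApproxError 2 (2 * s) u +
                6 * (1 + Real.sqrt 2) *
                  (bestApproxError 1 s u / Real.sqrt s +
                    beta N s K n * lpNormVec 2 n)) := by

  classical
  refine ⟨200, decoderCmd, by norm_num, ?_⟩
  intro N r s q p hN hr hs hq hp ε L t K hε hL ht hKdef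
  obtain ⟨hr1, -⟩ := Finset.mem_Icc.1 hr
  obtain ⟨hs1, -⟩ := Finset.mem_Icc.1 hs
  obtain ⟨hq1, -⟩ := Finset.mem_Icc.1 hq
  obtain ⟨hp0, hp1⟩ := hp
  have hLlog : Real.log (231 * (N : ℝ) / p) ≤ L := hL ▸ Nat.le_ceil _
  have hN2 : (2 : ℝ) ≤ N := by exact_mod_cast hN
  have hL1 : 1 ≤ L := by
    rw [hL, Nat.one_le_ceil_iff]
    refine Real.log_pos ?_
    rw [one_lt_div hp0]
    linarith
  have hts : 4 * s ≤ t := ht ▸ le_max_left _ _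
  have htr : 512 * r * L * q ≤ t := ht ▸ le_max_right _ _
  have ht2 : 2 ≤ t := by omega
  set d := Nat.clog t N with hd
  have hd1 : 1 ≤ d := Nat.clog_pos ht2 hN
  have htK : t ≤ K := by rw [hKdef]; exact Nat.le_mul_of_pos_right t hd1
  have hK2 : 2 ≤ K := ht2.trans htK
  have hK0 : 0 < K := by omega
  obtain ⟨q', W, hq1', hq2', hones, hW⟩ := exists_coherent_matrix hN hK2
  set α := Nat.clog K N - 1 with hα
  -- The logarithm decreases with the base and `t ≤ K`, so `⌈log_K N⌉ ≤ ⌈log_t N⌉`. This is why `K`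
  -- carries the factor `⌈log_t N⌉`.
  have hαd : α + 1 ≤ d := by
    have h1 : Nat.clog K N ≤ d := Nat.clog_anti_left ht2 htK
    have h2 : 0 < Nat.clog K N := Nat.clog_pos hK2 hN
    omega
  have hαK : 4 * α * s + 1 ≤ K := by
    calc 4 * α * s + 1 ≤ 4 * s * (α + 1) := by nlinarith
      _ ≤ t * d := Nat.mul_le_mul hts hαd
      _ = K := hKdef.symm
  have hm1 : K ^ 2 ≤ K * q' := by rw [sq]; exact Nat.mul_le_mul_left K hq1'
  have hm2 : K * q' ≤ 2 * K ^ 2 := by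
    calc K * q' ≤ K * (2 * K) := Nat.mul_le_mul_left K hq2'
      _ = _ := by ring
  have hq0 : (0 : ℝ) < q := by exact_mod_cast hq1
  have hε0 : 0 < ε := by rw [hε]; positivity
  have hμ0 : (0 : ℝ) ≤ (α : ℝ) / K := by positivity
  -- With `ε = 1 / q` the claim is `512 r L q α ≤ K`, which follows from `512 r L q ≤ t` and `α ≤
  -- d`.
  have hμ : 512 * (r : ℝ) * L * ((α : ℝ) / K) ≤ ε := by
    rw [hε, mul_div_assoc', div_le_div_iff₀ (by exact_mod_cast hK0) hq0]
    have : 512 * r * L * α * q ≤ 1 * K := by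
      calc 512 * r * L * α * q = 512 * r * L * q * α := by ring
        _ ≤ t * d := Nat.mul_le_mul htr (by omega)
        _ = 1 * K := by rw [one_mul, hKdef]
    exact_mod_cast this
  have hoff := abs_offGram_baseSketch_le hK0 hW
  have hnorm := sum_baseSketch_sq hK0 hW.zero_or_one hones
  have hb2 : 2 ≤ bitRows N := by
    have := Nat.clog_pos (b := 2) one_lt_two hN
    rw [bitRows]; omega
  have hdec : ∀ y : Fin (K * q') × Fin (2 * bitRows N) → ℂ, ∃ x : Fin N → ℂ,
      IsRecovery K (2 * s) W y x ∧ ∃ (τ : Store) (k : ℕ),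
        Exec (columnTable W) decoderCmd (initStore N s K y) τ k ∧
          k ≤ 200 * (K * q' * (2 * bitRows N)) ∧ ListsVector (2 * s) τ x := by
    intro y
    obtain ⟨τ, k, hexec, ⟨n, h1, h2, hk⟩, x, hx, hlist⟩ := wp_decoderCmd (s := s) hK0 hones y
    exact ⟨x, hx, τ, k, hexec, decoder_steps_le (hts.trans htK) hK0 hb2 h1 h2 hm1 hk, hlist⟩
  -- The choice depends on `y` and on data fixed together with `W`, but not on the signs, `u`, the
  -- noise or `A`.
  choose f hf hrun using hdec
  refine ⟨K * q', W, f, hW.mono (clog_sub_one_le_log hK2 hN), hones, ⟨α, hαK, hW⟩, ?_, ?_, ?_, ?_,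
    ?_, ?_⟩
  -- The requirement `64 r L α / K ≤ ε / 8` is `hμ` divided by `8`.
  · refine hasRIP_of_offGram_le hnorm hμ0 hoff ?_
    push_cast
    linarith
  · have : ((K * q' : ℕ) : ℝ) ≤ 2 * (K : ℝ) ^ 2 := by exact_mod_cast hm2
    nlinarith [sq_nonneg (K : ℝ)]
  · have h1 : ((K * q' : ℕ) : ℝ) ≤ 2 * (K : ℝ) ^ 2 := by exact_mod_cast hm2
    have h2 := bitRows_le_mul_log hN
    have h3 : 0 ≤ Real.log N := Real.log_nonneg (by linarith)
    rw [Nat.cast_mul (K * q'), Nat.cast_mul 2, Nat.cast_two]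
    calc ((K * q' : ℕ) : ℝ) * (2 * bitRows N) ≤ 2 * (K : ℝ) ^ 2 * (2 * (6 * Real.log N)) := by
          gcongr
      _ = 24 * ((K : ℝ) ^ 2 * Real.log N) := by ring
      _ ≤ 200 * ((K : ℝ) ^ 2 * Real.log N) := by gcongr; norm_num
      _ = _ := by ring
  · intro y
    obtain ⟨τ, k, hexec, hk, hlist⟩ := hrun y
    exact ⟨τ, k, hexec, by exact_mod_cast hk, hlist⟩
  · intro A U V σ hSVD Ω _ P _ ξ hmeas hind hlaw
    exact le_measure_satisfiesJLAssumptions hr1 hL1 hnorm hμ0 hε0 hp0 hp1 hoff hμ hLlog hSVD P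
      hmeas hind hlaw
  · intro d hd u n
    exact recovery_error_le_bestApproxError hs1 hW hones hαK hd u n (hf _)
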